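/- Call a group \emph{constructible} if it belongs to the smallest class of groups (closed under isomorphism) which contains the trivial group and is closed under finite extensions (if $N$ is a normal subgroup of finite index in $G$ and $N$ is in the class, then so is $G$) and under HNN extensions (if $H$ is in the class, then so is every HNN extension of $H$). For $n\in\mathbb{Z}$ let $BS(1,n)=\langle a,t\mid tat^{-1}=a^n\rangle$ be the Baumslag--Solitar group, and let $\pi_1(Kb)=BS(1,-1)$ be the fundamental group of the Klein bottle. For an injective endomorphism $\varphi$ of a group $H$, let $H*_\varphi=\langle H,t\mid txt^{-1}=\varphi(x)\ \text{for all } x\in H\rangle$ be the ascending HNN extension with base $H$; it is \emph{properly ascending} if $\varphi$ is not surjective. \textbf{Theorem.} Let $G$ be a torsion-free elementary amenable group of Hirsch length $3$. Then $G$ is constructible if and only if at least one of the following holds: (1) $G\cong BS(1,n)\rtimes_\theta\mathbb{Z}$ for some integer $n\ne 0,1,-1$ and some $\theta\in\mathrm{Aut}(BS(1,n))$; (2) $G\cong H*_\varphi$ is a properly ascending HNN extension with base $H\cong\mathbb{Z}^2$ or $H\cong\pi_1(Kb)$; (3) $G$ is polycyclic. -/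

import Mathlib

universe u

/-- The class of elementary amenable groups: the smallest class of groups (closed under
isomorphism) that contains the finite groups and the abelian groups and is closed under
subgroups, quotients, extensions and directed unions. -/
inductive IsElementaryAmenable : (G : Type u) → [Group G] → Prop
  | finite (G : Type u) [Group G] (hG : Finite G) : IsElementaryAmenable G
  | abelian (G : Type u) [Group G] (hG : ∀ x y : G, x * y = y * x) : IsElementaryAmenable G
  | subgroup (G H : Type u) [Group G] [Group H] (f : H →* G) (hf : Function.Injective f)
      (hG : IsElementaryAmenable G) : IsElementaryAmenable H
  | quotient (G Q : Type u) [Group G] [Group Q] (f : G →* Q) (hf : Function.Surjective f)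
      (hG : IsElementaryAmenable G) : IsElementaryAmenable Q
  | extension (G : Type u) [Group G] (N : Subgroup G) [N.Normal]
      (hN : IsElementaryAmenable N) (hQ : IsElementaryAmenable (G ⧸ N)) : IsElementaryAmenable G
  | directedUnion (G : Type u) [Group G] (S : Set (Subgroup G)) (hne : S.Nonempty)
      (hdir : DirectedOn (· ≤ ·) S) (hS : ∀ K ∈ S, IsElementaryAmenable K)
      (hunion : sSup S = ⊤) : IsElementaryAmenable G

/-- `HasHirschLength G h`: the group `G` has Hirsch length `h`. The Hirsch length of an
elementary amenable group is determined by the rules: finite groups have length `0`, the infinite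
cyclic group has length `1`, it is additive in extensions, and the length of a group is the
supremum of the lengths of its finitely generated subgroups. -/
inductive HasHirschLength : (G : Type u) → [Group G] → ℕ∞ → Prop
  | finite (G : Type u) [Group G] (hG : Finite G) : HasHirschLength G 0
  | infiniteCyclic (G : Type u) [Group G] (e : G ≃* Multiplicative ℤ) : HasHirschLength G 1
  | extension (G : Type u) [Group G] (N : Subgroup G) [N.Normal] (a b : ℕ∞)
      (hN : HasHirschLength N a) (hQ : HasHirschLength (G ⧸ N) b) : HasHirschLength G (a + b)
  | supFG (G : Type u) [Group G] (l : Subgroup G → ℕ∞)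
      (hl : ∀ F : Subgroup G, F.FG → HasHirschLength F (l F)) :
      HasHirschLength G (⨆ (F : Subgroup G) (_ : F.FG), l F)

/-- The class of constructible groups: the smallest class of groups (closed under isomorphism)
that contains the trivial group and is closed under finite extensions and HNN extensions. -/
inductive IsConstructible : (G : Type u) → [Group G] → Prop
  | trivial (G : Type u) [Group G] (hG : Subsingleton G) : IsConstructible G
  | finiteExtension (G : Type u) [Group G] (N : Subgroup G) [N.Normal] (hfin : N.FiniteIndex)
      (hN : IsConstructible N) : IsConstructible G
  | hnnExtension (G H : Type u) [Group G] [Group H] (A B : Subgroup H) (φ : A ≃* B)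
      (e : G ≃* HNNExtension H A B φ) (hH : IsConstructible H) : IsConstructible G

/-- Polycyclic groups: those with a finite subnormal series with cyclic factors. -/
inductive IsPolycyclic : (G : Type u) → [Group G] → Prop
  | trivial (G : Type u) [Group G] (hG : Subsingleton G) : IsPolycyclic G
  | step (G : Type u) [Group G] (N : Subgroup G) [N.Normal] (hN : IsPolycyclic N)
      (hQ : IsCyclic (G ⧸ N)) : IsPolycyclic G

/-- The Baumslag-Solitar group `BS(m,n) = ⟨a, t ∣ t a^m t⁻¹ = a^n⟩`, with `a` and `t` the
generators indexed by `0` and `1`. -/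
abbrev BaumslagSolitar (m n : ℤ) : Type :=
  PresentedGroup ({FreeGroup.of 1 * FreeGroup.of 0 ^ m * (FreeGroup.of 1)⁻¹ *
    (FreeGroup.of 0 ^ n)⁻¹} : Set (FreeGroup (Fin 2)))

/-- The fundamental group of the Klein bottle, `⟨a, t ∣ t a t⁻¹ = a⁻¹⟩`. -/
abbrev KleinBottleGroup : Type := BaumslagSolitar 1 (-1)

/-- The ascending HNN extension `⟨H, t ∣ t x t⁻¹ = φ x for all x ∈ H⟩` of the group `H` along an
injective endomorphism `φ`. -/
abbrev AscendingHNN (H : Type u) [Group H] (φ : H →* H) (hφ : Function.Injective φ) : Type u :=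
  HNNExtension H ⊤ φ.range (Subgroup.topEquiv.trans (MonoidHom.ofInjective hφ))

/-- `G` is isomorphic to a properly ascending HNN extension with base `H`: the injective
endomorphism of `H` is not an automorphism. -/
def IsProperlyAscendingHNN (H : Type) [Group H] (G : Type u) [Group G] : Prop :=
  ∃ (φ : H →* H) (hφ : Function.Injective φ),
    ¬ Function.Surjective φ ∧ Nonempty (G ≃* AscendingHNN H φ hφ)

-- The listed groups are constructible because a polycyclic group arises by finite extensions and
-- mapping tori (`IsPolycyclic.isConstructible`), while the other two families are HNN extensions,
-- once or twice iterated, over polycyclic groups.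
--
-- For the converse, an HNN extension whose associated subgroups are both proper contains a free
-- group of rank two, and such a group has infinite Hirsch length (`HNNExtension.eq_top_or_eq_top`).
-- Hence a torsion-free constructible group of finite positive length has a finite-index subgroup
-- that is an ascending HNN extension of a constructible group of length one less. Length one leaves
-- only `ℤ`. Length two leaves virtually abelian groups and groups `C⟨u⟩` of Baumslag-Solitar type,
-- with `C` normal, self-centralizing and of rank one (`IsConstructible.of_hirschLength_eq_two`). In
-- length three the base of the HNN extension is of one of these two kinds.
--
-- The difficulty is to pass from the finite-index subgroup to `G`. The tool is `IsContracted K L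
-- g`: the subgroup `K` is the ascending union of the conjugates `g⁻ⁿ L gⁿ`. Unlike the base of an
-- HNN extension, such a union can often be recognised invariantly, as the centralizer of a
-- commutator subgroup, and contraction survives passage to finite-index overgroups, to roots of `g`
-- and to elements with the same action. Torsion-freeness enters through the transfer: a
-- torsion-free group with centre of finite index is abelian, so the centralizer `C` in `G` of the
-- recognised subgroup `K` is abelian, normal and contains `K` with finite index
-- (`centralizer_comm_of_finiteIndex`).
--
-- If `C` has rank one and is self-centralizing, then `G/C` is torsion-free abelian; a root `u` of
-- the contracting element gives an isolated subgroup `C⟨u⟩`, which is `BS(1,r)` with quotient `ℤ`,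
-- unless `r = ±1` and `G` is polycyclic (`semidirectProduct_or_isPolycyclic`).
--
-- If the base is virtually abelian of rank two, either a power of the stable letter of a
-- finite-index normal subgroup centralizes its commutator subgroup, or `C` has rank two and the
-- stable letter generates a normal infinite cyclic subgroup of finite index in `G/C`. In the latter
-- case, if that subgroup is central, a transfer splits off `ℤ` and leaves a base `ℤ²` or the Klein
-- bottle group; if not, the stable letter is inverted modulo `C`, so `C` is contracted in both
-- directions, hence finitely generated, and `G` is polycyclic. In the former case `G` has all
-- subgroups finitely generated, and what is left is solvability, which comes from finite subgroups
-- of `GL₂(ℤ)` and `GL₃(ℤ)` (`Group.isSolvable_of_injective_GL`).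
--
-- If the base is of Baumslag-Solitar type, the union `A` of the conjugates of its rank-one subgroup
-- is either self-centralizing, which is the rank-one case, or commutes with an element outside it,
-- which yields a new base that is abelian of rank two (`exists_isAscending_of_centralizing`).

universe v

open Function

/-! ### Preliminaries on finitely generated subgroups -/

namespace Subgroup

theorem FG.map_hom {G K : Type*} [Group G] [Group K] {F : Subgroup G} (hF : F.FG) (f : G →* K) :
    (F.map f).FG := by
  classical
  obtain ⟨S, rfl⟩ := hF
  exact ⟨S.image f, by simp [MonoidHom.map_closure]⟩

theorem FG.exists_map_eq {G K : Type*} [Group G] [Group K] {f : G →* K} (hf : Surjective f)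
    {F : Subgroup K} (hF : F.FG) : ∃ F' : Subgroup G, F'.FG ∧ F'.map f = F := by
  classical
  obtain ⟨S, rfl⟩ := hF
  refine ⟨closure (S.image (surjInv hf)), ⟨_, rfl⟩, ?_⟩
  rw [MonoidHom.map_closure, Finset.coe_image, Set.image_image]
  simp [surjInv_eq hf]

end Subgroup

theorem MonoidHom.subgroupComap_injective {G K : Type*} [Group G] [Group K] {f : K →* G}
    (hf : Injective f) (N : Subgroup G) : Injective (f.subgroupComap N) := fun _ _ hxy =>
  Subtype.ext (hf (congrArg Subtype.val hxy))

/-! ### Hirsch length: monotonicity, additivity, uniqueness of the value -/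

namespace HasHirschLength

theorem exists_le_of_fg {G : Type u} [Group G] {c : ℕ∞}
    (h : ∀ F : Subgroup G, F.FG → ∃ b ≤ c, HasHirschLength F b) :
    ∃ b ≤ c, HasHirschLength G b := by
  classical
  refine ⟨_, ?_, supFG G (fun F => if hF : F.FG then (h F hF).choose else 0) ?_⟩
  · refine iSup₂_le fun F hF => ?_
    rw [dif_pos hF]
    exact (h F hF).choose_spec.1
  · intro F hF
    rw [dif_pos hF]
    exact (h F hF).choose_spec.2

theorem exists_le_one_of_isCyclic (G : Type u) [Group G] [IsCyclic G] :
    ∃ b ≤ 1, HasHirschLength G b := by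
  rcases finite_or_infinite G with h | h
  · exact ⟨0, zero_le, finite G h⟩
  · exact ⟨1, le_rfl, infiniteCyclic G intCyclicMulEquiv.symm⟩

/-- Uniqueness of the length is not available at this stage, so each rule is followed down to the
subgroup and produces some derivable value that is no larger. -/
theorem exists_le_of_injective {G : Type u} [Group G] {a : ℕ∞} (h : HasHirschLength G a) :
    ∀ {K : Type u} [Group K] (f : K →* G), Injective f → ∃ b ≤ a, HasHirschLength K b := by
  induction h with
  | finite G hG => exact fun f hf => ⟨0, le_rfl, finite _ (Finite.of_injective f hf)⟩
  | infiniteCyclic G e =>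
    intro K _ f hf
    have : IsCyclic K := isCyclic_of_injective (e.toMonoidHom.comp f) (e.injective.comp hf)
    exact exists_le_one_of_isCyclic K
  | extension G N a b _ _ ihN ihQ =>
    intro K _ f hf
    obtain ⟨a', ha', hN'⟩ := ihN (f.subgroupComap N) (MonoidHom.subgroupComap_injective hf N)
    obtain ⟨b', hb', hQ'⟩ := ihQ (QuotientGroup.map (N.comap f) N f le_rfl) (by
      rw [injective_iff_map_eq_one]
      intro x
      induction x using QuotientGroup.induction_on with
      | H x => simp)
    exact ⟨a' + b', add_le_add ha' hb', extension K (N.comap f) a' b' hN' hQ'⟩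
  | supFG G l _ ih =>
    intro K _ f hf
    apply exists_le_of_fg
    intro F hF
    obtain ⟨b, hb, hb'⟩ := ih (F.map f) (hF.map_hom f) (f.subgroupMap F) (fun x y hxy => by
      apply Subtype.ext; apply hf; simpa using congrArg Subtype.val hxy)
    exact ⟨b, hb.trans (le_iSup₂_of_le (F.map f) (hF.map_hom f) le_rfl), hb'⟩

theorem exists_le_of_surjective {G : Type u} [Group G] {a : ℕ∞} (h : HasHirschLength G a) :
    ∀ {Q : Type u} [Group Q] (f : G →* Q), Surjective f → ∃ b ≤ a, HasHirschLength Q b := by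
  induction h with
  | finite G hG => exact fun f hf => ⟨0, le_rfl, finite _ (Finite.of_surjective f hf)⟩
  | infiniteCyclic G e =>
    intro Q _ f hf
    have : IsCyclic Q := isCyclic_of_surjective (f.comp e.symm.toMonoidHom)
      (hf.comp e.symm.surjective)
    exact exists_le_one_of_isCyclic Q
  | extension G N a b _ _ ihN ihQ =>
    intro Q _ f hf
    have : (N.map f).Normal := Subgroup.Normal.map inferInstance f hf
    obtain ⟨a', ha', hN'⟩ := ihN ((f.subgroupMap N)) (f.subgroupMap_surjective N)
    obtain ⟨b', hb', hQ'⟩ := ihQ (QuotientGroup.map N (N.map f) f (N.le_comap_map f)) (by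
      intro x
      induction x using QuotientGroup.induction_on with
      | H x =>
        obtain ⟨y, rfl⟩ := hf x
        exact ⟨y, rfl⟩)
    exact ⟨a' + b', add_le_add ha' hb', extension Q (N.map f) a' b' hN' hQ'⟩
  | supFG G l _ ih =>
    intro Q _ f hf
    apply exists_le_of_fg
    intro F hF
    obtain ⟨F', hF', rfl⟩ := hF.exists_map_eq hf
    obtain ⟨b, hb, hb'⟩ := ih F' hF' (f.subgroupMap F') (f.subgroupMap_surjective F')
    exact ⟨b, hb.trans (le_iSup₂_of_le F' hF' le_rfl), hb'⟩

end HasHirschLength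

/-- The Hirsch length as a function: the least value allowed by the defining rules (which turns
out to be the only one), and `⊤` if there is none. -/
noncomputable def hirschLength (G : Type u) [Group G] : ℕ∞ := sInf {a | HasHirschLength G a}

namespace HasHirschLength

theorem hirschLength_le {G : Type u} [Group G] {a : ℕ∞} (h : HasHirschLength G a) :
    hirschLength G ≤ a := sInf_le h

theorem hirschLength {G : Type u} [Group G] {a : ℕ∞} (h : HasHirschLength G a) :
    HasHirschLength G (hirschLength G) := csInf_mem (s := {a | HasHirschLength G a}) ⟨a, h⟩

end HasHirschLength

theorem hirschLength_le_of_fg {G : Type u} [Group G] {a c : ℕ∞} (hG : HasHirschLength G a)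
    (h : ∀ F : Subgroup G, F.FG → hirschLength F ≤ c) : hirschLength G ≤ c := by
  obtain ⟨b, hb, hb'⟩ := HasHirschLength.exists_le_of_fg (G := G) (c := c) fun F hF =>
    ⟨_, h F hF, ((hG.exists_le_of_injective F.subtype F.subtype_injective).choose_spec.2).hirschLength⟩
  exact hb'.hirschLength_le.trans hb

theorem hirschLength_le_iSup_fg {G : Type u} [Group G] {a : ℕ∞} (hG : HasHirschLength G a) :
    hirschLength G ≤ ⨆ F : {F : Subgroup G // F.FG}, hirschLength F.1 :=
  hirschLength_le_of_fg hG fun F hF =>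
    le_iSup (fun F : {F : Subgroup G // F.FG} => hirschLength F.1) ⟨F, hF⟩

theorem hirschLength_le_add (G : Type u) [Group G] (N : Subgroup G) [N.Normal] :
    hirschLength G ≤ hirschLength N + hirschLength (G ⧸ N) := by
  by_cases h1 : ∃ a, HasHirschLength N a
  · by_cases h2 : ∃ b, HasHirschLength (G ⧸ N) b
    · obtain ⟨a, ha⟩ := h1
      obtain ⟨b, hb⟩ := h2
      exact (HasHirschLength.extension G N _ _ ha.hirschLength hb.hirschLength).hirschLength_le
    · have : hirschLength (G ⧸ N) = ⊤ := sInf_eq_top.2 fun a ha => absurd ⟨a, ha⟩ h2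
      simp [this]
  · have : hirschLength N = ⊤ := sInf_eq_top.2 fun a ha => absurd ⟨a, ha⟩ h1
    simp [this]

namespace HasHirschLength

theorem hirschLength_le_of_injective {G K : Type u} [Group G] [Group K] {a : ℕ∞}
    (h : HasHirschLength G a) (f : K →* G) (hf : Injective f) : _root_.hirschLength K ≤ a := by
  obtain ⟨b, hb, hb'⟩ := h.exists_le_of_injective f hf
  exact hb'.hirschLength_le.trans hb

theorem hirschLength_le_of_surjective {G Q : Type u} [Group G] [Group Q] {a : ℕ∞}
    (h : HasHirschLength G a) (f : G →* Q) (hf : Surjective f) : _root_.hirschLength Q ≤ a := by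
  obtain ⟨b, hb, hb'⟩ := h.exists_le_of_surjective f hf
  exact hb'.hirschLength_le.trans hb

theorem finite_hirschLength (G : Type u) [Group G] [hG : Finite G] : _root_.hirschLength G = 0 :=
  le_antisymm (finite G hG).hirschLength_le zero_le

/-- Superadditivity is the content of uniqueness, since the extension rule by itself only bounds the
least value from above. The induction is on the derivation for the middle group, with the exact
sequence left arbitrary. -/
theorem add_le {G : Type u} [Group G] {a : ℕ∞} (h : HasHirschLength G a) :
    ∀ {K Q : Type u} [Group K] [Group Q] (i : K →* G) (f : G →* Q), Injective i → Surjective f →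
      i.range = f.ker → _root_.hirschLength K + _root_.hirschLength Q ≤ a := by
  induction h with
  | finite G hG =>
    intro K Q _ _ i f hi hf _
    have := Finite.of_injective i hi
    have := Finite.of_surjective f hf
    simp [finite_hirschLength]
  | infiniteCyclic G e =>
    intro K Q _ _ i f hi hf hif
    have hG : HasHirschLength G 1 := infiniteCyclic G e
    rcases subsingleton_or_nontrivial K with hK | hK
    · rw [finite_hirschLength K, zero_add]
      exact hG.hirschLength_le_of_surjective f hf
    · have : Finite Q := by
        obtain ⟨k, hk⟩ := exists_ne (1 : K)
        have hcy : IsCyclic Q := isCyclic_of_surjective (f.comp e.symm.toMonoidHom)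
          (hf.comp e.symm.surjective)
        have hcy' : IsCyclic G := isCyclic_of_surjective e.symm.toMonoidHom e.symm.surjective
        obtain ⟨g, hg⟩ := hcy'.exists_zpow_surjective
        obtain ⟨n, hn⟩ := hg (i k)
        have hn0 : n ≠ 0 := by
          rintro rfl
          exact hk (hi (by simpa using hn.symm))
        have h1 : f g ^ n = 1 := by
          rw [← map_zpow, show g ^ n = i k from hn]
          exact (hif ▸ ⟨k, rfl⟩ : i k ∈ f.ker)
        have h2 : IsOfFinOrder (f g) := isOfFinOrder_iff_zpow_eq_one.2 ⟨n, hn0, h1⟩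
        have h3 : Finite (Subgroup.zpowers (f g)) := finite_zpowers.2 h2
        refine Finite.of_surjective (fun x : Subgroup.zpowers (f g) => (x : Q)) fun q => ?_
        obtain ⟨x, rfl⟩ := hf q
        obtain ⟨m, rfl⟩ := hg x
        exact ⟨⟨f g ^ m, m, rfl⟩, by simp⟩
      rw [finite_hirschLength Q, add_zero]
      exact hG.hirschLength_le_of_injective i hi
  -- The 3×3 diagram: `N` cuts the sequence into `K ∩ N → N → f(N)` and `K/(K ∩ N) → G/N → Q/f(N)`,
  -- both exact.
  | extension G N a b hNa hQb ihN ihQ =>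
    intro K Q _ _ i f hi hf hif
    have : (N.map f).Normal := Subgroup.Normal.map inferInstance f hf
    have hker : ∀ g, f g = 1 ↔ ∃ k, i k = g := fun g => by
      rw [← MonoidHom.mem_ker, ← hif]; rfl
    have h1 := ihN (i.subgroupComap N) (f.subgroupMap N) (MonoidHom.subgroupComap_injective hi N)
      (f.subgroupMap_surjective N) (by
        ext ⟨x, hx⟩
        simp only [MonoidHom.mem_range, MonoidHom.mem_ker, Subtype.ext_iff]
        simp only [Subtype.exists,
          Subgroup.mem_comap, MonoidHom.subgroupMap_apply_coe, Subgroup.coe_one, hker]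
        constructor
        · rintro ⟨k, _, hk⟩; exact ⟨k, hk⟩
        · rintro ⟨k, rfl⟩; exact ⟨k, hx, rfl⟩)
    have h2 := ihQ (QuotientGroup.map (N.comap i) N i le_rfl)
      (QuotientGroup.map N (N.map f) f (N.le_comap_map f))
      (by
        rw [injective_iff_map_eq_one]
        intro x
        induction x using QuotientGroup.induction_on with
        | H x => simp)
      (by
        intro x
        induction x using QuotientGroup.induction_on with
        | H x =>
          obtain ⟨y, rfl⟩ := hf x
          exact ⟨y, rfl⟩)
      (by
        ext x
        induction x using QuotientGroup.induction_on with
        | H x =>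
          simp only [MonoidHom.mem_range, MonoidHom.mem_ker, QuotientGroup.map_mk,
            QuotientGroup.eq_one_iff, Subgroup.mem_map]
          constructor
          · rintro ⟨y, hy⟩
            induction y using QuotientGroup.induction_on with
            | H y =>
              rw [QuotientGroup.map_mk, QuotientGroup.eq] at hy
              refine ⟨_, hy, ?_⟩
              rw [map_mul, map_inv, (hker (i y)).2 ⟨y, rfl⟩]; simp
          · rintro ⟨n, hn, hfn⟩
            obtain ⟨k, hk⟩ := (hker (x * n⁻¹)).1 (by rw [map_mul, map_inv, hfn]; simp)
            refine ⟨(k : K ⧸ N.comap i), ?_⟩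
            rw [QuotientGroup.map_mk, hk, QuotientGroup.eq]
            have : (x * n⁻¹)⁻¹ * x = n := by group
            rwa [this])
    calc _ ≤ (_root_.hirschLength (N.comap i) + _root_.hirschLength (K ⧸ N.comap i)) +
          (_root_.hirschLength (N.map f) + _root_.hirschLength (Q ⧸ N.map f)) :=
          add_le_add (hirschLength_le_add _ _) (hirschLength_le_add _ _)
      _ = (_root_.hirschLength (N.comap i) + _root_.hirschLength (N.map f)) +
          (_root_.hirschLength (K ⧸ N.comap i) + _root_.hirschLength (Q ⧸ N.map f)) := by
          abel
      _ ≤ a + b := add_le_add h1 h2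
  | supFG G l hl ih =>
    intro K Q _ _ i f hi hf hif
    have hG := supFG G l hl
    have hker : ∀ g, f g = 1 ↔ ∃ k, i k = g := fun g => by
      rw [← MonoidHom.mem_ker, ← hif]; rfl
    obtain ⟨bK, _, hK⟩ := hG.exists_le_of_injective i hi
    obtain ⟨bQ, _, hQ⟩ := hG.exists_le_of_surjective f hf
    refine (add_le_add (hirschLength_le_iSup_fg hK) (hirschLength_le_iSup_fg hQ)).trans ?_
    have : Nonempty {F : Subgroup K // F.FG} := ⟨⟨⊥, Subgroup.FG.bot⟩⟩
    have : Nonempty {F : Subgroup Q // F.FG} := ⟨⟨⊥, Subgroup.FG.bot⟩⟩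
    refine ENat.iSup_add_iSup_le ?_
    rintro ⟨E, hE⟩ ⟨F, hF⟩
    -- A lift of `F` joined with `E` is a finitely generated subgroup of `G` that controls both
    -- suprema at once.
    obtain ⟨F', hF', rfl⟩ := hF.exists_map_eq hf
    have hM : (E.map i ⊔ F').FG := (hE.map_hom i).sup hF'
    refine le_trans ?_ (le_iSup₂_of_le (E.map i ⊔ F') hM le_rfl)
    set M := E.map i ⊔ F' with hMdef
    have h1 := ih M hM (i.subgroupComap M) (f.subgroupMap M) (MonoidHom.subgroupComap_injective hi M)
      (f.subgroupMap_surjective M) (by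
        ext ⟨x, hx⟩
        simp only [MonoidHom.mem_range, MonoidHom.mem_ker, Subtype.ext_iff]
        simp only [Subtype.exists,
          Subgroup.mem_comap, MonoidHom.subgroupMap_apply_coe, Subgroup.coe_one, hker]
        constructor
        · rintro ⟨k, _, hk⟩; exact ⟨k, hk⟩
        · rintro ⟨k, rfl⟩; exact ⟨k, hx, rfl⟩)
    refine le_trans (add_le_add ?_ ?_) h1
    · have hle : E ≤ M.comap i := fun x hx => hMdef ▸ Subgroup.mem_sup_left ⟨x, hx, rfl⟩
      exact ((hK.exists_le_of_injective _ (M.comap i).subtype_injective).choose_spec.2).hirschLength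
        |>.hirschLength_le_of_injective (Subgroup.inclusion hle) (Subgroup.inclusion_injective hle)
    · have hle : F'.map f ≤ M.map f := Subgroup.map_mono (hMdef ▸ le_sup_right)
      exact ((hQ.exists_le_of_injective _ (M.map f).subtype_injective).choose_spec.2).hirschLength
        |>.hirschLength_le_of_injective (Subgroup.inclusion hle) (Subgroup.inclusion_injective hle)

/-- This excludes length zero for the infinite cyclic group; later it turns quotients of length zero
into torsion groups. -/
theorem isOfFinOrder_of_eq_zero {G : Type u} [Group G] {a : ℕ∞} (h : HasHirschLength G a) :
    a = 0 → ∀ g : G, IsOfFinOrder g := by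
  induction h with
  | finite G hG => exact fun _ g => isOfFinOrder_of_finite g
  | infiniteCyclic G e => exact fun h => absurd h one_ne_zero
  | extension G N a b _ _ ihN ihQ =>
    intro h g
    obtain ⟨rfl, rfl⟩ := add_eq_zero.1 h
    obtain ⟨n, hn, hgn⟩ := isOfFinOrder_iff_pow_eq_one.1 (ihQ rfl (g : G ⧸ N))
    have hgN : g ^ n ∈ N := by
      rw [← QuotientGroup.eq_one_iff]; exact hgn
    obtain ⟨m, hm, hgm⟩ := isOfFinOrder_iff_pow_eq_one.1 (ihN rfl ⟨g ^ n, hgN⟩)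
    refine isOfFinOrder_iff_pow_eq_one.2 ⟨n * m, Nat.mul_pos hn hm, ?_⟩
    rw [pow_mul]
    simpa using congrArg Subtype.val hgm
  | supFG G l _ ih =>
    intro h g
    have hF : (Subgroup.zpowers g).FG := ⟨{g}, by simp [Subgroup.zpowers_eq_closure]⟩
    have h0 : l (Subgroup.zpowers g) = 0 :=
      le_antisymm ((le_iSup₂ (f := fun (F : Subgroup G) (_ : F.FG) => l F) _ hF).trans h.le)
        zero_le
    have := ih _ hF h0 ⟨g, Subgroup.mem_zpowers g⟩
    simpa using Submonoid.isOfFinOrder_coe.2 this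

theorem infiniteCyclic_hirschLength {G : Type u} [Group G] (e : G ≃* Multiplicative ℤ) :
    _root_.hirschLength G = 1 := by
  have h := infiniteCyclic G e
  refine le_antisymm h.hirschLength_le (Order.one_le_iff_ne_zero.2 fun h0 => ?_)
  have := h.hirschLength.isOfFinOrder_of_eq_zero h0 (e.symm (Multiplicative.ofAdd 1))
  rw [isOfFinOrder_iff_pow_eq_one] at this
  obtain ⟨n, hn, h1⟩ := this
  rw [← map_pow, ← ofAdd_nsmul, map_eq_one_iff _ e.symm.injective, ofAdd_eq_one] at h1
  simp at h1
  omega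

/-- The Hirsch length is well defined. -/
theorem eq_hirschLength {G : Type u} [Group G] {a : ℕ∞} (h : HasHirschLength G a) :
    a = _root_.hirschLength G := by
  induction h with
  | finite G hG => exact (finite_hirschLength G).symm
  | infiniteCyclic G e => exact (infiniteCyclic_hirschLength e).symm
  | extension G N a b hN hQ ihN ihQ =>
    have h := extension G N a b hN hQ
    refine le_antisymm ?_ h.hirschLength_le
    rw [ihN, ihQ]
    exact h.hirschLength.add_le N.subtype (QuotientGroup.mk' N) N.subtype_injective
      (QuotientGroup.mk'_surjective N) (by simp)
  | supFG G l hl ih =>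
    have h := supFG G l hl
    refine le_antisymm (iSup₂_le fun F hF => ?_) h.hirschLength_le
    rw [ih F hF]
    exact h.hirschLength.hirschLength_le_of_injective F.subtype F.subtype_injective

end HasHirschLength

namespace HasHirschLength

theorem of_mulEquiv {G K : Type u} [Group G] [Group K] {a : ℕ∞} (h : HasHirschLength G a)
    (e : G ≃* K) : HasHirschLength K a := by
  obtain ⟨b, hb, hK⟩ := h.exists_le_of_surjective e.toMonoidHom e.surjective
  obtain ⟨c, hc, hG⟩ := hK.exists_le_of_surjective e.symm.toMonoidHom e.symm.surjective
  have : a = c := by rw [h.eq_hirschLength, hG.eq_hirschLength]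
  rwa [le_antisymm (this ▸ hc) hb]

theorem of_exact {G K Q : Type u} [Group G] [Group K] [Group Q] {a b : ℕ∞} (i : K →* G)
    (f : G →* Q) (hi : Injective i) (hf : Surjective f) (hif : i.range = f.ker)
    (hK : HasHirschLength K a) (hQ : HasHirschLength Q b) : HasHirschLength G (a + b) := by
  refine extension G f.ker a b ?_ ?_
  · rw [← hif]
    exact hK.of_mulEquiv (MonoidHom.ofInjective hi)
  · exact hQ.of_mulEquiv (QuotientGroup.quotientKerEquivOfSurjective f hf).symm

end HasHirschLength

/-! ### Calculus of the Hirsch length as a function -/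

/-- A group to which the rules for the Hirsch length assign a value. -/
class HasHirsch (G : Type u) [Group G] : Prop where
  exists_hasHirschLength : ∃ a, HasHirschLength G a

section HasHirsch

variable {G : Type u} [Group G]

theorem hasHirschLength (G : Type u) [Group G] [h : HasHirsch G] :
    HasHirschLength G (hirschLength G) := h.exists_hasHirschLength.choose_spec.hirschLength

theorem HasHirsch.of_injective [HasHirsch G] {K : Type u} [Group K] (f : K →* G)
    (hf : Injective f) : HasHirsch K :=
  let ⟨b, _, hb⟩ := (hasHirschLength G).exists_le_of_injective f hf
  ⟨b, hb⟩

theorem HasHirsch.of_surjective [HasHirsch G] {K : Type u} [Group K] (f : G →* K)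
    (hf : Surjective f) : HasHirsch K :=
  let ⟨b, _, hb⟩ := (hasHirschLength G).exists_le_of_surjective f hf
  ⟨b, hb⟩

instance [HasHirsch G] (H : Subgroup G) : HasHirsch H := .of_injective _ H.subtype_injective

instance [HasHirsch G] (H : Subgroup G) [H.Normal] : HasHirsch (G ⧸ H) :=
  .of_surjective _ (QuotientGroup.mk'_surjective H)

theorem hirschLength_le_of_injective [HasHirsch G] {K : Type u} [Group K] (f : K →* G)
    (hf : Injective f) : hirschLength K ≤ hirschLength G :=
  (hasHirschLength G).hirschLength_le_of_injective f hf

theorem hirschLength_subgroup_le [HasHirsch G] (H : Subgroup G) :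
    hirschLength H ≤ hirschLength G :=
  hirschLength_le_of_injective H.subtype H.subtype_injective

theorem hirschLength_mono [HasHirsch G] {H K : Subgroup G} (h : H ≤ K) :
    hirschLength H ≤ hirschLength K :=
  hirschLength_le_of_injective (Subgroup.inclusion h) (Subgroup.inclusion_injective h)

theorem hirschLength_congr [HasHirsch G] {K : Type u} [Group K] (e : G ≃* K) :
    hirschLength G = hirschLength K :=
  ((hasHirschLength G).of_mulEquiv e).eq_hirschLength

theorem hirschLength_eq_add [HasHirsch G] (N : Subgroup G) [N.Normal] :
    hirschLength G = hirschLength N + hirschLength (G ⧸ N) :=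
  ((hasHirschLength N).extension G N _ _ (hasHirschLength (G ⧸ N))).eq_hirschLength.symm

theorem hirschLength_eq_ker_add [HasHirsch G] {Q : Type u} [Group Q] (f : G →* Q)
    (hf : Surjective f) : hirschLength G = hirschLength f.ker + hirschLength Q := by
  rw [hirschLength_eq_add f.ker,
    hirschLength_congr (QuotientGroup.quotientKerEquivOfSurjective f hf)]

theorem isOfFinOrder_of_hirschLength_eq_zero [HasHirsch G] (h : hirschLength G = 0) (g : G) :
    IsOfFinOrder g :=
  (hasHirschLength G).isOfFinOrder_of_eq_zero h g

theorem hirschLength_eq_zero_of_finite [Finite G] : hirschLength G = 0 :=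
  HasHirschLength.finite_hirschLength G

theorem hirschLength_eq_of_finiteIndex [HasHirsch G] (H : Subgroup G) [H.FiniteIndex] :
    hirschLength H = hirschLength G := by
  refine le_antisymm (hirschLength_subgroup_le H) ?_
  have : hirschLength (G ⧸ H.normalCore) = 0 := hirschLength_eq_zero_of_finite
  rw [hirschLength_eq_add H.normalCore, this, add_zero]
  exact hirschLength_mono H.normalCore_le

theorem hirschLength_eq_of_le_of_relIndex [HasHirsch G] {H K : Subgroup G} (h : H ≤ K)
    (hi : H.relIndex K ≠ 0) : hirschLength H = hirschLength K := by
  have : (H.subgroupOf K).FiniteIndex := ⟨hi⟩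
  rw [← hirschLength_eq_of_finiteIndex (H.subgroupOf K)]
  exact hirschLength_congr (Subgroup.subgroupOfEquivOfLe h).symm

theorem hirschLength_zpowers {g : G} (hg : ¬ IsOfFinOrder g) :
    hirschLength (Subgroup.zpowers g) = 1 := by
  have : Infinite (Subgroup.zpowers g) := by
    rw [← not_finite_iff_infinite]; exact fun h => hg (finite_zpowers.1 h)
  exact HasHirschLength.infiniteCyclic_hirschLength intCyclicMulEquiv.symm

theorem one_le_hirschLength_of_not_isOfFinOrder [HasHirsch G] {g : G} (hg : ¬ IsOfFinOrder g) :
    1 ≤ hirschLength G := by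
  rw [← hirschLength_zpowers hg]
  exact hirschLength_subgroup_le _

theorem isOfFinOrder_of_hirschLength_lt_one [HasHirsch G] (h : hirschLength G < 1) (g : G) :
    IsOfFinOrder g := by
  by_contra hg
  exact absurd (one_le_hirschLength_of_not_isOfFinOrder hg) (not_le.2 h)

end HasHirsch

/-! ### Torsion-free groups and free abelian groups -/

/-- A group without nontrivial elements of finite order. -/
class TorsionFree (G : Type*) [Group G] : Prop where
  eq_one_of_isOfFinOrder : ∀ g : G, IsOfFinOrder g → g = 1

namespace TorsionFree

variable {G : Type*} [Group G]

theorem of_injective [h : TorsionFree G] {K : Type*} [Group K] (f : K →* G) (hf : Injective f) :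
    TorsionFree K :=
  ⟨fun g hg => hf (by rw [map_one]; exact h.1 _ (MonoidHom.isOfFinOrder f hg))⟩

instance [TorsionFree G] (H : Subgroup G) : TorsionFree H := .of_injective _ H.subtype_injective

theorem eq_one_of_pow [h : TorsionFree G] {g : G} {n : ℕ} (hn : n ≠ 0) (hg : g ^ n = 1) : g = 1 :=
  h.1 g (isOfFinOrder_iff_pow_eq_one.2 ⟨n, Nat.pos_of_ne_zero hn, hg⟩)

theorem eq_one_of_zpow [h : TorsionFree G] {g : G} {n : ℤ} (hn : n ≠ 0) (hg : g ^ n = 1) :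
    g = 1 :=
  h.1 g (isOfFinOrder_iff_zpow_eq_one.2 ⟨n, hn, hg⟩)

theorem not_isOfFinOrder [h : TorsionFree G] {g : G} (hg : g ≠ 1) : ¬ IsOfFinOrder g :=
  fun h' => hg (h.1 g h')

theorem eq_of_pow_eq [TorsionFree G] {x y : G} {n : ℕ} (hn : n ≠ 0) (hc : x * y = y * x)
    (h : x ^ n = y ^ n) : x = y := by
  have hc' : Commute x y⁻¹ := Commute.inv_right hc
  have : (x * y⁻¹) ^ n = 1 := by rw [hc'.mul_pow, h, inv_pow, mul_inv_cancel]
  exact mul_inv_eq_one.1 (eq_one_of_pow hn this)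

theorem eq_of_zpow_eq [TorsionFree G] {x y : G} {n : ℤ} (hn : n ≠ 0) (hc : x * y = y * x)
    (h : x ^ n = y ^ n) : x = y := by
  have hc' : Commute x y⁻¹ := Commute.inv_right hc
  have : (x * y⁻¹) ^ n = 1 := by rw [hc'.mul_zpow, h, inv_zpow, mul_inv_cancel]
  exact mul_inv_eq_one.1 (eq_one_of_zpow hn this)

/-- A torsion-free group whose center has finite index is commutative. -/
theorem mul_comm_of_finiteIndex_center [TorsionFree G] [(Subgroup.center G).FiniteIndex] (x y : G) :
    x * y = y * x := by
  -- The transfer into the centre is the power map whose exponent is the index of the centre.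
  -- Torsion-freeness makes this homomorphism injective, so the group embeds in its centre.
  have hinj : Injective (MonoidHom.transferCenterPow G) := by
    rw [injective_iff_map_eq_one]
    intro g hg
    refine eq_one_of_pow (Subgroup.FiniteIndex.index_ne_zero (H := Subgroup.center G)) ?_
    rw [← MonoidHom.transferCenterPow_apply, hg]; rfl
  apply hinj
  rw [map_mul, map_mul]
  exact Subtype.ext (Subgroup.mem_center_iff.1 (MonoidHom.transferCenterPow G y).2 _)

theorem exists_mulEquiv_pi [TorsionFree G] [Group.FG G] (hc : ∀ x y : G, x * y = y * x) :
    ∃ r : ℕ, Nonempty (G ≃* Multiplicative (Fin r → ℤ)) := by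
  let _ : CommGroup G := { ‹Group G› with mul_comm := hc }
  have : AddGroup.FG (Additive G) := GroupFG.iff_add_fg.1 ‹_›
  have : Module.Finite ℤ (Additive G) := Module.Finite.iff_addGroup_fg.2 this
  have : Module.IsTorsionFree ℤ (Additive G) := by
    refine ⟨fun r hr x y hxy => ?_⟩
    have hr0 : r ≠ 0 := hr.ne_zero
    exact eq_of_zpow_eq (x := x.toMul) (y := y.toMul) hr0 (hc _ _) hxy
  have b := Module.finBasis ℤ (Additive G)
  exact ⟨_, ⟨AddEquiv.toMultiplicativeRight b.equivFun.toAddEquiv⟩⟩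

end TorsionFree

/-- The lift is there because the rules relate groups of a single universe, whereas the value is
needed for groups in `Type u`. -/
theorem hasHirschLength_pi (r : ℕ) :
    HasHirschLength (ULift.{u} (Multiplicative (Fin r → ℤ))) r := by
  induction r with
  | zero => exact .finite _ inferInstance
  | succ r ih =>
    rw [Nat.cast_add, Nat.cast_one]
    let i : ULift.{u} (Multiplicative (Fin r → ℤ)) →* ULift.{u} (Multiplicative (Fin (r + 1) → ℤ)) :=
      { toFun := fun x => ⟨Multiplicative.ofAdd (Fin.cons 0 x.down.toAdd)⟩
        map_one' := by
          apply ULift.ext; apply Multiplicative.toAdd.injective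
          funext j; refine Fin.cases ?_ (fun j => ?_) j <;> simp
        map_mul' := fun x y => by
          apply ULift.ext; apply Multiplicative.toAdd.injective
          funext j; refine Fin.cases ?_ (fun j => ?_) j <;> simp }
    let f : ULift.{u} (Multiplicative (Fin (r + 1) → ℤ)) →* ULift.{u} (Multiplicative ℤ) :=
      { toFun := fun x => ⟨Multiplicative.ofAdd (x.down.toAdd 0)⟩
        map_one' := rfl
        map_mul' := fun x y => rfl }
    refine .of_exact i f ?_ ?_ ?_ ih (.infiniteCyclic _ MulEquiv.ulift)
    · intro x y hxy
      apply ULift.ext; apply Multiplicative.toAdd.injective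
      funext j
      have : (i x).down.toAdd j.succ = (i y).down.toAdd j.succ := by rw [hxy]
      simpa [i] using this
    · intro x
      exact ⟨⟨Multiplicative.ofAdd (fun _ => x.down.toAdd)⟩, rfl⟩
    · ext x
      constructor
      · rintro ⟨y, rfl⟩
        rfl
      · intro hx
        have hx' : x.down.toAdd 0 = 0 := congrArg (fun z => z.down.toAdd) hx
        refine ⟨⟨Multiplicative.ofAdd (fun j => x.down.toAdd j.succ)⟩, ?_⟩
        apply ULift.ext; apply Multiplicative.toAdd.injective
        funext j; refine Fin.cases ?_ (fun j => ?_) j <;> simp [i, hx']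

theorem hirschLength_of_mulEquiv_pi {G : Type u} [Group G] {r : ℕ}
    (e : G ≃* Multiplicative (Fin r → ℤ)) : hirschLength G = r :=
  ((hasHirschLength_pi r).of_mulEquiv (MulEquiv.ulift.trans e.symm)).eq_hirschLength.symm

theorem TorsionFree.nonempty_mulEquiv_pi {G : Type u} [Group G] [TorsionFree G] [Group.FG G]
    (hc : ∀ x y : G, x * y = y * x) {r : ℕ} (hr : hirschLength G = r) :
    Nonempty (G ≃* Multiplicative (Fin r → ℤ)) := by
  obtain ⟨s, ⟨e⟩⟩ := exists_mulEquiv_pi hc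
  have : s = r := by
    have := hirschLength_of_mulEquiv_pi e
    rw [hr] at this
    exact_mod_cast this.symm
  exact ⟨this ▸ e⟩

theorem TorsionFree.isCyclic_of_hirschLength_le_one {G : Type u} [Group G] [TorsionFree G]
    [Group.FG G] (hc : ∀ x y : G, x * y = y * x) (h : hirschLength G ≤ 1) :
    IsCyclic G := by
  obtain ⟨s, ⟨e⟩⟩ := exists_mulEquiv_pi hc
  have : s ≤ 1 := by
    have := hirschLength_of_mulEquiv_pi e
    rw [this] at h
    exact_mod_cast h
  rcases Nat.le_one_iff_eq_zero_or_eq_one.1 this with rfl | rfl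
  · have := e.injective.subsingleton
    infer_instance
  · let e' : Multiplicative (Fin 1 → ℤ) ≃* Multiplicative ℤ :=
      AddEquiv.toMultiplicative (AddEquiv.funUnique (Fin 1) ℤ)
    exact isCyclic_of_injective (e.trans e').toMonoidHom (e.trans e').injective

/-! ### Ascending HNN extensions inside a group: normal form and recognition -/

section Ascending

variable {G : Type*} [Group G]

/-- `t` conjugates the subgroup `H` into itself, and no proper power of `t` lies in `H`. If moreover
`H` and `t` generate `G`, then `G` is an ascending HNN extension with base `H`. -/
structure IsAscending (H : Subgroup G) (t : G) : Prop where
  conj_mem : ∀ x ∈ H, t * x * t⁻¹ ∈ H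
  pow_notMem : ∀ k : ℕ, k ≠ 0 → t ^ k ∉ H

theorem zpow_notMem_of_pow_notMem {H : Subgroup G} {t : G} (h : ∀ k : ℕ, k ≠ 0 → t ^ k ∉ H) {k : ℤ}
    (hk : k ≠ 0) : t ^ k ∉ H := by
  intro hmem
  refine h k.natAbs (Int.natAbs_ne_zero.2 hk) ?_
  rcases Int.natAbs_eq k with h | h
  · rwa [h, zpow_natCast] at hmem
  · rwa [h, zpow_neg, zpow_natCast, inv_mem_iff] at hmem

theorem conj_pow_mem {H : Subgroup G} {t : G} (h : ∀ x ∈ H, t * x * t⁻¹ ∈ H) (n : ℕ) {x : G}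
    (hx : x ∈ H) : t ^ n * x * (t ^ n)⁻¹ ∈ H := by
  induction n with
  | zero => simpa using hx
  | succ n ih =>
    have := h _ ih
    rwa [show t * (t ^ n * x * (t ^ n)⁻¹) * t⁻¹ = t ^ (n + 1) * x * (t ^ (n + 1))⁻¹ by
      rw [pow_succ']; group] at this

/-- Positive powers of `t` can be moved to the right past `H` and negative ones to the left, because
`t` conjugates `H` into itself. Hence products of elements of this shape have this shape again. -/
theorem exists_eq_of_mem_sup_zpowers {H : Subgroup G} {t : G} (h : ∀ x ∈ H, t * x * t⁻¹ ∈ H)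
    {x : G} (hx : x ∈ H ⊔ Subgroup.zpowers t) :
    ∃ i j : ℕ, ∃ y ∈ H, x = (t ^ i)⁻¹ * y * t ^ j := by
  let S : Subgroup G :=
    { carrier := {x | ∃ i j : ℕ, ∃ y ∈ H, x = (t ^ i)⁻¹ * y * t ^ j}
      one_mem' := ⟨0, 0, 1, H.one_mem, by simp⟩
      inv_mem' := by
        rintro _ ⟨i, j, y, hy, rfl⟩
        exact ⟨j, i, y⁻¹, H.inv_mem hy, by group⟩
      mul_mem' := by
        rintro _ _ ⟨i, j, y, hy, rfl⟩ ⟨k, l, z, hz, rfl⟩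
        rcases le_total k j with hkj | hkj
        · obtain ⟨m, rfl⟩ := Nat.exists_eq_add_of_le hkj
          refine ⟨i, m + l, y * (t ^ m * z * (t ^ m)⁻¹), H.mul_mem hy (conj_pow_mem h m hz), ?_⟩
          rw [add_comm k m, pow_add, pow_add]; group
        · obtain ⟨m, rfl⟩ := Nat.exists_eq_add_of_le hkj
          refine ⟨m + i, l, (t ^ m * y * (t ^ m)⁻¹) * z, H.mul_mem (conj_pow_mem h m hy) hz, ?_⟩
          rw [pow_add, pow_add]; group }
  have hle : H ⊔ Subgroup.zpowers t ≤ S := by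
    refine sup_le (fun y hy => ⟨0, 0, y, hy, by simp⟩) ?_
    rw [Subgroup.zpowers_le]
    exact ⟨0, 1, 1, H.one_mem, by simp⟩
  exact hle hx

/-- In the normal form `t⁻ⁱ y tʲ` of a kernel element, `i = j` reduces to `y`, and `i ≠ j` puts a
proper power of `f t` into the image of `H`. The criterion serves both for abstract HNN extensions
and for the presentation of `BS(1,n)`. -/
theorem injective_of_ascending {K : Type*} [Group K] {H : Subgroup G} {t : G}
    (h : ∀ x ∈ H, t * x * t⁻¹ ∈ H) (hsup : H ⊔ Subgroup.zpowers t = ⊤) (f : G →* K)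
    (hH : ∀ x ∈ H, f x = 1 → x = 1) (ht : ∀ k : ℕ, k ≠ 0 → f t ^ k ∉ H.map f) : Injective f := by
  rw [injective_iff_map_eq_one]
  intro x hx
  obtain ⟨i, j, y, hy, rfl⟩ := exists_eq_of_mem_sup_zpowers h (hsup ▸ Subgroup.mem_top x)
  have hfy : f y = f t ^ i * (f t ^ j)⁻¹ := by
    simp only [map_mul, map_inv, map_pow] at hx
    rw [eq_mul_inv_iff_mul_eq]
    rwa [mul_assoc, inv_mul_eq_one, eq_comm] at hx
  rcases lt_trichotomy i j with hij | rfl | hij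
  · obtain ⟨m, rfl⟩ := Nat.exists_eq_add_of_lt hij
    exact absurd (show f t ^ (m + 1) ∈ H.map f from ⟨y⁻¹, H.inv_mem hy, by
      rw [map_inv, hfy, show i + m + 1 = (m + 1) + i by ring, pow_add]; group⟩)
      (ht _ (Nat.succ_ne_zero m))
  · rw [mul_inv_cancel] at hfy
    rw [hH y hy hfy]; simp
  · obtain ⟨m, rfl⟩ := Nat.exists_eq_add_of_lt hij
    exact absurd (show f t ^ (m + 1) ∈ H.map f from ⟨y, hy, by
      rw [hfy, show j + m + 1 = (m + 1) + j by ring, pow_add]; group⟩)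
      (ht _ (Nat.succ_ne_zero m))

theorem surjective_of_sup_eq_top {K : Type*} [Group K] {f : K →* G} {H : Subgroup G} {t : G}
    (hsup : H ⊔ Subgroup.zpowers t = ⊤) (hH : H ≤ f.range) (ht : t ∈ f.range) : Surjective f := by
  rw [← MonoidHom.range_eq_top, ← top_le_iff, ← hsup]
  exact sup_le hH (by rwa [Subgroup.zpowers_le])

end Ascending

namespace HNNExtension

variable {H : Type*} [Group H] {A B : Subgroup H} {φ : A ≃* B}

theorem of_range_sup_zpowers_t :
    (of : H →* HNNExtension H A B φ).range ⊔ Subgroup.zpowers t = ⊤ := by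
  rw [eq_top_iff]
  intro x _
  induction x using HNNExtension.induction_on with
  | of g => exact Subgroup.mem_sup_left ⟨g, rfl⟩
  | t => exact Subgroup.mem_sup_right (Subgroup.mem_zpowers _)
  | mul x y hx hy => exact Subgroup.mul_mem _ (hx trivial) (hy trivial)
  | inv x hx => exact Subgroup.inv_mem _ (hx trivial)

/-- The exponent sum of the stable letter. -/
noncomputable def exponentHom (A B : Subgroup H) (φ : A ≃* B) :
    HNNExtension H A B φ →* Multiplicative ℤ :=
  lift 1 (Multiplicative.ofAdd 1) (by simp)

theorem zpow_t_notMem_range {k : ℤ} (hk : k ≠ 0) :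
    (t : HNNExtension H A B φ) ^ k ∉ (of : H →* HNNExtension H A B φ).range := by
  rintro ⟨h, hh⟩
  have := congrArg (exponentHom A B φ) hh
  simp only [exponentHom, lift_of, map_zpow, lift_t, MonoidHom.one_apply] at this
  rw [← ofAdd_zsmul, eq_comm, ofAdd_eq_one] at this
  simp at this
  exact hk this

theorem isAscending_of_left_eq_top (hA : A = ⊤) :
    IsAscending (of : H →* HNNExtension H A B φ).range t where
  conj_mem := by
    rintro _ ⟨h, rfl⟩
    exact ⟨φ ⟨h, hA ▸ Subgroup.mem_top h⟩, equiv_eq_conj ⟨h, hA ▸ Subgroup.mem_top h⟩⟩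
  pow_notMem k hk := by
    simpa using zpow_t_notMem_range (φ := φ) (k := k) (by exact_mod_cast hk)

theorem isAscending_of_right_eq_top (hB : B = ⊤) :
    IsAscending (of : H →* HNNExtension H A B φ).range t⁻¹ where
  conj_mem := by
    rintro _ ⟨h, rfl⟩
    refine ⟨φ.symm ⟨h, hB ▸ Subgroup.mem_top h⟩, ?_⟩
    rw [equiv_symm_eq_conj ⟨h, hB ▸ Subgroup.mem_top h⟩, inv_inv]
  pow_notMem k hk := by
    simpa using zpow_t_notMem_range (φ := φ) (k := k) (by exact_mod_cast hk)

end HNNExtension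

/-- The base is a copy `K` of `H` in a universe of its own, so that concrete groups in `Type` can be
bases for any `G`. -/
theorem nonempty_mulEquiv_ascendingHNN {G : Type u} [Group G] {H : Subgroup G} {t : G}
    (hA : IsAscending H t) (hsup : H ⊔ Subgroup.zpowers t = ⊤) {K : Type v} [Group K]
    (e : K ≃* H) (φ : K →* K) (hφ : Injective φ) (hcomp : ∀ x, (e (φ x) : G) = t * e x * t⁻¹) :
    Nonempty (G ≃* AscendingHNN K φ hφ) := by
  let f : AscendingHNN K φ hφ →* G :=
    HNNExtension.lift (H.subtype.comp e.toMonoidHom) t (fun a => by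
      have : ((((Subgroup.topEquiv.trans (MonoidHom.ofInjective hφ)) a : φ.range)) : K) = φ a := rfl
      rw [this]
      simp [hcomp])
  have hof : ∀ x, f (HNNExtension.of x) = e x := fun x => HNNExtension.lift_of _ _ _ x
  have ht : f HNNExtension.t = t := HNNExtension.lift_t _ _ _
  have hinj : Injective f := by
    refine injective_of_ascending (HNNExtension.isAscending_of_left_eq_top rfl).conj_mem
      HNNExtension.of_range_sup_zpowers_t f ?_ ?_
    · rintro _ ⟨x, rfl⟩ hx
      rw [hof] at hx
      have : e x = 1 := Subtype.ext hx
      rw [(map_eq_one_iff e e.injective).1 this, map_one]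
    · rintro k hk ⟨_, ⟨x, rfl⟩, hx⟩
      rw [ht, hof] at hx
      exact hA.pow_notMem k hk (hx ▸ (e x).2)
  have hsurj : Surjective f := by
    refine surjective_of_sup_eq_top hsup (fun x hx => ⟨HNNExtension.of (e.symm ⟨x, hx⟩), ?_⟩)
      ⟨_, ht⟩
    simp [hof]
  exact ⟨(MulEquiv.ofBijective f ⟨hinj, hsurj⟩).symm⟩

/-! ### Baumslag-Solitar groups and semidirect products with `ℤ` -/

namespace BaumslagSolitar

variable (n : ℤ)

/-- The generator `a` of `BS(1,n)`. -/
def a : BaumslagSolitar 1 n := PresentedGroup.of 0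

/-- The generator `t` of `BS(1,n)`. -/
def t : BaumslagSolitar 1 n := PresentedGroup.of 1

theorem t_mul_a : t n * a n * (t n)⁻¹ = a n ^ n := by
  have : PresentedGroup.mk ({FreeGroup.of 1 * FreeGroup.of 0 ^ (1 : ℤ) * (FreeGroup.of 1)⁻¹ *
    (FreeGroup.of 0 ^ n)⁻¹} : Set (FreeGroup (Fin 2))) (FreeGroup.of 1 * FreeGroup.of 0 ^ (1 : ℤ) *
    (FreeGroup.of 1)⁻¹ * (FreeGroup.of 0 ^ n)⁻¹) = 1 :=
    PresentedGroup.one_of_mem rfl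
  simp only [map_mul, map_inv, map_zpow, zpow_one] at this
  exact mul_inv_eq_one.1 this

theorem zpowers_sup_zpowers : Subgroup.zpowers (a n) ⊔ Subgroup.zpowers (t n) = ⊤ := by
  rw [eq_top_iff, ← PresentedGroup.closure_range_of, Subgroup.closure_le]
  rintro _ ⟨i, rfl⟩
  fin_cases i
  · exact Subgroup.mem_sup_left (Subgroup.mem_zpowers _)
  · exact Subgroup.mem_sup_right (Subgroup.mem_zpowers _)

theorem conj_mem_zpowers (x : BaumslagSolitar 1 n) (hx : x ∈ Subgroup.zpowers (a n)) :
    t n * x * (t n)⁻¹ ∈ Subgroup.zpowers (a n) := by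
  obtain ⟨k, rfl⟩ := hx
  refine ⟨n * k, ?_⟩
  calc a n ^ (n * k) = (a n ^ n) ^ k := zpow_mul _ _ _
    _ = (t n * a n * (t n)⁻¹) ^ k := congrArg (· ^ k) (t_mul_a n).symm
    _ = t n * a n ^ k * (t n)⁻¹ := conj_zpow

variable {n}

/-- The homomorphism out of `BS(1,n)` given by two elements that satisfy the relation. -/
def lift {G : Type*} [Group G] (x y : G) (h : y * x * y⁻¹ = x ^ n) : BaumslagSolitar 1 n →* G :=
  PresentedGroup.toGroup (f := ![x, y]) (by
    rintro _ rfl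
    simp [h])

@[simp]
theorem lift_a {G : Type*} [Group G] (x y : G) (h : y * x * y⁻¹ = x ^ n) : lift x y h (a n) = x :=
  PresentedGroup.toGroup.of _

@[simp]
theorem lift_t {G : Type*} [Group G] (x y : G) (h : y * x * y⁻¹ = x ^ n) : lift x y h (t n) = y :=
  PresentedGroup.toGroup.of _

theorem isAscending (n : ℤ) : IsAscending (Subgroup.zpowers (a n)) (t n) where
  conj_mem := conj_mem_zpowers n
  pow_notMem := by
    rintro k hk ⟨m, hm⟩
    have := congrArg (lift (n := n) (1 : Multiplicative ℤ) (Multiplicative.ofAdd 1) (by simp)) hm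
    simp only [map_zpow, map_pow, lift_a, lift_t, one_zpow] at this
    rw [← ofAdd_nsmul, eq_comm, ofAdd_eq_one] at this
    simp at this
    exact hk this

theorem nonempty_mulEquiv {G : Type*} [Group G] {x y : G} (h : y * x * y⁻¹ = x ^ n)
    (hsup : Subgroup.zpowers x ⊔ Subgroup.zpowers y = ⊤) (hx : ¬ IsOfFinOrder x)
    (hy : ∀ k : ℕ, k ≠ 0 → y ^ k ∉ Subgroup.zpowers x) :
    Nonempty (BaumslagSolitar 1 n ≃* G) := by
  refine ⟨MulEquiv.ofBijective (lift x y h) ⟨?_, ?_⟩⟩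
  · refine injective_of_ascending (conj_mem_zpowers n) (zpowers_sup_zpowers n) _ ?_ ?_
    · rintro _ ⟨k, rfl⟩ hk
      change a n ^ k = 1
      have hk' : x ^ k = 1 := by simpa using hk
      by_cases hk0 : k = 0
      · simp [hk0]
      · exact absurd (isOfFinOrder_iff_zpow_eq_one.2 ⟨k, hk0, hk'⟩) hx
    · rintro k hk hmem
      rw [MonoidHom.map_zpowers, lift_a, lift_t] at hmem
      exact hy k hk hmem
  · refine surjective_of_sup_eq_top hsup ?_ ⟨t n, lift_t x y h⟩
    rw [Subgroup.zpowers_le]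
    exact ⟨a n, lift_a x y h⟩

end BaumslagSolitar

theorem exists_mulEquiv_semidirectProduct {G : Type*} [Group G] (M : Subgroup G) [M.Normal] {s : G}
    (hsup : M ⊔ Subgroup.zpowers s = ⊤) (hs : ∀ k : ℕ, k ≠ 0 → s ^ k ∉ M) {B : Type*} [Group B]
    (e : B ≃* M) :
    ∃ θ : MulAut B, Nonempty (G ≃* B ⋊[zpowersHom (MulAut B) θ] Multiplicative ℤ) := by
  let θ : MulAut B := MulAut.congr e.symm (MulAut.conjNormal s)
  have hθ : ∀ (n : ℤ) (b : B), (e ((θ ^ n) b) : G) = s ^ n * e b * (s ^ n)⁻¹ := by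
    intro n b
    have : θ ^ n = MulAut.congr e.symm (MulAut.conjNormal (s ^ n)) := by
      rw [map_zpow, map_zpow]
    rw [this]
    change ((e (e.symm (MulAut.conjNormal (s ^ n) (e b)))) : G) = _
    rw [e.apply_symm_apply, MulAut.conjNormal_apply]
  have hs' : ∀ k : ℤ, s ^ k ∈ M → k = 0 := fun k hk => by
    by_contra hk0
    exact zpow_notMem_of_pow_notMem hs hk0 hk
  let f : B ⋊[zpowersHom (MulAut B) θ] Multiplicative ℤ →* G :=
    SemidirectProduct.lift (M.subtype.comp e.toMonoidHom) (zpowersHom G s) (by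
      intro g
      ext b
      exact hθ g.toAdd b)
  refine ⟨θ, ⟨(MulEquiv.ofBijective f ⟨?_, ?_⟩).symm⟩⟩
  · rw [injective_iff_map_eq_one]
    rintro ⟨b, g⟩ hb
    have hb' : (e b : G) * s ^ g.toAdd = 1 := hb
    have hg : g.toAdd = 0 := hs' _ (by
      rw [← inv_eq_of_mul_eq_one_right hb']
      exact M.inv_mem (e b).2)
    rw [hg, zpow_zero, mul_one] at hb'
    have hb1 : b = 1 := (map_eq_one_iff e e.injective).1 (Subtype.ext hb')
    have hg1 : g = 1 := hg
    rw [hb1, hg1]; rfl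
  · refine surjective_of_sup_eq_top hsup (fun x hx => ⟨SemidirectProduct.inl (e.symm ⟨x, hx⟩), ?_⟩)
      ⟨SemidirectProduct.inr (Multiplicative.ofAdd 1), ?_⟩
    · simp [f]
    · simp [f]

/-! ### The listed groups are constructible -/

theorem IsConstructible.of_mulEquiv {G : Type u} [Group G] (h : IsConstructible G) :
    ∀ {K : Type u} [Group K], G ≃* K → IsConstructible K := by
  induction h with
  | trivial G hG => exact fun e => .trivial _ e.symm.injective.subsingleton
  | finiteExtension G N hfin hN ih =>
    intro K _ e
    have : (N.map e.toMonoidHom).Normal := Subgroup.Normal.map inferInstance _ e.surjective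
    refine .finiteExtension K (N.map e.toMonoidHom) ?_ (ih (e.subgroupMap N))
    constructor
    rw [Subgroup.index_map_of_bijective e.bijective]
    exact hfin.index_ne_zero
  | hnnExtension G H A B φ e hH ih =>
    intro K _ e'
    exact .hnnExtension K H A B φ (e'.symm.trans e) hH

theorem IsConstructible.of_isAscending {G : Type u} [Group G] {H : Subgroup G} {t : G}
    (hA : IsAscending H t) (hsup : H ⊔ Subgroup.zpowers t = ⊤) (hH : IsConstructible H) :
    IsConstructible G := by
  let φ : H →* H := ((MulAut.conj t).toMonoidHom.comp H.subtype).codRestrict H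
    (fun x => hA.conj_mem _ x.2)
  have hφ : Injective φ := by
    intro x y hxy
    have := congrArg Subtype.val hxy
    simpa [φ] using this
  obtain ⟨e⟩ := nonempty_mulEquiv_ascendingHNN hA hsup (MulEquiv.refl H) φ hφ (fun x => rfl)
  exact .hnnExtension G H _ _ _ e hH

theorem IsAscending.map {G : Type u} {K : Type v} [Group G] [Group K] {H : Subgroup G} {t : G}
    (h : IsAscending H t) (f : G →* K) (hf : Injective f) : IsAscending (H.map f) (f t) where
  conj_mem := by
    rintro _ ⟨x, hx, rfl⟩
    exact ⟨_, h.conj_mem x hx, by simp⟩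
  pow_notMem := by
    rintro k hk ⟨x, hx, hxk⟩
    rw [← map_pow] at hxk
    exact h.pow_notMem k hk (hf hxk ▸ hx)

theorem sup_zpowers_map {G : Type u} {K : Type v} [Group G] [Group K] (H : Subgroup G) (t : G)
    (f : G →* K) :
    H.map f ⊔ Subgroup.zpowers (f t) = (H ⊔ Subgroup.zpowers t).map f := by
  rw [Subgroup.map_sup, MonoidHom.map_zpowers]

theorem IsConstructible.of_mulEquiv_of_isAscending {Γ : Type v} [Group Γ] {G : Type u} [Group G]
    (e : Γ ≃* G) {H : Subgroup Γ} {t : Γ} (hA : IsAscending H t)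
    (hsup : H ⊔ Subgroup.zpowers t = ⊤) (hH : IsConstructible (H.map e.toMonoidHom)) :
    IsConstructible G :=
  .of_isAscending (hA.map e.toMonoidHom e.injective) (by
    rw [sup_zpowers_map, hsup, Subgroup.map_top_of_surjective _ e.surjective]) hH

namespace IsPolycyclic

theorem of_surjective {G : Type u} [Group G] (h : IsPolycyclic G) :
    ∀ {Q : Type v} [Group Q] (f : G →* Q), Surjective f → IsPolycyclic Q := by
  induction h with
  | trivial G hG => exact fun f hf => .trivial _ hf.subsingleton
  | step G N hN hQ ih =>
    intro Q _ f hf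
    have : (N.map f).Normal := Subgroup.Normal.map inferInstance f hf
    refine .step Q (N.map f) (ih (f.subgroupMap N) (f.subgroupMap_surjective N)) ?_
    refine isCyclic_of_surjective (QuotientGroup.map N (N.map f) f (N.le_comap_map f)) ?_
    intro x
    induction x using QuotientGroup.induction_on with
    | H x =>
      obtain ⟨y, rfl⟩ := hf x
      exact ⟨y, rfl⟩

theorem of_isCyclic (G : Type u) [Group G] [IsCyclic G] : IsPolycyclic G :=
  .step G ⊥ (.trivial _ inferInstance)
    (isCyclic_of_surjective _ (QuotientGroup.mk'_surjective ⊥))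

end IsPolycyclic

theorem QuotientGroup.exists_zpow_eq_of_sup_eq_top {G : Type u} [Group G] {M : Subgroup G} [M.Normal] {s : G}
    (hsup : M ⊔ Subgroup.zpowers s = ⊤) (x : G) : ∃ k : ℤ, (s : G ⧸ M) ^ k = x := by
  have hx : x ∈ M ⊔ Subgroup.zpowers s := hsup ▸ Subgroup.mem_top x
  rw [Subgroup.mem_sup_of_normal_left] at hx
  obtain ⟨m, hm, _, ⟨k, rfl⟩, rfl⟩ := hx
  exact ⟨k, by rw [QuotientGroup.mk_mul, (QuotientGroup.eq_one_iff m).2 hm, one_mul]; rfl⟩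

theorem IsPolycyclic.of_sup_zpowers {G : Type u} [Group G] {M : Subgroup G} [M.Normal] {s : G}
    (hsup : M ⊔ Subgroup.zpowers s = ⊤) (hM : IsPolycyclic M) : IsPolycyclic G := by
  refine .step G M hM ⟨(s : G ⧸ M), fun x => ?_⟩
  induction x using QuotientGroup.induction_on with
  | H x => exact QuotientGroup.exists_zpow_eq_of_sup_eq_top hsup x

theorem exists_sup_zpowers_eq_top_of_isCyclic_quotient {G : Type u} [Group G] (N : Subgroup G)
    [N.Normal] [hQ : IsCyclic (G ⧸ N)] :
    ∃ t : G, N ⊔ Subgroup.zpowers t = ⊤ ∧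
      (Infinite (G ⧸ N) → ∀ k : ℕ, k ≠ 0 → t ^ k ∉ N) := by
  obtain ⟨q, hq⟩ := hQ.exists_zpow_surjective
  obtain ⟨t, rfl⟩ := QuotientGroup.mk_surjective q
  refine ⟨t, ?_, fun hinf k hk hmem => ?_⟩
  · rw [eq_top_iff]
    intro x _
    obtain ⟨k, hk⟩ := hq x
    have h1 : (t ^ k)⁻¹ * x ∈ N := QuotientGroup.eq.1 hk
    have h2 := Subgroup.mul_mem _ (Subgroup.mem_sup_right (S := N) (Subgroup.zpow_mem_zpowers t k))
      (Subgroup.mem_sup_left (T := Subgroup.zpowers t) h1)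
    rwa [mul_inv_cancel_left] at h2
  · have h1 : IsOfFinOrder (t : G ⧸ N) := isOfFinOrder_iff_pow_eq_one.2
      ⟨k, Nat.pos_of_ne_zero hk, by rw [← QuotientGroup.mk_pow]; exact (QuotientGroup.eq_one_iff _).2 hmem⟩
    have h2 : Finite (Subgroup.zpowers (t : G ⧸ N)) := finite_zpowers.2 h1
    have h3 : Finite (G ⧸ N) :=
      Finite.of_surjective (fun x : Subgroup.zpowers (t : G ⧸ N) => (x : G ⧸ N)) fun x =>
        ⟨⟨x, hq x⟩, rfl⟩
    exact not_finite (G ⧸ N)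

/-- A finite cyclic quotient gives a finite extension; an infinite one splits, and the group is an
HNN extension along an automorphism of the base. -/
theorem IsPolycyclic.isConstructible {G : Type u} [Group G] (h : IsPolycyclic G) :
    IsConstructible G := by
  induction h with
  | trivial G hG => exact .trivial G hG
  | step G N hN hQ ih =>
    rcases finite_or_infinite (G ⧸ N) with h | h
    · exact .finiteExtension G N N.finiteIndex_of_finite_quotient ih
    · obtain ⟨t, ht, ht'⟩ := exists_sup_zpowers_eq_top_of_isCyclic_quotient N
      exact .of_isAscending ⟨fun x hx => Subgroup.Normal.conj_mem inferInstance x hx t, ht' h⟩ ht ih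

theorem IsConstructible.of_mulEquiv_baumslagSolitar {G : Type u} [Group G] {n : ℤ}
    (e : BaumslagSolitar 1 n ≃* G) : IsConstructible G := by
  refine .of_mulEquiv_of_isAscending e (BaumslagSolitar.isAscending n)
    (BaumslagSolitar.zpowers_sup_zpowers n) (IsPolycyclic.isConstructible ?_)
  have := isCyclic_of_surjective _ (e.toMonoidHom.subgroupMap_surjective
    (Subgroup.zpowers (BaumslagSolitar.a n)))
  exact .of_isCyclic _

theorem IsConstructible.of_mulEquiv_semidirectProduct {G : Type u} [Group G] {n : ℤ}
    {θ : Multiplicative ℤ →* MulAut (BaumslagSolitar 1 n)}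
    (e : G ≃* BaumslagSolitar 1 n ⋊[θ] Multiplicative ℤ) : IsConstructible G := by
  let S := BaumslagSolitar 1 n ⋊[θ] Multiplicative ℤ
  let H : Subgroup S := (SemidirectProduct.inl (φ := θ)).range
  have hH : H = (SemidirectProduct.rightHom (φ := θ)).ker := SemidirectProduct.range_inl_eq_ker_rightHom
  let s : S := SemidirectProduct.inr (Multiplicative.ofAdd 1)
  have hn : H.Normal := hH ▸ inferInstance
  refine .of_mulEquiv_of_isAscending e.symm (H := H) (t := s)
    ⟨fun x hx => hn.conj_mem x hx s, ?_⟩ ?_ ?_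
  · intro k hk hmem
    rw [hH, MonoidHom.mem_ker] at hmem
    simp only [s, map_pow, SemidirectProduct.rightHom_inr] at hmem
    rw [← ofAdd_nsmul, ofAdd_eq_one] at hmem
    simp at hmem
    exact hk hmem
  · rw [eq_top_iff]
    rintro x -
    rw [← SemidirectProduct.inl_left_mul_inr_right x]
    refine Subgroup.mul_mem _ (Subgroup.mem_sup_left ⟨_, rfl⟩) (Subgroup.mem_sup_right ⟨x.right.toAdd, ?_⟩)
    simp only [s, ← map_zpow]
    rw [← ofAdd_zsmul]; simp
  · exact .of_mulEquiv_baumslagSolitar ((MonoidHom.ofInjective SemidirectProduct.inl_injective).trans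
      (e.symm.subgroupMap H))

theorem IsPolycyclic.kleinBottleGroup : IsPolycyclic KleinBottleGroup := by
  have : (Subgroup.zpowers (BaumslagSolitar.a (-1))).Normal := by
    rw [← Subgroup.normalizer_eq_top_iff, eq_top_iff, ← BaumslagSolitar.zpowers_sup_zpowers,
      sup_le_iff, Subgroup.zpowers_le, Subgroup.zpowers_le]
    refine ⟨Subgroup.le_normalizer (Subgroup.mem_zpowers _), ?_⟩
    rw [Subgroup.mem_normalizer_iff]
    refine fun x => ⟨BaumslagSolitar.conj_mem_zpowers _ x, ?_⟩
    rintro ⟨k, hk⟩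
    refine ⟨-k, ?_⟩
    have h1 : BaumslagSolitar.t (-1) * BaumslagSolitar.a (-1) ^ (-k) * (BaumslagSolitar.t (-1))⁻¹ =
        BaumslagSolitar.a (-1) ^ k := by
      rw [← conj_zpow]
      refine (congrArg (· ^ (-k)) (BaumslagSolitar.t_mul_a (-1))).trans ?_
      exact (zpow_mul _ _ _).symm.trans (by simp)
    have h2 := h1.trans hk
    exact mul_left_cancel (mul_right_cancel h2)
  have hc : IsPolycyclic (Subgroup.zpowers (BaumslagSolitar.a (-1))) := .of_isCyclic _
  exact .of_sup_zpowers (BaumslagSolitar.zpowers_sup_zpowers _) hc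

theorem IsPolycyclic.int_prod_int : IsPolycyclic (Multiplicative (ℤ × ℤ)) := by
  have : IsCyclic (Multiplicative ℤ) := inferInstance
  refine .of_sup_zpowers (M := Subgroup.zpowers (Multiplicative.ofAdd ((1, 0) : ℤ × ℤ)))
    (s := Multiplicative.ofAdd ((0, 1) : ℤ × ℤ)) ?_ (.of_isCyclic _)
  rw [eq_top_iff]
  rintro x -
  have : x = Multiplicative.ofAdd ((1, 0) : ℤ × ℤ) ^ (x.toAdd.1) *
      Multiplicative.ofAdd ((0, 1) : ℤ × ℤ) ^ (x.toAdd.2) := by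
    apply Multiplicative.toAdd.injective
    simp
  rw [this]
  exact Subgroup.mul_mem _ (Subgroup.mem_sup_left (Subgroup.zpow_mem_zpowers _ _))
    (Subgroup.mem_sup_right (Subgroup.zpow_mem_zpowers _ _))

theorem IsProperlyAscendingHNN.isConstructible {H : Type} [Group H] {G : Type u} [Group G]
    (h : IsProperlyAscendingHNN H G) (hH : IsPolycyclic H) : IsConstructible G := by
  obtain ⟨φ, hφ, -, ⟨e⟩⟩ := h
  refine .of_mulEquiv_of_isAscending e.symm (HNNExtension.isAscending_of_left_eq_top rfl)
    HNNExtension.of_range_sup_zpowers_t (IsPolycyclic.isConstructible ?_)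
  have h1 := hH.of_surjective _ (HNNExtension.of (G := H) (A := ⊤) (B := φ.range)
    (φ := Subgroup.topEquiv.trans (MonoidHom.ofInjective hφ))).rangeRestrict_surjective
  exact h1.of_surjective _ (e.symm.toMonoidHom.subgroupMap_surjective _)

/-! ### Non-ascending HNN extensions contain free groups of rank two -/

/-- A group is not the union of two proper subgroups. -/
theorem Subgroup.exists_notMem_of_ne_top {H : Type*} [Group H] {A B : Subgroup H} (hA : A ≠ ⊤)
    (hB : B ≠ ⊤) : ∃ g, g ∉ A ∧ g ∉ B := by
  obtain ⟨x, hx⟩ : ∃ x, x ∉ A := by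
    by_contra! h; exact hA (eq_top_iff.2 fun x _ => h x)
  obtain ⟨y, hy⟩ : ∃ y, y ∉ B := by
    by_contra! h; exact hB (eq_top_iff.2 fun x _ => h x)
  by_cases hxB : x ∈ B
  · by_cases hyA : y ∈ A
    · exact ⟨x * y, fun h => hx ((A.mul_mem_cancel_right hyA).1 h),
        fun h => hy ((B.mul_mem_cancel_left hxB).1 h)⟩
    · exact ⟨y, hyA, hy⟩
  · exact ⟨x, hx, hxB⟩

namespace HNNExtension

variable {H : Type*} [Group H] {A B : Subgroup H} (φ : A ≃* B)

/-- Two conjugates of the stable letter, indexed by `Bool`. -/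
def conjStable (g : H) (i : Bool) : HNNExtension H A B φ :=
  of (if i then 1 else g) * t * (of (if i then 1 else g))⁻¹

/-- A reduced word in the two conjugates of `t` spells a reduced word of the HNN extension. The
first entry and the first sign are recorded so that the induction can prepend a letter. -/
theorem exists_reducedWord (g : H) (hgA : g ∉ A) (hgB : g ∉ B) (L : List (Bool × Bool))
    (hL : FreeGroup.IsReduced L) :
    ∃ w : NormalWord.ReducedWord H A B,
      w.prod φ = FreeGroup.lift (conjStable φ g) (FreeGroup.mk L) ∧
      (L = [] → w.toList = [] ∧ w.head = 1) ∧
      ∀ i ε L', L = (i, ε) :: L' → w.head = (if i then 1 else g) ∧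
        ∃ x l, w.toList = ((if ε then 1 else -1), x) :: l := by
  induction L with
  | nil =>
    refine ⟨NormalWord.ReducedWord.empty H A B, ?_, fun _ => ⟨rfl, rfl⟩, by simp⟩
    simp [NormalWord.ReducedWord.prod, NormalWord.ReducedWord.empty]
  | cons a L ih =>
    obtain ⟨i, ε⟩ := a
    obtain ⟨w, hw, hnil, hcons⟩ := ih (List.IsChain.tail hL)
    let d : Bool → H := fun i => if i then 1 else g
    let sg : Bool → ℤˣ := fun ε => if ε then 1 else -1
    let w' : NormalWord.ReducedWord H A B :=
      { head := d i
        toList := (sg ε, (d i)⁻¹ * w.head) :: w.toList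
        chain := by
          rcases L with _ | ⟨⟨j, ε'⟩, L⟩
          · simp [(hnil rfl).1]
          · obtain ⟨hh, x, l, hl⟩ := hcons j ε' L rfl
            have hchain := w.chain
            rw [hl] at hchain ⊢
            rw [List.isChain_cons_cons]
            -- Between neighbouring letters stands `(d i)⁻¹ * d j`. For `i = j` it is trivial, and
            -- the signs agree since the word is reduced; for `i ≠ j` it is `g` or `g⁻¹`, which lies
            -- in neither associated subgroup.
            refine ⟨?_, hchain⟩
            rw [hh]
            intro hmem
            have hr : i = j → ε = ε' := (List.isChain_cons_cons.1 hL).1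
            by_cases hij : i = j
            · simp [sg, hr hij]
            · exfalso
              have hg : ∀ u : ℤˣ, g ∉ toSubgroup A B u := by
                intro u
                rcases Int.units_eq_one_or u with rfl | rfl
                · exact hgA
                · exact hgB
              cases i <;> cases j <;> simp_all [d] }
    refine ⟨w', ?_, by simp, ?_⟩
    · have h1 : (FreeGroup.mk ((i, ε) :: L)) = FreeGroup.mk [(i, ε)] * FreeGroup.mk L := by
        rw [FreeGroup.mul_mk]; rfl
      rw [h1, map_mul, ← hw]
      have h2 : FreeGroup.lift (conjStable φ g) (FreeGroup.mk [(i, ε)]) =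
          of (d i) * t ^ ((sg ε : ℤˣ) : ℤ) * (of (d i))⁻¹ := by
        cases ε <;> simp [conjStable, sg, d, mul_assoc]
      rw [h2]
      simp [NormalWord.ReducedWord.prod, w', mul_assoc]
    · rintro i' ε' L' h
      cases h
      exact ⟨rfl, _, _, rfl⟩

theorem lift_conjStable_injective (g : H) (hgA : g ∉ A) (hgB : g ∉ B) :
    Injective (FreeGroup.lift (conjStable φ g)) := by
  rw [injective_iff_map_eq_one]
  intro x hx
  obtain ⟨w, hw, -, hcons⟩ := exists_reducedWord φ g hgA hgB x.toWord FreeGroup.isReduced_toWord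
  rw [FreeGroup.mk_toWord, hx] at hw
  have hnil := ReducedWord.toList_eq_nil_of_mem_of_range φ w (hw ▸ Subgroup.one_mem _)
  rw [← FreeGroup.toWord_eq_nil_iff]
  rcases hL : x.toWord with _ | ⟨⟨i, ε⟩, L⟩
  · rfl
  · obtain ⟨-, y, l, hl⟩ := hcons i ε L hL
    simp [hnil] at hl

end HNNExtension

/-- The kernel of a map onto `ℤ` that kills one generator is free by Nielsen–Schreier and not
abelian, so it contains a free group of rank two. Additivity then makes the length at least one more
than itself. -/
theorem hirschLength_eq_top_of_mulEquiv_freeGroup {Γ : Type u} [Group Γ] [HasHirsch Γ]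
    (e : FreeGroup Bool ≃* Γ) : hirschLength Γ = ⊤ := by
  let f₀ : FreeGroup Bool →* ULift.{u} (Multiplicative ℤ) :=
    FreeGroup.lift (fun i => if i then 1 else ULift.up (Multiplicative.ofAdd 1))
  let f : Γ →* ULift.{u} (Multiplicative ℤ) := f₀.comp e.symm.toMonoidHom
  have hf : Surjective f := fun z => by
    refine ⟨e (FreeGroup.of false ^ z.down.toAdd), ?_⟩
    apply ULift.ext
    simp only [f, f₀, MonoidHom.comp_apply, MulEquiv.coe_toMonoidHom, MulEquiv.symm_apply_apply,
      map_zpow, FreeGroup.lift_apply_of]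
    apply Multiplicative.toAdd.injective
    simp
  have hadd := hirschLength_eq_ker_add f hf
  rw [HasHirschLength.infiniteCyclic_hirschLength MulEquiv.ulift] at hadd
  have : IsFreeGroup Γ := IsFreeGroup.ofMulEquiv e
  have hfree : IsFreeGroup f.ker := inferInstance
  let x : FreeGroup Bool := FreeGroup.of true
  let y : FreeGroup Bool := FreeGroup.of false * FreeGroup.of true * (FreeGroup.of false)⁻¹
  have hxk : e x ∈ f.ker := by simp [f, f₀, x, MonoidHom.mem_ker]
  have hyk : e y ∈ f.ker := by
    rw [MonoidHom.mem_ker, MonoidHom.comp_apply, MulEquiv.coe_toMonoidHom, e.symm_apply_apply]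
    simp [f₀, y]
  have hxy : x * y ≠ y * x := by
    intro h
    have := congrArg FreeGroup.toWord h
    revert this
    decide
  obtain ⟨i, j, hij⟩ : ∃ i j : IsFreeGroup.Generators f.ker, i ≠ j := by
    by_contra! hall
    have hsub : Subsingleton (IsFreeGroup.Generators f.ker) := ⟨hall⟩
    have hcomm : ∀ a b : FreeGroup (IsFreeGroup.Generators f.ker), a * b = b * a := by
      rcases isEmpty_or_nonempty (IsFreeGroup.Generators f.ker) with h | ⟨⟨s⟩⟩
      · exact fun a b => Subsingleton.elim _ _
      · let _ : Unique (IsFreeGroup.Generators f.ker) := ⟨⟨s⟩, fun t => hall t s⟩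
        intro a b
        apply FreeGroup.mulEquivIntOfUnique.injective
        rw [map_mul, map_mul, mul_comm]
    have h1 : (⟨e x, hxk⟩ : f.ker) * ⟨e y, hyk⟩ = ⟨e y, hyk⟩ * ⟨e x, hxk⟩ := by
      apply (IsFreeGroup.toFreeGroup f.ker).injective
      rw [map_mul, hcomm, ← map_mul]
    apply hxy
    apply e.injective
    rw [map_mul e x y, map_mul e y x]
    exact congrArg Subtype.val h1
  let m : Bool → IsFreeGroup.Generators f.ker := fun b => if b then i else j
  have hm : Injective m := by
    intro a b hab
    cases a <;> cases b <;> simp_all [m, eq_comm]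
  have hle : hirschLength Γ ≤ hirschLength f.ker :=
    hirschLength_le_of_injective (G := f.ker)
      ((IsFreeGroup.toFreeGroup f.ker).symm.toMonoidHom.comp
        ((FreeGroup.map m).comp e.symm.toMonoidHom))
      ((IsFreeGroup.toFreeGroup f.ker).symm.injective.comp
        ((FreeGroup.map_injective hm).comp e.symm.injective))
  by_contra hne
  have hk : hirschLength f.ker ≠ ⊤ := fun h => hne (by rw [hadd, h]; rfl)
  rw [hadd] at hle
  exact absurd hle (not_le.2 ((ENat.lt_add_one_iff hk).2 le_rfl))

/-- An element `g` outside both associated subgroups makes `t` and `g t g⁻¹` generate a free group.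
-/
theorem HNNExtension.eq_top_or_eq_top {H : Type u} [Group H] {A B : Subgroup H} (φ : A ≃* B)
    [HasHirsch (HNNExtension H A B φ)] (hfin : hirschLength (HNNExtension H A B φ) ≠ ⊤) :
    A = ⊤ ∨ B = ⊤ := by
  by_contra! h
  obtain ⟨g, hgA, hgB⟩ := Subgroup.exists_notMem_of_ne_top h.1 h.2
  have hinj := lift_conjStable_injective φ g hgA hgB
  have h1 := hirschLength_eq_top_of_mulEquiv_freeGroup (MonoidHom.ofInjective hinj)
  exact hfin (top_le_iff.1 (h1 ▸ hirschLength_subgroup_le _))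

/-- Induction along the construction: a finite extension only multiplies the index, and an HNN step
of finite length is ascending, for `t` or for `t⁻¹` according to which associated subgroup is the
whole base. The base occurs in the construction, so it remains constructible. -/
theorem IsConstructible.exists_isAscending {G : Type u} [Group G] (h : IsConstructible G) :
    ∀ [TorsionFree G] [HasHirsch G], hirschLength G ≠ ⊤ →
      Subsingleton G ∨ ∃ (H : Subgroup G) (t : G), IsAscending H t ∧
        (H ⊔ Subgroup.zpowers t).FiniteIndex ∧ IsConstructible H := by
  induction h with
  | trivial G hG => exact fun _ => Or.inl hG
  | finiteExtension G N hfin hN ih =>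
    intro _ _ htop
    rcases ih (ne_top_of_le_ne_top htop (hirschLength_subgroup_le N)) with hs | ⟨H, t, hA, hi, hc⟩
    · left
      have h1 : N = ⊥ := Subgroup.eq_bot_of_subsingleton N
      have h2 : Finite G := by
        have := hfin.index_ne_zero
        rw [h1, Subgroup.index_bot] at this
        exact Nat.finite_of_card_ne_zero this
      exact ⟨fun x y => by
        rw [TorsionFree.eq_one_of_isOfFinOrder x (isOfFinOrder_of_finite x),
          TorsionFree.eq_one_of_isOfFinOrder y (isOfFinOrder_of_finite y)]⟩
    · right
      refine ⟨H.map N.subtype, t, hA.map N.subtype N.subtype_injective, ⟨?_⟩,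
        hc.of_mulEquiv (H.equivMapOfInjective _ N.subtype_injective)⟩
      have := sup_zpowers_map H t N.subtype
      rw [Subgroup.coe_subtype] at this
      rw [this, Subgroup.index_map_subtype]
      exact mul_ne_zero hi.index_ne_zero hfin.index_ne_zero
  | hnnExtension G H A B φ e hH ih =>
    intro _ _ htop
    have := HasHirsch.of_surjective e.toMonoidHom e.surjective
    rw [hirschLength_congr e] at htop
    have key : ∀ t', IsAscending (HNNExtension.of (A := A) (B := B) (φ := φ)).range t' →
        (HNNExtension.of (A := A) (B := B) (φ := φ)).range ⊔ Subgroup.zpowers t' = ⊤ →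
        ∃ (K : Subgroup G) (t : G), IsAscending K t ∧
          (K ⊔ Subgroup.zpowers t).FiniteIndex ∧ IsConstructible K := by
      intro t' hA hsup
      refine ⟨_, _, hA.map e.symm.toMonoidHom e.symm.injective, ?_, ?_⟩
      · rw [sup_zpowers_map, hsup, Subgroup.map_top_of_surjective _ e.symm.surjective]
        infer_instance
      · exact hH.of_mulEquiv ((MonoidHom.ofInjective (HNNExtension.of_injective φ)).trans
          (e.symm.subgroupMap _))
    right
    rcases HNNExtension.eq_top_or_eq_top φ htop with hA | hB
    · exact key _ (HNNExtension.isAscending_of_left_eq_top hA)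
        HNNExtension.of_range_sup_zpowers_t
    · refine key _ (HNNExtension.isAscending_of_right_eq_top hB) ?_
      rw [Subgroup.zpowers_inv]
      exact HNNExtension.of_range_sup_zpowers_t

/-! ### Subgroups contracted by conjugation -/

namespace Subgroup

variable {G : Type*} [Group G]

theorem exists_finite_cover_of_relIndex_ne_zero {C K : Subgroup G} (h : C.relIndex K ≠ 0) :
    ∃ D : Set G, D.Finite ∧ D ⊆ K ∧ ∀ x ∈ K, ∃ d ∈ D, d⁻¹ * x ∈ C := by
  have : (C.subgroupOf K).FiniteIndex := ⟨h⟩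
  refine ⟨Set.range fun q : K ⧸ C.subgroupOf K => ((q.out : K) : G), Set.finite_range _, ?_, ?_⟩
  · rintro _ ⟨q, rfl⟩
    exact q.out.2
  · intro x hx
    refine ⟨_, ⟨((⟨x, hx⟩ : K) : K ⧸ C.subgroupOf K), rfl⟩, ?_⟩
    have h1 := QuotientGroup.eq.1 (Quotient.out_eq' ((⟨x, hx⟩ : K) : K ⧸ C.subgroupOf K))
    exact h1

theorem relIndex_ne_zero_of_finite_cover {C K : Subgroup G} {D : Set G} (hD : D.Finite)
    (h : ∀ x ∈ K, ∃ d ∈ D, d⁻¹ * x ∈ C) : C.relIndex K ≠ 0 := by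
  have := hD.to_subtype
  choose! f hfD hf using h
  have hinj : Injective fun q : K ⧸ C.subgroupOf K => (⟨f (q.out : K), hfD _ q.out.2⟩ : D) := by
    intro p q hpq
    have hpq' : f (p.out : K) = f (q.out : K) := congrArg Subtype.val hpq
    rw [← Quotient.out_eq' p, ← Quotient.out_eq' q]
    refine QuotientGroup.eq.2 ?_
    have h1 := C.mul_mem (C.inv_mem (hf _ p.out.2)) (hpq' ▸ hf _ q.out.2)
    rw [mem_subgroupOf]
    simpa using h1
  have := Finite.of_injective _ hinj
  exact (finiteIndex_of_finite_quotient (H := C.subgroupOf K)).index_ne_zero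

theorem exists_pow_mem_of_finiteIndex (H : Subgroup G) [h : H.FiniteIndex] (g : G) :
    ∃ n : ℕ, n ≠ 0 ∧ g ^ n ∈ H := by
  obtain ⟨n, hn, -, hg⟩ := exists_pow_mem_of_index_ne_zero h.index_ne_zero g
  exact ⟨n, hn.ne', hg⟩

/-- `H.map` of conjugation by `g`, characterised by its elements. -/
theorem mem_map_conj {H : Subgroup G} {g x : G} :
    x ∈ H.map (MulAut.conj g).toMonoidHom ↔ g⁻¹ * x * g ∈ H := by
  constructor
  · rintro ⟨y, hy, rfl⟩
    simpa [mul_assoc] using hy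
  · intro h
    exact ⟨_, h, by simp [mul_assoc]⟩

end Subgroup

/-- Conjugation by `g` maps `L` into itself and preserves `K`, and its positive powers move every
element of `K` into `L`. -/
structure IsContracted {G : Type*} [Group G] (K L : Subgroup G) (g : G) : Prop where
  le : L ≤ K
  mem_iff : ∀ x, g * x * g⁻¹ ∈ K ↔ x ∈ K
  conj_mem : ∀ x ∈ L, g * x * g⁻¹ ∈ L
  absorb : ∀ x ∈ K, ∃ n : ℕ, g ^ n * x * (g ^ n)⁻¹ ∈ L

/-- The union of the subgroups `t⁻ⁿ H tⁿ`. -/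
def ascUnion {G : Type*} [Group G] (H : Subgroup G) (t : G) : Subgroup G :=
  ⨆ n : ℕ, H.comap (MulAut.conj (t ^ n)).toMonoidHom

section

variable {G : Type*} [Group G]

theorem conj_pow_mem_of_le {H : Subgroup G} {t : G} (h : ∀ x ∈ H, t * x * t⁻¹ ∈ H) {m n : ℕ}
    (hmn : m ≤ n) {x : G} (hx : t ^ m * x * (t ^ m)⁻¹ ∈ H) : t ^ n * x * (t ^ n)⁻¹ ∈ H := by
  obtain ⟨k, rfl⟩ := Nat.exists_eq_add_of_le hmn
  have := conj_pow_mem h k hx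
  rwa [show t ^ k * (t ^ m * x * (t ^ m)⁻¹) * (t ^ k)⁻¹ = t ^ (m + k) * x * (t ^ (m + k))⁻¹ by
    rw [add_comm, pow_add]; group] at this

theorem mem_ascUnion {H : Subgroup G} {t : G} (h : ∀ x ∈ H, t * x * t⁻¹ ∈ H) {x : G} :
    x ∈ ascUnion H t ↔ ∃ n : ℕ, t ^ n * x * (t ^ n)⁻¹ ∈ H := by
  rw [ascUnion, Subgroup.mem_iSup_of_directed]
  · rfl
  · refine Monotone.directed_le fun m n hmn x hx => ?_
    exact conj_pow_mem_of_le h hmn hx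

theorem isContracted_ascUnion {H : Subgroup G} {t : G} (h : ∀ x ∈ H, t * x * t⁻¹ ∈ H) :
    IsContracted (ascUnion H t) H t where
  le x hx := (mem_ascUnion h).2 ⟨0, by simpa using hx⟩
  mem_iff x := by
    rw [mem_ascUnion h, mem_ascUnion h]
    have key : ∀ n : ℕ, t ^ n * (t * x * t⁻¹) * (t ^ n)⁻¹ = t ^ (n + 1) * x * (t ^ (n + 1))⁻¹ :=
      fun n => by rw [pow_succ]; group
    constructor
    · rintro ⟨n, hn⟩
      exact ⟨n + 1, key n ▸ hn⟩
    · rintro ⟨n, hn⟩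
      exact ⟨n, (key n).symm ▸ conj_pow_mem_of_le h (Nat.le_succ n) hn⟩
  conj_mem := h
  absorb x hx := (mem_ascUnion h).1 hx

theorem conj_pow_mem_iff {K : Subgroup G} {g : G} (h : ∀ x, g * x * g⁻¹ ∈ K ↔ x ∈ K) (n : ℕ) (x : G) :
    g ^ n * x * (g ^ n)⁻¹ ∈ K ↔ x ∈ K := by
  induction n with
  | zero => simp
  | succ n ih =>
    rw [← ih, ← h (g ^ n * x * (g ^ n)⁻¹), pow_succ']
    simp [mul_assoc]

theorem conj_inv_mem_iff {K : Subgroup G} {g : G} (h : ∀ x, g * x * g⁻¹ ∈ K ↔ x ∈ K) (x : G) :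
    g⁻¹ * x * g ∈ K ↔ x ∈ K := by
  rw [← h]; simp [mul_assoc]

theorem conj_mem_of_mem_sup {K H : Subgroup G} {g : G} (hH : ∀ h ∈ H, ∀ x ∈ K, h * x * h⁻¹ ∈ K)
    (h : ∀ x, g * x * g⁻¹ ∈ K ↔ x ∈ K) {y : G} (hy : y ∈ H ⊔ Subgroup.zpowers g) (x : G) :
    y * x * y⁻¹ ∈ K ↔ x ∈ K := by
  have : H ⊔ Subgroup.zpowers g ≤ Subgroup.normalizer (K : Set G) := by
    refine sup_le (fun z hz => ?_) ?_
    · rw [Subgroup.mem_normalizer_iff]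
      refine fun x => ⟨hH z hz x, fun hx => ?_⟩
      have := hH z⁻¹ (H.inv_mem hz) _ hx
      simpa [mul_assoc] using this
    · rw [Subgroup.zpowers_le, Subgroup.mem_normalizer_iff]
      exact fun x => (h x).symm
  exact (Subgroup.mem_normalizer_iff.1 (this hy) x).symm

namespace IsContracted

variable {K L : Subgroup G} {g : G}

theorem pow (h : IsContracted K L g) {m : ℕ} (hm : m ≠ 0) : IsContracted K L (g ^ m) where
  le := h.le
  mem_iff := conj_pow_mem_iff h.mem_iff m
  conj_mem x hx := conj_pow_mem h.conj_mem m hx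
  absorb x hx := by
    obtain ⟨n, hn⟩ := h.absorb x hx
    refine ⟨n, ?_⟩
    rw [← pow_mul]
    exact conj_pow_mem_of_le h.conj_mem (Nat.le_mul_of_pos_left n (Nat.pos_of_ne_zero hm)) hn

theorem inf_normal (h : IsContracted K L g) (N : Subgroup G) [hN : N.Normal] :
    IsContracted (K ⊓ N) (L ⊓ N) g where
  le := inf_le_inf_right N h.le
  mem_iff x := by
    rw [Subgroup.mem_inf, Subgroup.mem_inf, h.mem_iff]
    refine and_congr_right fun _ => ⟨fun hx => ?_, fun hx => hN.conj_mem x hx g⟩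
    have := hN.conj_mem _ hx g⁻¹
    simpa [mul_assoc] using this
  conj_mem x hx := ⟨h.conj_mem x hx.1, hN.conj_mem x hx.2 g⟩
  absorb x hx := by
    obtain ⟨n, hn⟩ := h.absorb x hx.1
    exact ⟨n, hn, hN.conj_mem x hx.2 _⟩

/-- Contraction depends only on the automorphism that `g` induces on `K`. In practice `g'` differs
from `g` by an element centralizing `K`. -/
theorem congr (h : IsContracted K L g) {g' : G} (hg : ∀ x ∈ K, g' * x * g'⁻¹ = g * x * g⁻¹) :
    IsContracted K L g' := by
  have hpow : ∀ n : ℕ, ∀ x ∈ K, g' ^ n * x * (g' ^ n)⁻¹ = g ^ n * x * (g ^ n)⁻¹ := by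
    intro n
    induction n with
    | zero => simp
    | succ n ih =>
      intro x hx
      have h1 := hg _ ((conj_pow_mem_iff h.mem_iff n x).2 hx)
      rw [← ih x hx] at h1
      calc g' ^ (n + 1) * x * (g' ^ (n + 1))⁻¹ = g' * (g' ^ n * x * (g' ^ n)⁻¹) * g'⁻¹ := by
            rw [pow_succ']; group
        _ = g * (g ^ n * x * (g ^ n)⁻¹) * g⁻¹ := by rw [h1, ih x hx]
        _ = _ := by rw [pow_succ']; group
  refine ⟨h.le, fun x => ⟨fun hx => ?_, fun hx => ?_⟩, fun x hx => ?_, fun x hx => ?_⟩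
  · have h1 := hg _ ((conj_inv_mem_iff h.mem_iff _).2 hx)
    have h2 : g' * (g⁻¹ * (g' * x * g'⁻¹) * g) * g'⁻¹ = g' * x * g'⁻¹ := by
      rw [h1]; group
    have h3 := mul_left_cancel (mul_right_cancel h2)
    rw [← h3]
    exact (conj_inv_mem_iff h.mem_iff _).2 hx
  · rw [hg x hx]; exact (h.mem_iff x).2 hx
  · rw [hg x (h.le hx)]; exact h.conj_mem x hx
  · obtain ⟨n, hn⟩ := h.absorb x hx
    exact ⟨n, by rwa [hpow n x hx]⟩

/-- The join of the conjugates of `L` by `gʲ` with `j < e` is invariant under `g`: the last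
conjugate is sent to `gᵉ L g⁻ᵉ ≤ L`. It is finitely generated since the join is finite. -/
theorem of_pow {e : ℕ} (he : e ≠ 0) (h : IsContracted K L (g ^ e))
    (hg : ∀ x, g * x * g⁻¹ ∈ K ↔ x ∈ K) (hL : L.FG) :
    ∃ L' : Subgroup G, L'.FG ∧ L ≤ L' ∧ IsContracted K L' g := by
  let L' : Subgroup G := ⨆ j : Fin e, L.map (MulAut.conj (g ^ (j : ℕ))).toMonoidHom
  have hmem : ∀ j : ℕ, j < e → L.map (MulAut.conj (g ^ j)).toMonoidHom ≤ L' := fun j hj =>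
    le_iSup (fun j : Fin e => L.map (MulAut.conj (g ^ (j : ℕ))).toMonoidHom) ⟨j, hj⟩
  have hLL' : L ≤ L' := fun x hx => hmem 0 (Nat.pos_of_ne_zero he) (by
    rw [Subgroup.mem_map_conj]; simpa using hx)
  have hconj : L'.map (MulAut.conj g).toMonoidHom ≤ L' := by
    rw [Subgroup.map_iSup]
    refine iSup_le fun j => ?_
    have h1 : (L.map (MulAut.conj (g ^ (j : ℕ))).toMonoidHom).map (MulAut.conj g).toMonoidHom =
        L.map (MulAut.conj (g ^ (j + 1 : ℕ))).toMonoidHom := by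
      ext x
      simp only [Subgroup.mem_map_conj]
      rw [pow_succ' g j]
      simp [mul_assoc]
    rw [h1]
    rcases Nat.lt_or_ge (j + 1) e with hj | hj
    · exact hmem _ hj
    · have hje : (j : ℕ) + 1 = e := le_antisymm j.2 hj
      rw [hje]
      rintro _ ⟨x, hx, rfl⟩
      exact hLL' (h.conj_mem x hx)
  refine ⟨L', Subgroup.FG.iSup _ fun j => hL.map_hom _, hLL', ?_, hg, ?_, ?_⟩
  · refine iSup_le fun j => ?_
    rintro _ ⟨x, hx, rfl⟩
    exact (conj_pow_mem_iff hg j x).2 (h.le hx)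
  · exact fun x hx => hconj ⟨x, hx, rfl⟩
  · intro x hx
    obtain ⟨n, hn⟩ := h.absorb x hx
    exact ⟨e * n, hLL' (by rwa [pow_mul])⟩

/-- For each representative `d` of the finitely many cosets of `C` in `K`, conjugation by `g` gives
another representative times an error in `C`. One conjugate `g⁻ᵐ L gᵐ` contains all the errors, and
together with the representatives it generates the new invariant subgroup. -/
theorem of_relIndex {C : Subgroup G} (h : IsContracted C L g) (hCK : C ≤ K)
    (hi : C.relIndex K ≠ 0) (hg : ∀ x, g * x * g⁻¹ ∈ K ↔ x ∈ K) (hL : L.FG) :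
    ∃ L' : Subgroup G, L'.FG ∧ IsContracted K L' g := by
  obtain ⟨D, hD, hDK, hcov⟩ := Subgroup.exists_finite_cover_of_relIndex_ne_zero hi
  have h1 : ∀ d ∈ D, ∃ d' ∈ D, ∃ n : ℕ,
      g ^ n * (d'⁻¹ * (g * d * g⁻¹)) * (g ^ n)⁻¹ ∈ L := by
    intro d hd
    obtain ⟨d', hd', hdd'⟩ := hcov _ ((hg d).2 (hDK hd))
    obtain ⟨n, hn⟩ := h.absorb _ hdd'
    exact ⟨d', hd', n, hn⟩
  choose! f hfD ν hν using h1
  obtain ⟨m, hm⟩ := (hD.image ν).bddAbove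
  let L₂ : Subgroup G := L.map (MulAut.conj (g ^ m)⁻¹).toMonoidHom
  have hL₂ : ∀ x, x ∈ L₂ ↔ g ^ m * x * (g ^ m)⁻¹ ∈ L := fun x => by
    rw [Subgroup.mem_map_conj, inv_inv]
  have hLL₂ : L ≤ L₂ := fun x hx => (hL₂ x).2 (conj_pow_mem h.conj_mem m hx)
  let L' : Subgroup G := L₂ ⊔ Subgroup.closure D
  have hconj : L'.map (MulAut.conj g).toMonoidHom ≤ L' := by
    rw [Subgroup.map_sup, MonoidHom.map_closure]
    refine sup_le ?_ ((Subgroup.closure_le _).2 ?_)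
    · rintro _ ⟨x, hx, rfl⟩
      refine Subgroup.mem_sup_left ((hL₂ _).2 ?_)
      have := h.conj_mem _ ((hL₂ x).1 hx)
      rw [show g * (g ^ m * x * (g ^ m)⁻¹) * g⁻¹ = (g * g ^ m) * x * (g * g ^ m)⁻¹ by group,
        ← pow_succ', pow_succ] at this
      simpa [mul_assoc] using this
    · rintro _ ⟨d, hd, rfl⟩
      have h2 : (f d)⁻¹ * (g * d * g⁻¹) ∈ L₂ :=
        (hL₂ _).2 (conj_pow_mem_of_le h.conj_mem (hm ⟨d, hd, rfl⟩) (hν d hd))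
      have h3 := L'.mul_mem (Subgroup.mem_sup_right (Subgroup.subset_closure (hfD d hd)))
        (Subgroup.mem_sup_left h2)
      simpa using h3
  have hconj' : ∀ x ∈ L', g * x * g⁻¹ ∈ L' := fun x hx => hconj ⟨x, hx, rfl⟩
  refine ⟨L', (hL.map_hom _).sup ⟨hD.toFinset, by simp⟩, ?_, hg, hconj', ?_⟩
  · refine sup_le (fun x hx => hCK ?_) ((Subgroup.closure_le _).2 hDK)
    exact (conj_pow_mem_iff h.mem_iff m x).1 (h.le ((hL₂ x).1 hx))
  · intro x hx
    obtain ⟨d, hd, hdx⟩ := hcov x hx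
    obtain ⟨n, hn⟩ := h.absorb _ hdx
    refine ⟨n, ?_⟩
    have hd' : g ^ n * d * (g ^ n)⁻¹ ∈ L' :=
      conj_pow_mem hconj' n (Subgroup.mem_sup_right (Subgroup.subset_closure hd))
    have := L'.mul_mem hd' (Subgroup.mem_sup_left (hLL₂ hn))
    rwa [show g ^ n * d * (g ^ n)⁻¹ * (g ^ n * (d⁻¹ * x) * (g ^ n)⁻¹) = g ^ n * x * (g ^ n)⁻¹ by
      group] at this

end IsContracted

/-- Let `N` be a normal subgroup of finite index in a torsion-free group, such that the centralizer
`K` in `N` of the commutator subgroup of `N` is commutative and contains that commutator subgroup.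
Then the centralizer of `K` is commutative. -/
theorem centralizer_comm_of_finiteIndex [TorsionFree G] {N K : Subgroup G} [N.FiniteIndex]
    (hKN : K ≤ N) (hK : ∀ x ∈ K, ∀ y ∈ K, x * y = y * x)
    (hC : ∀ x ∈ N, (∀ y ∈ ⁅N, N⁆, x * y = y * x) → x ∈ K) (hN : ⁅N, N⁆ ≤ K) :
    N ⊓ Subgroup.centralizer (K : Set G) = K ∧
    ∀ x ∈ Subgroup.centralizer (K : Set G), ∀ y ∈ Subgroup.centralizer (K : Set G),
      x * y = y * x := by
  have h1 : N ⊓ Subgroup.centralizer (K : Set G) = K := by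
    refine le_antisymm (fun x hx => hC x hx.1 fun y hy => ?_) (fun x hx => ⟨hKN hx, ?_⟩)
    · exact (Subgroup.mem_centralizer_iff.1 hx.2 y (hN hy)).symm
    · exact Subgroup.mem_centralizer_iff.2 fun y hy => hK y hy x hx
  refine ⟨h1, ?_⟩
  set C := Subgroup.centralizer (K : Set G) with hCdef
  -- `K = N ∩ C` is central in its centralizer `C` and of finite index there, so the transfer
  -- argument applies to `C`.
  have h2 : K.subgroupOf C ≤ Subgroup.center C := by
    intro x hx
    rw [Subgroup.mem_center_iff]
    intro y
    exact Subtype.ext (Subgroup.mem_centralizer_iff.1 y.2 x hx).symm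
  have h3 : (K.subgroupOf C).FiniteIndex := by
    constructor
    have : K.relIndex C = N.relIndex C := by
      rw [← h1, Subgroup.inf_relIndex_right]
    change K.relIndex C ≠ 0
    rw [this]
    have h5 : (N.subgroupOf C).FiniteIndex := inferInstance
    exact h5.index_ne_zero
  have h4 : (Subgroup.center C).FiniteIndex := Subgroup.finiteIndex_of_le h2
  intro x hx y hy
  exact congrArg Subtype.val (TorsionFree.mul_comm_of_finiteIndex_center (⟨x, hx⟩ : C) ⟨y, hy⟩)

end

section RankOne

variable {G : Type u} [Group G] [TorsionFree G] [HasHirsch G]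

/-- The cyclic group generated by `y` exhausts the length, so the quotient of `K` by it is torsion.
-/
theorem exists_pow_mem_zpowers_of_hirschLength_le_one {K : Subgroup G}
    (hK : ∀ x ∈ K, ∀ y ∈ K, x * y = y * x) (h1 : hirschLength K ≤ 1) {x y : G} (hx : x ∈ K)
    (hy : y ∈ K) (hy1 : y ≠ 1) : ∃ n : ℕ, n ≠ 0 ∧ x ^ n ∈ Subgroup.zpowers y := by
  let y' : K := ⟨y, hy⟩
  have hn : (Subgroup.zpowers y').Normal := ⟨fun z hz g => by
    have : g * z * g⁻¹ = z := by
      rw [mul_inv_eq_iff_eq_mul]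
      exact Subtype.ext (hK _ g.2 _ z.2)
    rwa [this]⟩
  have hy' : y' ≠ 1 := fun h => hy1 (congrArg Subtype.val h)
  have h2 := hirschLength_eq_add (Subgroup.zpowers y')
  rw [hirschLength_zpowers (TorsionFree.not_isOfFinOrder hy')] at h2
  have h3 : hirschLength (K ⧸ Subgroup.zpowers y') < 1 := by
    rw [h2] at h1
    by_contra hge
    have h4 : (1 : ℕ∞) + 1 ≤ 1 := (add_le_add_right (not_lt.1 hge) 1).trans h1
    exact absurd h4 (by decide)
  obtain ⟨n, hn0, hn1⟩ := isOfFinOrder_iff_pow_eq_one.1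
    (isOfFinOrder_of_hirschLength_lt_one h3 ((⟨x, hx⟩ : K) : K ⧸ Subgroup.zpowers y'))
  rw [← QuotientGroup.mk_pow, QuotientGroup.eq_one_iff] at hn1
  obtain ⟨m, hm⟩ := hn1
  exact ⟨n, hn0.ne', m, congrArg Subtype.val hm⟩

/-- A power of `x` is a power of `y`, hence fixed by `g`, and roots in `K` are unique. -/
theorem commute_of_hirschLength_le_one {K : Subgroup G}
    (hK : ∀ x ∈ K, ∀ y ∈ K, x * y = y * x) (h1 : hirschLength K ≤ 1) {g y : G}
    (hg : ∀ x ∈ K, g * x * g⁻¹ ∈ K) (hy : y ∈ K) (hy1 : y ≠ 1) (hgy : g * y = y * g) :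
    ∀ x ∈ K, g * x = x * g := by
  intro x hx
  obtain ⟨n, hn, m, hm⟩ := exists_pow_mem_zpowers_of_hirschLength_le_one hK h1 hx hy hy1
  have hm : y ^ m = x ^ n := hm
  have h2 : (g * x * g⁻¹) ^ n = x ^ n := by
    rw [conj_pow, ← hm, mul_inv_eq_iff_eq_mul]
    exact Commute.zpow_right hgy m
  have h3 := TorsionFree.eq_of_pow_eq hn (hK _ (hg x hx) _ hx) h2
  rwa [mul_inv_eq_iff_eq_mul] at h3

end RankOne

/-! ### The maximal condition on subgroups and polycyclicity -/

/-- Every subgroup of `G` is finitely generated. -/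
class SubgroupsFG (G : Type*) [Group G] : Prop where
  fg : ∀ H : Subgroup G, H.FG

namespace SubgroupsFG

theorem of_surjective {G K : Type*} [Group G] [Group K] [hG : SubgroupsFG G] (f : G →* K)
    (hf : Surjective f) : SubgroupsFG K :=
  ⟨fun H => by
    rw [← Subgroup.map_comap_eq_self_of_surjective hf H]
    exact (hG.fg _).map_hom f⟩

instance {G : Type*} [Group G] [hG : SubgroupsFG G] (N : Subgroup G) : SubgroupsFG N :=
  ⟨fun H => by
    obtain ⟨S, hS⟩ := hG.fg (H.map N.subtype)
    have : H = (Subgroup.closure (S : Set G)).comap N.subtype := by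
      rw [hS, Subgroup.comap_map_eq_self_of_injective N.subtype_injective]
    have hSN : (S : Set G) ⊆ N.subtype.range := by
      intro s hs
      have h1 : s ∈ H.map N.subtype := hS ▸ Subgroup.subset_closure hs
      obtain ⟨y, -, rfl⟩ := h1
      exact ⟨y, rfl⟩
    refine (Subgroup.fg_iff H).2 ⟨N.subtype ⁻¹' S, ?_, S.finite_toSet.preimage
      N.subtype_injective.injOn⟩
    apply Subgroup.map_injective N.subtype_injective
    rw [MonoidHom.map_closure, Set.image_preimage_eq_of_subset hSN, hS]⟩

instance {G : Type*} [Group G] [hG : SubgroupsFG G] : Group.FG G := Group.fg_def.2 (hG.fg ⊤)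

theorem of_comm {G : Type*} [Group G] [Group.FG G] (hc : ∀ x y : G, x * y = y * x) :
    SubgroupsFG G := by
  let _ : CommGroup G := { ‹Group G› with mul_comm := hc }
  have : AddGroup.FG (Additive G) := GroupFG.iff_add_fg.1 ‹_›
  have : Module.Finite ℤ (Additive G) := Module.Finite.iff_addGroup_fg.2 this
  have : IsNoetherian ℤ (Additive G) := inferInstance
  refine ⟨fun H => ?_⟩
  rw [Subgroup.fg_iff_add_fg]
  have h1 := IsNoetherian.noetherian (AddSubgroup.toIntSubmodule (Subgroup.toAddSubgroup H))
  rw [Submodule.fg_iff_addSubgroup_fg] at h1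
  simpa using h1

theorem of_extension {G : Type*} [Group G] (N : Subgroup G) [N.Normal] [hN : SubgroupsFG N]
    [hQ : SubgroupsFG (G ⧸ N)] : SubgroupsFG G := by
  refine ⟨fun H => ?_⟩
  obtain ⟨F, hF, hFH⟩ : ∃ F : Subgroup G, F.FG ∧ F ≤ H ∧
      F.map (QuotientGroup.mk' N) = H.map (QuotientGroup.mk' N) := by
    have h1 : (H.map (QuotientGroup.mk' N)).FG := hQ.fg _
    have h2 := (Group.fg_iff_subgroup_fg _).2 h1
    obtain ⟨F', hF', hF''⟩ := Subgroup.FG.exists_map_eq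
      ((QuotientGroup.mk' N).subgroupMap_surjective H) (Group.fg_def.1 h2)
    refine ⟨F'.map H.subtype, hF'.map_hom _, ?_, ?_⟩
    · rintro _ ⟨x, -, rfl⟩
      exact x.2
    · have h3 := congrArg (Subgroup.map (H.map (QuotientGroup.mk' N)).subtype) hF''
      rw [Subgroup.map_map] at h3
      rw [Subgroup.map_map]
      have h4 : (QuotientGroup.mk' N).comp H.subtype =
        (H.map (QuotientGroup.mk' N)).subtype.comp ((QuotientGroup.mk' N).subgroupMap H) := rfl
      rw [h4, h3, ← MonoidHom.range_eq_map, Subgroup.range_subtype]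
  have h5 : (H ⊓ N).FG := by
    have := (hN.fg (H.subgroupOf N)).map_hom N.subtype
    rwa [Subgroup.subgroupOf_map_subtype] at this
  have : H = F ⊔ (H ⊓ N) := by
    refine le_antisymm (fun x hx => ?_) (sup_le hFH.1 inf_le_left)
    obtain ⟨y, hy, hyx⟩ : (x : G ⧸ N) ∈ F.map (QuotientGroup.mk' N) := hFH.2 ▸ ⟨x, hx, rfl⟩
    have h6 : y⁻¹ * x ∈ N := QuotientGroup.eq.1 hyx
    have h7 := Subgroup.mul_mem _ (Subgroup.mem_sup_left (T := H ⊓ N) hy)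
      (Subgroup.mem_sup_right (S := F) ⟨H.mul_mem (H.inv_mem (hFH.1 hy)) hx, h6⟩)
    rwa [mul_inv_cancel_left] at h7
  rw [this]
  exact hF.sup h5

instance (priority := 100) of_finite {G : Type*} [Group G] [Finite G] : SubgroupsFG G :=
  ⟨fun H => ⟨(Set.toFinite (H : Set G)).toFinset, by simp⟩⟩

theorem of_finiteIndex {G : Type*} [Group G] (N : Subgroup G) [N.FiniteIndex] [hN : SubgroupsFG N] :
    SubgroupsFG G := by
  have : SubgroupsFG N.normalCore :=
    of_surjective (G := N.normalCore.subgroupOf N)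
      (Subgroup.subgroupOfEquivOfLe N.normalCore_le).toMonoidHom (MulEquiv.surjective _)
  exact of_extension N.normalCore

end SubgroupsFG

theorem Subgroup.FG.of_le_of_comm {G : Type*} [Group G] {L M : Subgroup G} (hL : L.FG)
    (hc : ∀ x ∈ L, ∀ y ∈ L, x * y = y * x) (hML : M ≤ L) : M.FG := by
  have : Group.FG L := (Group.fg_iff_subgroup_fg L).2 hL
  have : SubgroupsFG L := .of_comm fun x y => Subtype.ext (hc x x.2 y y.2)
  have h := (this.fg (M.subgroupOf L)).map_hom L.subtype
  rwa [Subgroup.subgroupOf_map_subtype, inf_eq_left.2 hML] at h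

/-- All subgroups above `N` are normal, so generators of `G` can be adjoined one at a time with
cyclic quotients. -/
theorem IsPolycyclic.of_commutator_le {G : Type u} [Group G] [Group.FG G] {N : Subgroup G}
    (hN : commutator G ≤ N) (hNp : IsPolycyclic N) : IsPolycyclic G := by
  classical
  obtain ⟨S, hS⟩ := Group.fg_def.1 ‹Group.FG G›
  have key : ∀ T : Finset G, IsPolycyclic (N ⊔ Subgroup.closure (T : Set G) : Subgroup G) := by
    intro T
    induction T using Finset.induction_on with
    | empty =>
      have : N ⊔ Subgroup.closure ((∅ : Finset G) : Set G) = N := by simp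
      rwa [this]
    | insert s T _ ih =>
      set M := N ⊔ Subgroup.closure (T : Set G) with hM
      have hMn : M.Normal := .of_commutator_le _ (hN.trans (hM ▸ le_sup_left))
      have h1 : N ⊔ Subgroup.closure ((insert s T : Finset G) : Set G) = M ⊔ Subgroup.zpowers s := by
        rw [Finset.coe_insert, Set.insert_eq, Subgroup.closure_union, ← Subgroup.zpowers_eq_closure,
          hM, sup_assoc, sup_comm (Subgroup.zpowers s)]
      rw [h1]
      set P := M ⊔ Subgroup.zpowers s with hP
      have hs : s ∈ P := hP ▸ Subgroup.mem_sup_right (Subgroup.mem_zpowers s)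
      have hMP : M ≤ P := hP ▸ le_sup_left
      refine .of_sup_zpowers (M := M.subgroupOf P) (s := ⟨s, hs⟩) ?_
        (ih.of_surjective (Subgroup.subgroupOfEquivOfLe hMP).symm.toMonoidHom
          (MulEquiv.surjective _))
      apply Subgroup.map_injective P.subtype_injective
      rw [Subgroup.map_sup, Subgroup.subgroupOf_map_subtype, inf_eq_left.2 hMP,
        MonoidHom.map_zpowers, ← MonoidHom.range_eq_map, Subgroup.range_subtype]
      exact hP.symm
  have h2 := key S
  rw [hS, sup_top_eq] at h2
  exact h2.of_surjective Subgroup.topEquiv.toMonoidHom (MulEquiv.surjective _)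

/-- The derived series is climbed from the bottom: each term is finitely generated, and the next
lower term is its commutator subgroup. -/
theorem IsPolycyclic.of_isSolvable {G : Type u} [Group G] [SubgroupsFG G]
    [hs : Group.IsSolvable G] : IsPolycyclic G := by
  obtain ⟨n, hn⟩ := hs.solvable
  have key : ∀ k : ℕ, k ≤ n → IsPolycyclic (derivedSeries G (n - k)) := by
    intro k
    induction k with
    | zero =>
      intro _
      rw [Nat.sub_zero, hn]
      exact .trivial _ inferInstance
    | succ k ih =>
      intro hk
      have h1 := ih (by omega)
      obtain ⟨m, hm⟩ : ∃ m, n - k = m + 1 := ⟨n - (k + 1), by omega⟩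
      rw [hm, derivedSeries_succ] at h1
      rw [show n - (k + 1) = m by omega]
      refine .of_commutator_le (N := commutator (derivedSeries G m)) le_rfl ?_
      have h2 : (commutator (derivedSeries G m)).map (derivedSeries G m).subtype =
          ⁅derivedSeries G m, derivedSeries G m⁆ := by
        rw [commutator_def, Subgroup.map_commutator, ← MonoidHom.range_eq_map, Subgroup.range_subtype]
      rw [← h2] at h1
      exact h1.of_surjective (Subgroup.equivMapOfInjective _ _
        (Subgroup.subtype_injective _)).symm.toMonoidHom (MulEquiv.surjective _)
  have h := key n le_rfl
  rw [Nat.sub_self, derivedSeries_zero] at h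
  exact h.of_surjective Subgroup.topEquiv.toMonoidHom (MulEquiv.surjective _)

/-! ### Hirsch length of cyclic extensions and ascending unions -/

section

variable {G : Type u} [Group G]

theorem normal_subgroupOf_sup_zpowers {K : Subgroup G} {t : G} (h : ∀ x, t * x * t⁻¹ ∈ K ↔ x ∈ K) :
    (K.subgroupOf (K ⊔ Subgroup.zpowers t)).Normal := by
  refine ⟨fun x hx y => ?_⟩
  rw [Subgroup.mem_subgroupOf] at hx ⊢
  exact (conj_mem_of_mem_sup (fun z hz w hw => K.mul_mem (K.mul_mem hz hw) (K.inv_mem hz)) h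
    y.2 x).2 hx

theorem subgroupOf_sup_zpowers_eq_top {K : Subgroup G} {t : G}
    (ht : t ∈ K ⊔ Subgroup.zpowers t) :
    K.subgroupOf (K ⊔ Subgroup.zpowers t) ⊔
      Subgroup.zpowers (⟨t, ht⟩ : (K ⊔ Subgroup.zpowers t : Subgroup G)) = ⊤ := by
  apply Subgroup.map_injective (K ⊔ Subgroup.zpowers t).subtype_injective
  rw [Subgroup.map_sup, Subgroup.subgroupOf_map_subtype, inf_eq_left.2 le_sup_left,
    MonoidHom.map_zpowers, ← MonoidHom.range_eq_map, Subgroup.range_subtype]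
  rfl

theorem hirschLength_of_sup_zpowers_eq_top [HasHirsch G] {K : Subgroup G} [K.Normal] {t : G}
    (hsup : K ⊔ Subgroup.zpowers t = ⊤) (ht : ∀ k : ℕ, k ≠ 0 → t ^ k ∉ K) :
    hirschLength G = hirschLength K + 1 := by
  have hcyc : IsCyclic (G ⧸ K) := ⟨(t : G ⧸ K), fun x => by
    induction x using QuotientGroup.induction_on with
    | H x => exact QuotientGroup.exists_zpow_eq_of_sup_eq_top hsup x⟩
  have hinf : Infinite (G ⧸ K) := by
    by_contra h
    rw [not_infinite_iff_finite] at h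
    obtain ⟨n, hn, h1⟩ := isOfFinOrder_iff_pow_eq_one.1 (isOfFinOrder_of_finite (t : G ⧸ K))
    rw [← QuotientGroup.mk_pow, QuotientGroup.eq_one_iff] at h1
    exact ht n hn.ne' h1
  rw [hirschLength_eq_add K, HasHirschLength.infiniteCyclic_hirschLength
    (G := G ⧸ K) intCyclicMulEquiv.symm]

theorem hirschLength_sup_zpowers [HasHirsch G] {K : Subgroup G} {t : G}
    (h : ∀ x, t * x * t⁻¹ ∈ K ↔ x ∈ K) (ht : ∀ k : ℕ, k ≠ 0 → t ^ k ∉ K) :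
    hirschLength (K ⊔ Subgroup.zpowers t : Subgroup G) = hirschLength K + 1 := by
  have htm : t ∈ K ⊔ Subgroup.zpowers t := Subgroup.mem_sup_right (Subgroup.mem_zpowers t)
  have := normal_subgroupOf_sup_zpowers h
  rw [hirschLength_of_sup_zpowers_eq_top (subgroupOf_sup_zpowers_eq_top htm) (fun k hk hmem =>
    ht k hk hmem)]
  rw [hirschLength_congr (Subgroup.subgroupOfEquivOfLe (le_sup_left :
    K ≤ K ⊔ Subgroup.zpowers t))]

/-- The Hirsch length of an ascending union. -/
theorem IsContracted.hirschLength_eq [HasHirsch G] {K L : Subgroup G} {g : G}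
    (h : IsContracted K L g) : hirschLength K = hirschLength L := by
  refine le_antisymm ?_ (hirschLength_mono h.le)
  refine hirschLength_le_of_fg (hasHirschLength K) fun F hF => ?_
  obtain ⟨S, hS⟩ := hF
  -- A single power of `g` carries a finitely generated subgroup of `K` into `L`, and such subgroups
  -- determine the length.
  have h1 : ∃ m : ℕ, ∀ s ∈ S, g ^ m * (s : G) * (g ^ m)⁻¹ ∈ L := by
    choose ν hν using fun s : K => h.absorb s s.2
    obtain ⟨m, hm⟩ := (S.finite_toSet.image ν).bddAbove
    exact ⟨m, fun s hs => conj_pow_mem_of_le h.conj_mem (hm ⟨s, hs, rfl⟩) (hν s)⟩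
  obtain ⟨m, hm⟩ := h1
  have h2 : F ≤ (L.comap (MulAut.conj (g ^ m)).toMonoidHom).comap K.subtype := by
    rw [← hS, Subgroup.closure_le]
    exact hm
  let f : F →* L := ((MulAut.conj (g ^ m)).toMonoidHom.comp (K.subtype.comp F.subtype)).codRestrict L
    (fun x => h2 x.2)
  refine hirschLength_le_of_injective (G := L) f ?_
  intro x y hxy
  have h3 := congrArg Subtype.val hxy
  apply Subtype.ext
  apply Subtype.ext
  exact (MulAut.conj (g ^ m)).injective h3

theorem finite_of_comm_of_fg [Group.FG G] (hc : ∀ x y : G, x * y = y * x)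
    (ht : ∀ x : G, IsOfFinOrder x) : Finite G := by
  let _ : CommGroup G := { ‹Group G› with mul_comm := hc }
  exact CommGroup.finite_of_fg_isMulTorsion G ht

end

/-! ### Self-centralizing normal subgroups of rank one -/

open scoped commutatorElement

section

variable {G : Type u} [Group G]

theorem conj_mem_of_commutator_le {N K : Subgroup G} (hN : ⁅N, N⁆ ≤ K) (hKN : K ≤ N) {x k : G}
    (hx : x ∈ N) (hk : k ∈ K) : x * k * x⁻¹ ∈ K := by
  have h1 := hN (Subgroup.commutator_mem_commutator hx (hKN hk))
  have h2 := K.mul_mem h1 hk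
  rwa [commutatorElement_def, inv_mul_cancel_right] at h2

theorem exists_ne_one_of_hirschLength_ne_zero {K : Subgroup G} (h : hirschLength K ≠ 0) :
    ∃ y ∈ K, y ≠ 1 := by
  by_contra! hK
  have : Subsingleton K := ⟨fun x y => Subtype.ext ((hK x x.2).trans (hK y y.2).symm)⟩
  exact h hirschLength_eq_zero_of_finite

theorem TorsionFree.quotient {C : Subgroup G} [C.Normal]
    (h : ∀ (x : G) (n : ℕ), n ≠ 0 → x ^ n ∈ C → x ∈ C) : TorsionFree (G ⧸ C) := by
  refine ⟨fun q hq => ?_⟩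
  obtain ⟨n, hn, hqn⟩ := isOfFinOrder_iff_pow_eq_one.1 hq
  induction q using QuotientGroup.induction_on with
  | H x =>
    rw [← QuotientGroup.mk_pow, QuotientGroup.eq_one_iff] at hqn
    rw [QuotientGroup.eq_one_iff]
    exact h x n hn.ne' hqn

variable [TorsionFree G] [HasHirsch G]

/-- Automorphisms of a torsion-free abelian group of rank one are multiplications by rational
numbers, hence commute. The fractions here are `i/n` for `x` and `j/m` for `y`, and the two sides
are compared after raising to the power `n * m`. -/
theorem mul_mul_eq_of_hirschLength_le_one {C : Subgroup G} [hn : C.Normal]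
    (hC : ∀ x ∈ C, ∀ y ∈ C, x * y = y * x) (h1 : hirschLength C ≤ 1) (x y : G) {c : G}
    (hc : c ∈ C) : x * (y * c * y⁻¹) * x⁻¹ = y * (x * c * x⁻¹) * y⁻¹ := by
  by_cases hc1 : c = 1
  · simp [hc1]
  obtain ⟨n, hn0, i, hi⟩ := exists_pow_mem_zpowers_of_hirschLength_le_one hC h1
    (hn.conj_mem c hc x) hc hc1
  obtain ⟨m, hm0, j, hj⟩ := exists_pow_mem_zpowers_of_hirschLength_le_one hC h1
    (hn.conj_mem c hc y) hc hc1
  have hi : c ^ i = (x * c * x⁻¹) ^ n := hi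
  have hj : c ^ j = (y * c * y⁻¹) ^ m := hj
  refine TorsionFree.eq_of_pow_eq (mul_ne_zero hn0 hm0) (hC _ (hn.conj_mem _ (hn.conj_mem c hc y) x)
    _ (hn.conj_mem _ (hn.conj_mem c hc x) y)) ?_
  have e1 : (x * (y * c * y⁻¹) * x⁻¹) ^ (n * m) = c ^ (i * j) := by
    rw [conj_pow, mul_comm n m, pow_mul, ← hj, ← zpow_natCast (c ^ j), ← zpow_mul, mul_comm,
      zpow_mul, ← conj_zpow, ← conj_zpow, zpow_natCast, conj_pow, ← conj_pow, ← hi, zpow_mul]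
  have e2 : (y * (x * c * x⁻¹) * y⁻¹) ^ (n * m) = c ^ (i * j) := by
    rw [conj_pow, pow_mul, ← hi, ← zpow_natCast (c ^ i), ← zpow_mul, mul_comm i,
      zpow_mul, ← conj_zpow, ← conj_zpow, zpow_natCast, ← hj, ← zpow_mul, mul_comm]
  rw [e1, e2]

/-- A self-centralizing normal subgroup of rank one, contracted by some element of infinite order
modulo the subgroup, with commutative quotient. -/
theorem exists_normal_of_hirschLength_eq_one {N K L : Subgroup G} [N.FiniteIndex] {g : G}
    (hKN : K ≤ N) (hK : ∀ x ∈ K, ∀ y ∈ K, x * y = y * x) (hK1 : hirschLength K = 1)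
    (hN : ⁅N, N⁆ ≤ K) (hself : ∀ x ∈ N, (∀ y ∈ K, x * y = y * x) → x ∈ K)
    (hL : L.FG) (hg : IsContracted K L g) (hgK : ∀ m : ℕ, m ≠ 0 → g ^ m ∉ K) :
    ∃ C : Subgroup G, C.Normal ∧ (∀ x ∈ C, ∀ y ∈ C, x * y = y * x) ∧ hirschLength C = 1 ∧
      commutator G ≤ C ∧ (∀ x, (∀ y ∈ C, x * y = y * x) → x ∈ C) ∧
      ∃ (g' : G) (L' : Subgroup G), L'.FG ∧ IsContracted C L' g' ∧
        ∀ m : ℕ, m ≠ 0 → g' ^ m ∉ C := by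
  set N₀ := N.normalCore with hN₀
  have hN₀N : N₀ ≤ N := N.normalCore_le
  set K₀ := K ⊓ N₀ with hK₀
  obtain ⟨m, hm, hgm⟩ := Subgroup.exists_pow_mem_of_finiteIndex N₀ g
  obtain ⟨y, hy, hy1⟩ := exists_ne_one_of_hirschLength_ne_zero (K := K) (by rw [hK1]; exact one_ne_zero)
  obtain ⟨n, hn, hyn⟩ := Subgroup.exists_pow_mem_of_finiteIndex N₀ y
  have hyn1 : y ^ n ≠ 1 := fun h => hy1 (TorsionFree.eq_one_of_pow hn h)
  have hcent : ∀ x ∈ N, ∀ z ∈ K, z ≠ 1 → x * z = z * x → x ∈ K := fun x hx z hz hz1 hxz =>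
    hself x hx (commute_of_hirschLength_le_one hK hK1.le
      (fun w hw => conj_mem_of_commutator_le hN hKN hx hw) hz hz1 hxz)
  have hcomm₀ : ⁅N₀, N₀⁆ ≤ K₀ :=
    le_inf ((Subgroup.commutator_mono hN₀N hN₀N).trans hN) (Subgroup.commutator_le_left _ _)
  -- This commutator is a nontrivial element of `⁅N₀, N₀⁆`. By rank one, anything in `N₀` commuting
  -- with it centralizes all of `K`, and so lies in `K₀`.
  have hz : ⁅g ^ m, y ^ n⁆ ∈ ⁅N₀, N₀⁆ := Subgroup.commutator_mem_commutator hgm hyn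
  have hz1 : ⁅g ^ m, y ^ n⁆ ≠ 1 := by
    intro h
    rw [commutatorElement_eq_one_iff_mul_comm] at h
    exact hgK m hm (hcent _ (hN₀N hgm) _ (K.pow_mem hy n) hyn1 h)
  have hK₀c : ∀ x ∈ K₀, ∀ y ∈ K₀, x * y = y * x := fun x hx y hy => hK x hx.1 y hy.1
  have hC₀ : ∀ x ∈ N₀, (∀ y ∈ ⁅N₀, N₀⁆, x * y = y * x) → x ∈ K₀ := fun x hx hxy =>
    ⟨hcent x (hN₀N hx) _ (hcomm₀ hz).1 hz1 (hxy _ hz), hx⟩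
  obtain ⟨hinf, hCc⟩ := centralizer_comm_of_finiteIndex (K := K₀) (N := N₀) inf_le_right hK₀c hC₀ hcomm₀
  -- `K₀` is the centralizer in `N₀` of `⁅N₀, N₀⁆`, which makes it normal in `G`.
  have hK₀n : K₀.Normal := by
    have : K₀ = N₀ ⊓ Subgroup.centralizer (⁅N₀, N₀⁆ : Subgroup G) := by
      refine le_antisymm (fun x hx => ⟨hx.2, Subgroup.mem_centralizer_iff.2 fun y hy =>
        hK₀c y (hcomm₀ hy) x hx⟩) (fun x hx => hC₀ x hx.1 fun y hy =>
        (Subgroup.mem_centralizer_iff.1 hx.2 y hy).symm)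
    rw [this]
    infer_instance
  set C := Subgroup.centralizer (K₀ : Set G) with hC
  have hCn : C.Normal := inferInstance
  have hK₀C : K₀ ≤ C := hinf ▸ inf_le_right
  have hrel : K₀.relIndex C ≠ 0 := by
    have h5 : (N₀.subgroupOf C).FiniteIndex := inferInstance
    rw [← hinf, Subgroup.inf_relIndex_right]
    exact h5.index_ne_zero
  have hrelK : K₀.relIndex K ≠ 0 := by
    have h5 : (N₀.subgroupOf K).FiniteIndex := inferInstance
    rw [hK₀, inf_comm, Subgroup.inf_relIndex_right]
    exact h5.index_ne_zero
  have hC1 : hirschLength C = 1 := by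
    rw [← hirschLength_eq_of_le_of_relIndex hK₀C hrel,
      hirschLength_eq_of_le_of_relIndex inf_le_left hrelK, hK1]
  have hCself : ∀ x, (∀ y ∈ C, x * y = y * x) → x ∈ C := fun x hx =>
    Subgroup.mem_centralizer_iff.2 fun y hy => (hx y (hK₀C hy)).symm
  obtain ⟨L', hL', hgL'⟩ := ((hg.pow hm).inf_normal N₀).of_relIndex hK₀C hrel
    (fun x => ⟨fun hx => by
      have := hCn.conj_mem _ hx (g ^ m)⁻¹
      simpa [mul_assoc] using this, fun hx => hCn.conj_mem _ hx _⟩)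
    (hL.of_le_of_comm (fun x hx y hy => hK x (hg.le hx) y (hg.le hy)) inf_le_left)
  refine ⟨C, hCn, hCc, hC1, ?_, hCself, g ^ m, L', hL', hgL', ?_⟩
  -- The actions of `x` and `y` on the rank-one group `C` commute, so commutators centralize `C`,
  -- and `C` contains its centralizer.
  · rw [commutator_def, Subgroup.commutator_le]
    intro x _ y _
    refine hCself _ fun c hc => ?_
    have h1 := mul_mul_eq_of_hirschLength_le_one hCc hC1.le x y (hCn.conj_mem _ hc (y * x)⁻¹)
    rw [commutatorElement_def, ← mul_inv_eq_iff_eq_mul]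
    calc x * y * x⁻¹ * y⁻¹ * c * (x * y * x⁻¹ * y⁻¹)⁻¹
        = x * (y * ((y * x)⁻¹ * c * (y * x)⁻¹⁻¹) * y⁻¹) * x⁻¹ := by group
      _ = y * (x * ((y * x)⁻¹ * c * (y * x)⁻¹⁻¹) * x⁻¹) * y⁻¹ := h1
      _ = c := by group
  · intro k hk hmem
    rw [← pow_mul] at hmem
    have h2 : g ^ (m * k) ∈ N₀ := by rw [pow_mul]; exact N₀.pow_mem hgm k
    have h3 : g ^ (m * k) ∈ K₀ := hinf ▸ ⟨h2, hmem⟩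
    exact hgK _ (mul_ne_zero hm hk) h3.1

/-- An element commutes with its own power, which is a nontrivial element of `C` unless `x = 1`; by
rank one it centralizes all of `C`. -/
theorem mem_of_pow_mem_of_self_centralizing {C : Subgroup G} [hn : C.Normal]
    (hC : ∀ x ∈ C, ∀ y ∈ C, x * y = y * x) (h1 : hirschLength C ≤ 1)
    (hself : ∀ x, (∀ y ∈ C, x * y = y * x) → x ∈ C) {x : G} {n : ℕ} (hn0 : n ≠ 0)
    (hx : x ^ n ∈ C) : x ∈ C := by
  by_cases hx1 : x ^ n = 1
  · rw [TorsionFree.eq_one_of_pow hn0 hx1]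
    exact C.one_mem
  · exact hself x (commute_of_hirschLength_le_one hC h1 (fun y hy => hn.conj_mem y hy x) hx hx1
      (pow_mul_comm' x n).symm)

end

/-- In a finitely generated torsion-free commutative group every nontrivial element is a power of an
element that generates an isolated subgroup. -/
theorem exists_root_of_fg {Q : Type u} [Group Q] [TorsionFree Q] [HasHirsch Q] [Group.FG Q]
    (hc : ∀ x y : Q, x * y = y * x) {g : Q} (hg : g ≠ 1) :
    ∃ (u : Q) (e : ℕ), e ≠ 0 ∧ u ^ e = g ∧
      ∀ (x : Q) (n : ℕ), n ≠ 0 → x ^ n ∈ Subgroup.zpowers u → x ∈ Subgroup.zpowers u := by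
  -- The isolator of the cyclic group generated by `g`. It is a finite extension of that group,
  -- hence has length one and is cyclic; `u` is a generator with the sign that makes `g` a positive
  -- power.
  let U : Subgroup Q :=
    { carrier := {x | ∃ n : ℕ, n ≠ 0 ∧ x ^ n ∈ Subgroup.zpowers g}
      one_mem' := ⟨1, one_ne_zero, by rw [one_pow]; exact Subgroup.one_mem _⟩
      inv_mem' := by
        rintro x ⟨n, hn, hx⟩
        exact ⟨n, hn, by rw [inv_pow]; exact Subgroup.inv_mem _ hx⟩
      mul_mem' := by
        rintro x y ⟨n, hn, hx⟩ ⟨m, hm, hy⟩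
        refine ⟨n * m, mul_ne_zero hn hm, ?_⟩
        rw [Commute.mul_pow (hc x y), pow_mul, mul_comm n m, pow_mul]
        exact Subgroup.mul_mem _ (Subgroup.pow_mem _ hx m) (Subgroup.pow_mem _ hy n) }
  have hfg : SubgroupsFG Q := .of_comm hc
  have hgU : g ∈ U := ⟨1, one_ne_zero, by rw [pow_one]; exact Subgroup.mem_zpowers g⟩
  have hcU : ∀ x y : U, x * y = y * x := fun x y => Subtype.ext (hc x y)
  have hn : (Subgroup.zpowers (⟨g, hgU⟩ : U)).Normal := ⟨fun z hz w => by
    rw [hcU w z, mul_inv_cancel_right]; exact hz⟩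
  have hfin : Finite (U ⧸ Subgroup.zpowers (⟨g, hgU⟩ : U)) := by
    refine finite_of_comm_of_fg (fun x y => ?_) (fun x => ?_)
    · induction x using QuotientGroup.induction_on with
      | H x =>
        induction y using QuotientGroup.induction_on with
        | H y => rw [← QuotientGroup.mk_mul, hcU, QuotientGroup.mk_mul]
    · induction x using QuotientGroup.induction_on with
      | H x =>
        obtain ⟨x, n, hn, k, hk⟩ := x
        refine isOfFinOrder_iff_pow_eq_one.2 ⟨n, Nat.pos_of_ne_zero hn, ?_⟩
        rw [← QuotientGroup.mk_pow, QuotientGroup.eq_one_iff]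
        exact ⟨k, Subtype.ext hk⟩
  have h1 : hirschLength U ≤ 1 := by
    rw [hirschLength_eq_add (Subgroup.zpowers (⟨g, hgU⟩ : U)),
      hirschLength_eq_zero_of_finite (G := U ⧸ Subgroup.zpowers (⟨g, hgU⟩ : U)),
      add_zero, hirschLength_zpowers]
    exact TorsionFree.not_isOfFinOrder fun h => hg (congrArg Subtype.val h)
  have hcyc : IsCyclic U := TorsionFree.isCyclic_of_hirschLength_le_one hcU h1
  obtain ⟨⟨u, huU⟩, hu⟩ := hcyc.exists_generator
  have hU : ∀ x, x ∈ Subgroup.zpowers u ↔ x ∈ U := by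
    intro x
    constructor
    · rintro ⟨k, rfl⟩
      exact U.zpow_mem huU k
    · intro hx
      obtain ⟨k, hk⟩ := hu ⟨x, hx⟩
      exact ⟨k, congrArg Subtype.val hk⟩
  have hiso : ∀ (x : Q) (n : ℕ), n ≠ 0 → x ^ n ∈ Subgroup.zpowers u → x ∈ Subgroup.zpowers u := by
    intro x n hn hx
    rw [hU] at hx ⊢
    obtain ⟨m, hm, hxm⟩ := hx
    exact ⟨n * m, mul_ne_zero hn hm, by rwa [pow_mul]⟩
  obtain ⟨k, hk⟩ := (hU g).2 hgU
  have hk : u ^ k = g := hk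
  have hk0 : k ≠ 0 := by rintro rfl; exact hg (by simpa using hk.symm)
  rcases Int.natAbs_eq k with h | h
  · exact ⟨u, k.natAbs, Int.natAbs_ne_zero.2 hk0, by rw [← hk, ← zpow_natCast, ← h], hiso⟩
  · refine ⟨u⁻¹, k.natAbs, Int.natAbs_ne_zero.2 hk0, ?_, ?_⟩
    · rw [← hk, inv_pow, ← zpow_natCast, ← zpow_neg, ← h]
    · rwa [Subgroup.zpowers_inv]

theorem QuotientGroup.mul_comm_of_commutator_le {G : Type*} [Group G] {C : Subgroup G} [C.Normal]
    (h : commutator G ≤ C) (x y : G ⧸ C) : x * y = y * x := by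
  induction x using QuotientGroup.induction_on with
  | H x =>
    induction y using QuotientGroup.induction_on with
    | H y =>
      rw [← QuotientGroup.mk_mul, ← QuotientGroup.mk_mul, QuotientGroup.eq]
      refine h ?_
      have : (x * y)⁻¹ * (y * x) = ⁅y⁻¹, x⁻¹⁆ := by rw [commutatorElement_def]; group
      rw [this, commutator_def]
      exact Subgroup.commutator_mem_commutator (Subgroup.mem_top _) (Subgroup.mem_top _)

theorem QuotientGroup.mk_mem_zpowers_iff {G : Type*} [Group G] {C : Subgroup G} [C.Normal] {u x : G} :
    (x : G ⧸ C) ∈ Subgroup.zpowers (u : G ⧸ C) ↔ x ∈ C ⊔ Subgroup.zpowers u := by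
  constructor
  · rintro ⟨k, hk⟩
    have h1 : (u ^ k)⁻¹ * x ∈ C := QuotientGroup.eq.1 hk
    have h2 := Subgroup.mul_mem _ (Subgroup.mem_sup_right (S := C) (Subgroup.zpow_mem_zpowers u k))
      (Subgroup.mem_sup_left (T := Subgroup.zpowers u) h1)
    rwa [mul_inv_cancel_left] at h2
  · intro hx
    rw [Subgroup.mem_sup_of_normal_left] at hx
    obtain ⟨m, hm, _, ⟨k, rfl⟩, rfl⟩ := hx
    exact ⟨k, by rw [QuotientGroup.mk_mul, (QuotientGroup.eq_one_iff m).2 hm, one_mul]; rfl⟩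

theorem IsContracted.sup_zpowers_eq {G : Type*} [Group G] {K L : Subgroup G} {g : G}
    (h : IsContracted K L g) : L ⊔ Subgroup.zpowers g = K ⊔ Subgroup.zpowers g := by
  refine le_antisymm (sup_le_sup_right h.le _) (sup_le (fun x hx => ?_) le_sup_right)
  obtain ⟨n, hn⟩ := h.absorb x hx
  have hg : g ^ n ∈ L ⊔ Subgroup.zpowers g :=
    Subgroup.mem_sup_right (Subgroup.pow_mem _ (Subgroup.mem_zpowers g) n)
  have h1 := Subgroup.mul_mem _ (Subgroup.mul_mem _ (Subgroup.inv_mem _ hg)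
    (Subgroup.mem_sup_left (T := Subgroup.zpowers g) hn)) hg
  rwa [show (g ^ n)⁻¹ * (g ^ n * x * (g ^ n)⁻¹) * g ^ n = x by group] at h1

theorem exists_eq_zpowers_of_hirschLength_le_one {G : Type u} [Group G] [TorsionFree G]
    {L : Subgroup G} (hL : L.FG)
    (hc : ∀ x ∈ L, ∀ y ∈ L, x * y = y * x) (h1 : hirschLength L ≤ 1) :
    ∃ c, L = Subgroup.zpowers c := by
  have : Group.FG L := (Group.fg_iff_subgroup_fg L).2 hL
  have hcyc : IsCyclic L := TorsionFree.isCyclic_of_hirschLength_le_one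
    (fun x y => Subtype.ext (hc x x.2 y y.2)) h1
  obtain ⟨c, hc⟩ := L.isCyclic_iff_exists_zpowers_eq_top.1 hcyc
  exact ⟨c, hc.symm⟩

section

variable {G : Type u} [Group G] [TorsionFree G] [HasHirsch G]

/-- A self-centralizing rank-one normal subgroup as in `exists_normal_of_hirschLength_eq_one` lies in
an isolated subgroup that is a Baumslag-Solitar group. -/
theorem exists_isContracted_zpowers [Group.FG G] {C L : Subgroup G} [hCn : C.Normal] {g : G}
    (hCc : ∀ x ∈ C, ∀ y ∈ C, x * y = y * x) (hC1 : hirschLength C = 1) (hcomm : commutator G ≤ C)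
    (hself : ∀ x, (∀ y ∈ C, x * y = y * x) → x ∈ C) (hL : L.FG) (hg : IsContracted C L g)
    (hgC : ∀ m : ℕ, m ≠ 0 → g ^ m ∉ C) :
    ∃ (c u : G) (r : ℤ), c ≠ 1 ∧ u * c * u⁻¹ = c ^ r ∧ IsContracted C (Subgroup.zpowers c) u ∧
      (∀ m : ℕ, m ≠ 0 → u ^ m ∉ C) ∧
      ∀ (x : G) (n : ℕ), n ≠ 0 → x ^ n ∈ C ⊔ Subgroup.zpowers u → x ∈ C ⊔ Subgroup.zpowers u := by
  have hiso : ∀ (x : G) (n : ℕ), n ≠ 0 → x ^ n ∈ C → x ∈ C := fun x n hn hx =>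
    mem_of_pow_mem_of_self_centralizing hCc hC1.le hself hn hx
  have hQ : TorsionFree (G ⧸ C) := .quotient hiso
  have hQfg : Group.FG (G ⧸ C) := Group.fg_of_surjective (QuotientGroup.mk'_surjective C)
  have hg1 : (g : G ⧸ C) ≠ 1 := by
    rw [Ne, QuotientGroup.eq_one_iff]
    have := hgC 1 one_ne_zero
    rwa [pow_one] at this
  obtain ⟨q, e, he, hqe, hq⟩ := exists_root_of_fg (QuotientGroup.mul_comm_of_commutator_le hcomm) hg1
  obtain ⟨u, rfl⟩ := QuotientGroup.mk_surjective q
  have huC : ∀ x, u * x * u⁻¹ ∈ C ↔ x ∈ C := fun x => ⟨fun hx => by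
    have := hCn.conj_mem _ hx u⁻¹
    simpa [mul_assoc] using this, fun hx => hCn.conj_mem _ hx _⟩
  have hueC : (u ^ e)⁻¹ * g ∈ C := QuotientGroup.eq.1 hqe
  -- Modulo the abelian group `C` the elements `u ^ e` and `g` agree, so they act alike on `C`.
  have hue : IsContracted C L (u ^ e) := hg.congr fun x hx => by
    have h1 : g = u ^ e * ((u ^ e)⁻¹ * g) := by group
    have h2 : ((u ^ e)⁻¹ * g) * x * ((u ^ e)⁻¹ * g)⁻¹ = x := by
      rw [mul_inv_eq_iff_eq_mul]; exact hCc _ hueC x hx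
    calc u ^ e * x * (u ^ e)⁻¹
        = u ^ e * (((u ^ e)⁻¹ * g) * x * ((u ^ e)⁻¹ * g)⁻¹) * (u ^ e)⁻¹ := by rw [h2]
      _ = g * x * g⁻¹ := by group
  obtain ⟨L₁, hL₁, -, hu⟩ := hue.of_pow he huC hL
  obtain ⟨c, rfl⟩ := exists_eq_zpowers_of_hirschLength_le_one hL₁
    (fun x hx y hy => hCc x (hu.le hx) y (hu.le hy)) (hu.hirschLength_eq ▸ hC1.le)
  have hc1 : c ≠ 1 := by
    rintro rfl
    have h1 := hu.hirschLength_eq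
    rw [hC1, Subgroup.zpowers_one_eq_bot, hirschLength_eq_zero_of_finite] at h1
    exact one_ne_zero h1
  obtain ⟨r, hr⟩ := hu.conj_mem c (Subgroup.mem_zpowers c)
  refine ⟨c, u, r, hc1, hr.symm, hu, fun m hm hmem => ?_, fun x n hn hx => ?_⟩
  · have h1 := hiso u m hm hmem
    rw [← QuotientGroup.eq_one_iff] at h1
    rw [h1, one_pow] at hqe
    exact hg1 hqe.symm
  · rw [← QuotientGroup.mk_mem_zpowers_iff] at hx ⊢
    exact hq x n hn hx

end

theorem isPolycyclic_of_commutator_le_of_comm {G : Type u} [Group G] [Group.FG G] {C : Subgroup G}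
    [C.Normal] (hC : C.FG) (hCc : ∀ x ∈ C, ∀ y ∈ C, x * y = y * x) (hcomm : commutator G ≤ C) :
    IsPolycyclic G := by
  have h1 : Group.FG C := (Group.fg_iff_subgroup_fg C).2 hC
  have hc : ∀ x y : C, x * y = y * x := fun x y => Subtype.ext (hCc x x.2 y y.2)
  have h2 : SubgroupsFG C := .of_comm hc
  have h3 : Group.IsSolvable C := Group.isSolvable_of_comm hc
  exact .of_commutator_le hcomm .of_isSolvable

/-- The subgroup has the full length two, so the quotient by it is torsion; being isolated, it is
everything. -/
theorem sup_zpowers_eq_top_of_hirschLength_eq_two {G : Type u} [Group G] [HasHirsch G]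
    [Group.FG G] {C : Subgroup G} [hCn : C.Normal] {u : G}
    (hC1 : hirschLength C = 1) (hcomm : commutator G ≤ C)
    (huC : ∀ m : ℕ, m ≠ 0 → u ^ m ∉ C)
    (hiso : ∀ (x : G) (n : ℕ), n ≠ 0 → x ^ n ∈ C ⊔ Subgroup.zpowers u → x ∈ C ⊔ Subgroup.zpowers u)
    (hG : hirschLength G = 2) : C ⊔ Subgroup.zpowers u = ⊤ := by
  set M := C ⊔ Subgroup.zpowers u with hM
  have hMn : M.Normal := .of_commutator_le _ (hcomm.trans (hM ▸ le_sup_left))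
  have hMl : hirschLength M = 2 := by
    rw [hM, hirschLength_sup_zpowers (fun x => ⟨fun hx => by
      have := hCn.conj_mem _ hx u⁻¹
      simpa [mul_assoc] using this, fun hx => hCn.conj_mem _ hx _⟩) huC, hC1]
    rfl
  have h1 := hirschLength_eq_add M
  rw [hG, hMl] at h1
  have h2 : hirschLength (G ⧸ M) < 1 := by
    by_contra hge
    have h4 : (2 : ℕ∞) + 1 ≤ 2 := (add_le_add_right (not_lt.1 hge) 2).trans h1.symm.le
    exact absurd h4 (by decide)
  rw [eq_top_iff]
  intro x _
  obtain ⟨n, hn, hx⟩ := isOfFinOrder_iff_pow_eq_one.1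
    (isOfFinOrder_of_hirschLength_lt_one h2 (x : G ⧸ M))
  rw [← QuotientGroup.mk_pow, QuotientGroup.eq_one_iff] at hx
  exact hiso x n hn.ne' hx

section

variable {G : Type u} [Group G] [TorsionFree G] [HasHirsch G] [Group.FG G]

/-- The exponent `r` decides. If `r = ±1`, conjugation by `u` maps the group of powers of `c` onto
itself, so it contracts nothing, `C` is cyclic and `G` is polycyclic. Otherwise `C` and `u` generate
a copy of `BS(1,r)`, and the quotient by it is torsion-free, finitely generated, abelian of length
one. -/
theorem semidirectProduct_or_isPolycyclic {C : Subgroup G} [hCn : C.Normal] {c u : G} {r : ℤ}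
    (hCc : ∀ x ∈ C, ∀ y ∈ C, x * y = y * x)
    (hC1 : hirschLength C = 1) (hcomm : commutator G ≤ C) (hc1 : c ≠ 1) (hr : u * c * u⁻¹ = c ^ r)
    (hu : IsContracted C (Subgroup.zpowers c) u) (huC : ∀ m : ℕ, m ≠ 0 → u ^ m ∉ C)
    (hiso : ∀ (x : G) (n : ℕ), n ≠ 0 → x ^ n ∈ C ⊔ Subgroup.zpowers u → x ∈ C ⊔ Subgroup.zpowers u)
    (hG : hirschLength G = 3) :
    (∃ n : ℤ, n ≠ 0 ∧ n ≠ 1 ∧ n ≠ -1 ∧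
        ∃ θ : MulAut (BaumslagSolitar 1 n),
          Nonempty (G ≃* BaumslagSolitar 1 n ⋊[zpowersHom (MulAut (BaumslagSolitar 1 n)) θ]
            Multiplicative ℤ)) ∨ IsPolycyclic G := by
  by_cases hr1 : r = 1 ∨ r = -1
  · right
    refine isPolycyclic_of_commutator_le_of_comm ?_ hCc hcomm
    have : C = Subgroup.zpowers c := by
      refine le_antisymm (fun x hx => ?_) hu.le
      obtain ⟨n, hn⟩ := hu.absorb x hx
      have hconj : ∀ y, u * y * u⁻¹ ∈ Subgroup.zpowers c ↔ y ∈ Subgroup.zpowers c := by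
        refine fun y => ⟨?_, fun hy => hu.conj_mem y hy⟩
        rintro ⟨k, hk⟩
        have hk : c ^ k = u * y * u⁻¹ := hk
        refine ⟨r * k, ?_⟩
        have h1 : u * c ^ (r * k) * u⁻¹ = c ^ k := by
          rw [← conj_zpow, hr, ← zpow_mul]
          rcases hr1 with rfl | rfl <;> simp
        rw [hk] at h1
        exact mul_left_cancel (mul_right_cancel h1)
      exact (conj_pow_mem_iff hconj n x).1 hn
    rw [this]
    exact ⟨{c}, by rw [Finset.coe_singleton, Subgroup.zpowers_eq_closure]⟩
  · left
    rw [not_or] at hr1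
    set M := C ⊔ Subgroup.zpowers u with hM
    have hMn : M.Normal := .of_commutator_le _ (hcomm.trans (hM ▸ le_sup_left))
    have hMl : hirschLength M = 2 := by
      rw [hM, hirschLength_sup_zpowers hu.mem_iff huC, hC1]
      rfl
    have h1 := hirschLength_eq_add M
    rw [hG, hMl] at h1
    have h2 : hirschLength (G ⧸ M) = 1 := by
      have : (2 : ℕ∞) + 1 = 2 + hirschLength (G ⧸ M) := h1
      exact (ENat.add_right_injective_of_ne_top (by decide) this).symm
    have hQ : TorsionFree (G ⧸ M) := .quotient hiso
    have hQfg : Group.FG (G ⧸ M) := Group.fg_of_surjective (QuotientGroup.mk'_surjective M)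
    have hcyc : IsCyclic (G ⧸ M) := TorsionFree.isCyclic_of_hirschLength_le_one
      (QuotientGroup.mul_comm_of_commutator_le (hcomm.trans (hM ▸ le_sup_left))) h2.le
    have hinf : Infinite (G ⧸ M) := by
      by_contra h
      rw [not_infinite_iff_finite] at h
      rw [hirschLength_eq_zero_of_finite] at h2
      exact zero_ne_one h2
    obtain ⟨s, hs, hs'⟩ := exists_sup_zpowers_eq_top_of_isCyclic_quotient M
    have hcM : c ∈ M := hM ▸ Subgroup.mem_sup_left (hu.le (Subgroup.mem_zpowers c))
    have huM : u ∈ M := hM ▸ Subgroup.mem_sup_right (Subgroup.mem_zpowers u)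
    obtain ⟨e⟩ : Nonempty (BaumslagSolitar 1 r ≃* M) := by
      refine BaumslagSolitar.nonempty_mulEquiv (x := ⟨c, hcM⟩) (y := ⟨u, huM⟩) (Subtype.ext hr) ?_
        (TorsionFree.not_isOfFinOrder fun h => hc1 (congrArg Subtype.val h)) ?_
      · apply Subgroup.map_injective M.subtype_injective
        rw [Subgroup.map_sup, MonoidHom.map_zpowers, MonoidHom.map_zpowers,
          ← MonoidHom.range_eq_map, Subgroup.range_subtype]
        exact hu.sup_zpowers_eq.trans hM.symm
      · rintro k hk ⟨m, hm⟩
        exact huC k hk (hu.le ⟨m, congrArg Subtype.val hm⟩)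
    refine ⟨r, ?_, hr1.1, hr1.2, exists_mulEquiv_semidirectProduct M hs (hs' hinf) e⟩
    rintro rfl
    rw [zpow_zero, mul_inv_eq_one, mul_eq_left] at hr
    exact hc1 hr

end

/-! ### Constructible groups of Hirsch length one and two -/

theorem IsContracted.pow_notMem {G : Type*} [Group G] {K L : Subgroup G} {g : G}
    (h : IsContracted K L g) (hg : ∀ k : ℕ, k ≠ 0 → g ^ k ∉ L) (k : ℕ) (hk : k ≠ 0) : g ^ k ∉ K := by
  intro hmem
  obtain ⟨n, hn⟩ := h.absorb _ hmem
  rw [← pow_add, add_comm, pow_add, mul_inv_cancel_right] at hn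
  exact hg k hk hn

theorem IsContracted.eq_of_pow_comm {G : Type*} [Group G] {K L : Subgroup G} {g : G}
    (h : IsContracted K L g) {q : ℕ} (hq : q ≠ 0) (hc : ∀ x ∈ K, g ^ q * x = x * g ^ q) : K = L := by
  refine le_antisymm (fun x hx => ?_) h.le
  obtain ⟨n, hn⟩ := (h.pow hq).absorb x hx
  have h1 : (g ^ q) ^ n * x = x * (g ^ q) ^ n := (Commute.pow_left (hc x hx) n)
  rwa [h1, mul_inv_cancel_right] at hn

/-- The ascending union of the conjugates of `H` has the length of `H`, is normalized by `t`, and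
generates the same subgroup together with `t`. -/
theorem IsAscending.hirschLength_eq {G : Type u} [Group G] [HasHirsch G] {H : Subgroup G} {t : G}
    (hA : IsAscending H t) :
    hirschLength (H ⊔ Subgroup.zpowers t : Subgroup G) = hirschLength H + 1 := by
  have hK := isContracted_ascUnion hA.conj_mem
  rw [hK.sup_zpowers_eq, hirschLength_sup_zpowers hK.mem_iff (hK.pow_notMem hA.pow_notMem),
    hK.hirschLength_eq]

/-- Each nontrivial element has a nontrivial power in the normal core of `C`, so by rank one it
centralizes that core. The centre therefore has finite index. -/
theorem mul_comm_of_finiteIndex_of_hirschLength_le_one {G : Type u} [Group G] [TorsionFree G]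
    [HasHirsch G] {C : Subgroup G} [C.FiniteIndex] (hC : ∀ x ∈ C, ∀ y ∈ C, x * y = y * x)
    (h1 : hirschLength C ≤ 1) (x y : G) : x * y = y * x := by
  have hle : C.normalCore ≤ Subgroup.center G := by
    intro z hz
    rw [Subgroup.mem_center_iff]
    intro g
    by_cases hg : g = 1
    · simp [hg]
    obtain ⟨n, hn, hgn⟩ := Subgroup.exists_pow_mem_of_finiteIndex C.normalCore g
    exact commute_of_hirschLength_le_one
      (fun x hx y hy => hC x (C.normalCore_le hx) y (C.normalCore_le hy))
      ((hirschLength_mono C.normalCore_le).trans h1)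
      (fun w hw => C.normalCore_normal.conj_mem w hw g) hgn
      (fun h => hg (TorsionFree.eq_one_of_pow hn h)) (pow_mul_comm' g n).symm z hz
  have : (Subgroup.center G).FiniteIndex := Subgroup.finiteIndex_of_le hle
  exact TorsionFree.mul_comm_of_finiteIndex_center x y

theorem exists_zpow_mul_of_mem_sup {G : Type*} [Group G] {K : Subgroup G} {t : G}
    (h : ∀ x, t * x * t⁻¹ ∈ K ↔ x ∈ K) {x : G} (hx : x ∈ K ⊔ Subgroup.zpowers t) :
    ∃ b : ℤ, ∃ k ∈ K, x = t ^ b * k := by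
  obtain ⟨i, j, y, hy, rfl⟩ := exists_eq_of_mem_sup_zpowers (fun x hx => (h x).2 hx) hx
  refine ⟨j - i, (t ^ j)⁻¹ * y * t ^ j, ?_, ?_⟩
  · rw [← conj_pow_mem_iff h j]
    simpa [mul_assoc] using hy
  · rw [zpow_sub, zpow_natCast, zpow_natCast, ← (Commute.pow_pow_self t i j).inv_left.eq]
    group

theorem relIndex_sup_zpowers_pow_ne_zero {G : Type*} [Group G] {K : Subgroup G} {t : G}
    (h : ∀ x, t * x * t⁻¹ ∈ K ↔ x ∈ K) {m : ℕ} (hm : m ≠ 0) :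
    (K ⊔ Subgroup.zpowers (t ^ m)).relIndex (K ⊔ Subgroup.zpowers t) ≠ 0 := by
  refine Subgroup.relIndex_ne_zero_of_finite_cover (D := (fun i => t ^ i) '' Set.Iio m)
    ((Set.finite_Iio m).image _) fun x hx => ?_
  obtain ⟨b, k, hk, rfl⟩ := exists_zpow_mul_of_mem_sup h hx
  have hm' : (m : ℤ) ≠ 0 := by exact_mod_cast hm
  have hb := Int.emod_nonneg b hm'
  refine ⟨_, ⟨(b % m).toNat, ?_, rfl⟩, ?_⟩
  · have := Int.emod_lt_of_pos b (show (0 : ℤ) < m by omega)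
    simp only [Set.mem_Iio]
    omega
  · have h1 : (t ^ (b % m).toNat)⁻¹ * (t ^ b * k) = (t ^ m) ^ (b / m) * k := by
      rw [← zpow_natCast t (b % m).toNat, Int.toNat_of_nonneg hb, ← zpow_neg, ← mul_assoc,
        ← zpow_add, ← zpow_natCast t m, ← zpow_mul]
      congr 2
      have := Int.emod_add_mul_ediv b m
      omega
    rw [h1]
    exact Subgroup.mul_mem _ (Subgroup.mem_sup_right ⟨_, rfl⟩) (Subgroup.mem_sup_left hk)

theorem Group.fg_of_finiteIndex_of_fg {G : Type*} [Group G] {N : Subgroup G} [N.FiniteIndex]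
    (hN : N.FG) : Group.FG G := by
  obtain ⟨D, hD, -, hcov⟩ := Subgroup.exists_finite_cover_of_relIndex_ne_zero (C := N) (K := ⊤)
    (by rw [Subgroup.relIndex_top_right]; exact Subgroup.FiniteIndex.index_ne_zero)
  refine Group.fg_def.2 ?_
  have : N ⊔ Subgroup.closure D = ⊤ := by
    rw [eq_top_iff]
    intro x hx
    obtain ⟨d, hd, hdx⟩ := hcov x hx
    have := Subgroup.mul_mem _ (Subgroup.mem_sup_right (S := N) (Subgroup.subset_closure hd))
      (Subgroup.mem_sup_left hdx)
    rwa [mul_inv_cancel_left] at this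
  rw [← this]
  exact hN.sup ⟨hD.toFinset, by simp⟩

theorem Subgroup.fg_zpowers {G : Type*} [Group G] (c : G) : (Subgroup.zpowers c).FG :=
  ⟨{c}, by rw [Finset.coe_singleton, Subgroup.zpowers_eq_closure]⟩

theorem mul_comm_of_mem_zpowers {G : Type*} [Group G] (c : G) :
    ∀ x ∈ Subgroup.zpowers c, ∀ y ∈ Subgroup.zpowers c, x * y = y * x := by
  rintro _ ⟨i, rfl⟩ _ ⟨j, rfl⟩
  exact Commute.zpow_zpow_self c i j

theorem mul_comm_of_mem_sup {G : Type*} [Group G] {A B : Subgroup G}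
    (hA : ∀ x ∈ A, ∀ y ∈ A, x * y = y * x) (hB : ∀ x ∈ B, ∀ y ∈ B, x * y = y * x)
    (hAB : ∀ x ∈ A, ∀ y ∈ B, x * y = y * x) : ∀ x ∈ A ⊔ B, ∀ y ∈ A ⊔ B, x * y = y * x := by
  have hA' : A ≤ Subgroup.centralizer (A ⊔ B : Subgroup G) := by
    rw [Subgroup.le_centralizer_iff]
    exact sup_le (fun x hx => Subgroup.mem_centralizer_iff.2 fun y hy => hA y hy x hx)
      (fun x hx => Subgroup.mem_centralizer_iff.2 fun y hy => hAB y hy x hx)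
  have hB' : B ≤ Subgroup.centralizer (A ⊔ B : Subgroup G) := by
    rw [Subgroup.le_centralizer_iff]
    exact sup_le (fun x hx => Subgroup.mem_centralizer_iff.2 fun y hy => (hAB x hx y hy).symm)
      (fun x hx => Subgroup.mem_centralizer_iff.2 fun y hy => hB y hy x hx)
  exact fun x hx y hy => (Subgroup.mem_centralizer_iff.1 (sup_le hA' hB' hx) y hy).symm

theorem IsContracted.mul_comm {G : Type*} [Group G] {K L : Subgroup G} {g : G}
    (hK : IsContracted K L g) (hL : ∀ x ∈ L, ∀ y ∈ L, x * y = y * x) :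
    ∀ x ∈ K, ∀ y ∈ K, x * y = y * x := by
  intro x hx y hy
  obtain ⟨n, hn⟩ := hK.absorb x hx
  obtain ⟨m, hm⟩ := hK.absorb y hy
  have h1 : Commute _ _ := hL _ (conj_pow_mem_of_le hK.conj_mem (le_max_left n m) hn) _
    (conj_pow_mem_of_le hK.conj_mem (le_max_right n m) hm)
  rwa [Commute.conj_iff] at h1

theorem commutator_sup_zpowers_le {G : Type*} [Group G] {K : Subgroup G} {t : G}
    (h : ∀ x, t * x * t⁻¹ ∈ K ↔ x ∈ K) :
    ⁅K ⊔ Subgroup.zpowers t, K ⊔ Subgroup.zpowers t⁆ ≤ K := by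
  rw [Subgroup.commutator_le]
  intro x hx y hy
  obtain ⟨a, k, hk, rfl⟩ := exists_zpow_mul_of_mem_sup h hx
  obtain ⟨b, l, hl, rfl⟩ := exists_zpow_mul_of_mem_sup h hy
  have hz : ∀ (n : ℤ) (x : G), t ^ n * x * (t ^ n)⁻¹ ∈ K ↔ x ∈ K := fun n x =>
    conj_mem_of_mem_sup (H := ⊥) (fun h hh x hx => by
      rw [Subgroup.mem_bot.1 hh]; simpa using hx) h
      (Subgroup.mem_sup_right (Subgroup.zpow_mem_zpowers t n)) x
  have e : ⁅t ^ a * k, t ^ b * l⁆ = (t ^ a * k * (t ^ a)⁻¹) *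
      (t ^ (a + b) * (l * k⁻¹) * (t ^ (a + b))⁻¹) * (t ^ b * l⁻¹ * (t ^ b)⁻¹) := by
    rw [commutatorElement_def]; group
  rw [e]
  exact K.mul_mem (K.mul_mem ((hz _ _).2 hk) ((hz _ _).2 (K.mul_mem hl (K.inv_mem hk))))
    ((hz _ _).2 (K.inv_mem hl))

/-- Normalizing an infinite cyclic group means acting on it by a unit `±1`, whose square is `1`. -/
theorem sq_mul_comm_of_conj_mem_zpowers {G : Type*} [Group G] [TorsionFree G] {c u : G}
    (h : ∀ x, u * x * u⁻¹ ∈ Subgroup.zpowers c ↔ x ∈ Subgroup.zpowers c) :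
    u ^ 2 * c = c * u ^ 2 := by
  by_cases hc : c = 1
  · simp [hc]
  obtain ⟨r, hr⟩ := (h c).2 (Subgroup.mem_zpowers c)
  obtain ⟨k, hk⟩ := (h (u⁻¹ * c * u)).1 (by simp [mul_assoc])
  have hr : c ^ r = u * c * u⁻¹ := hr
  have hk : c ^ k = u⁻¹ * c * u := hk
  have h1 : c ^ (r * k) = c ^ (1 : ℤ) := by
    rw [zpow_mul, hr, conj_zpow, hk]; group
  have h2 : r * k = 1 := by
    by_contra hne
    refine hc (TorsionFree.eq_one_of_zpow (sub_ne_zero.2 hne) ?_)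
    rw [zpow_sub, h1, mul_inv_cancel]
  have h3 : r * r = 1 := by
    rcases Int.eq_one_or_neg_one_of_mul_eq_one h2 with rfl | rfl <;> rfl
  have h4 : u ^ 2 * c * (u ^ 2)⁻¹ = c := by
    calc u ^ 2 * c * (u ^ 2)⁻¹ = u * (u * c * u⁻¹) * u⁻¹ := by rw [pow_two]; group
      _ = (u * c * u⁻¹) ^ r := by rw [← hr, ← conj_zpow, ← hr]
      _ = c := by rw [← hr, ← zpow_mul, h3, zpow_one]
  rwa [mul_inv_eq_iff_eq_mul] at h4

section

variable {G : Type u} [Group G] [TorsionFree G] [HasHirsch G]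

theorem subsingleton_of_hirschLength_lt_one {H : Subgroup G} (h : hirschLength H < 1) :
    Subsingleton H :=
  ⟨fun x y => by
    rw [TorsionFree.eq_one_of_isOfFinOrder x (isOfFinOrder_of_hirschLength_lt_one h x),
      TorsionFree.eq_one_of_isOfFinOrder y (isOfFinOrder_of_hirschLength_lt_one h y)]⟩

/-- The base of the finite-index ascending HNN extension in a constructible group. -/
theorem IsConstructible.exists_isAscending_of_hirschLength_eq_add_one (h : IsConstructible G) {a : ℕ}
    (ha : hirschLength G = a + 1) : ∃ (H : Subgroup G) (t : G), IsAscending H t ∧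
      (H ⊔ Subgroup.zpowers t).FiniteIndex ∧ IsConstructible H ∧ hirschLength H = a := by
  rcases h.exists_isAscending (by rw [ha]; exact ENat.natCast_ne_top (a + 1)) with hs | ⟨H, t, hA, hi, hc⟩
  · rw [hirschLength_eq_zero_of_finite] at ha
    exact absurd ha (by norm_cast)
  · refine ⟨H, t, hA, hi, hc, ?_⟩
    have h1 := hA.hirschLength_eq
    rw [hirschLength_eq_of_finiteIndex, ha] at h1
    exact ENat.add_left_injective_of_ne_top (n := 1) (by decide) h1.symm

theorem IsConstructible.isCyclic_of_hirschLength_eq_one (h : IsConstructible G)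
    (h1 : hirschLength G = 1) : IsCyclic G := by
  obtain ⟨H, t, -, hi, -, hH⟩ := h.exists_isAscending_of_hirschLength_eq_add_one (a := 0) (by simpa using h1)
  have hs := subsingleton_of_hirschLength_lt_one (H := H) (by rw [hH]; exact zero_lt_one)
  have hb : H = ⊥ := Subgroup.eq_bot_of_subsingleton H
  rw [hb, bot_sup_eq] at hi
  have hfg : Group.FG G := Group.fg_of_finiteIndex_of_fg (Subgroup.fg_zpowers t)
  refine TorsionFree.isCyclic_of_hirschLength_le_one ?_ h1.le
  refine mul_comm_of_finiteIndex_of_hirschLength_le_one (C := Subgroup.zpowers t) ?_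
    ((hirschLength_subgroup_le _).trans h1.le)
  exact mul_comm_of_mem_zpowers t

/-- A torsion-free constructible group of Hirsch length two is virtually free abelian, or is a
Baumslag-Solitar group. -/
theorem IsConstructible.of_hirschLength_eq_two (h : IsConstructible G) (h2 : hirschLength G = 2) :
    (∃ L : Subgroup G, L.FiniteIndex ∧ L.FG ∧ ∀ x ∈ L, ∀ y ∈ L, x * y = y * x) ∨
    ∃ (C : Subgroup G) (c u : G), C.Normal ∧ (∀ x ∈ C, ∀ y ∈ C, x * y = y * x) ∧
      hirschLength C = 1 ∧ commutator G ≤ C ∧ (∀ x, (∀ y ∈ C, x * y = y * x) → x ∈ C) ∧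
      c ≠ 1 ∧ IsContracted C (Subgroup.zpowers c) u ∧ (∀ m : ℕ, m ≠ 0 → u ^ m ∉ C) ∧
      C ⊔ Subgroup.zpowers u = ⊤ := by
  obtain ⟨H, t, hA, hi, hcH, hH⟩ := h.exists_isAscending_of_hirschLength_eq_add_one (a := 1) (by
    rw [h2]; rfl)
  have hcyc := hcH.isCyclic_of_hirschLength_eq_one (by simpa using hH)
  obtain ⟨c, rfl⟩ : ∃ c, Subgroup.zpowers c = H := H.isCyclic_iff_exists_zpowers_eq_top.1 hcyc
  have hfg : Group.FG G := Group.fg_of_finiteIndex_of_fg ((Subgroup.fg_zpowers c).sup (Subgroup.fg_zpowers t))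
  have hK := isContracted_ascUnion hA.conj_mem
  set K := ascUnion (Subgroup.zpowers c) t with hKdef
  have hsup := hK.sup_zpowers_eq
  have hKc := hK.mul_comm (mul_comm_of_mem_zpowers c)
  have hK1 : hirschLength K = 1 := by rw [hK.hirschLength_eq, hH]; rfl
  -- Either `K` is self-centralizing, which is the Baumslag-Solitar case, or a proper power of `t`
  -- centralizes `K`. In the second case nothing is contracted, so `K` is cyclic and that power
  -- together with it generates an abelian subgroup of finite index.
  by_cases hself : ∀ x ∈ K ⊔ Subgroup.zpowers t, (∀ y ∈ K, x * y = y * x) → x ∈ K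
  · right
    rw [hsup] at hi
    have hN := commutator_sup_zpowers_le hK.mem_iff
    obtain ⟨C, hCn, hCc, hC1, hcomm, hCself, g, L, hL, hg, hgC⟩ :=
      exists_normal_of_hirschLength_eq_one le_sup_left hKc hK1 hN hself (Subgroup.fg_zpowers c) hK
        (hK.pow_notMem hA.pow_notMem)
    obtain ⟨c', u, r, hc1, -, hu, huC, hiso⟩ :=
      exists_isContracted_zpowers hCc hC1 hcomm hCself hL hg hgC
    exact ⟨C, c', u, hCn, hCc, hC1, hcomm, hCself, hc1, hu, huC,
      sup_zpowers_eq_top_of_hirschLength_eq_two hC1 hcomm huC hiso h2⟩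
  · left
    push Not at hself
    obtain ⟨x, hx, hxK, hxn⟩ := hself
    obtain ⟨b, k, hk, rfl⟩ := exists_zpow_mul_of_mem_sup hK.mem_iff hx
    have hb : b ≠ 0 := by
      rintro rfl
      exact hxn (by simpa using hk)
    have hcb : ∀ y ∈ K, Commute (t ^ b) y := fun y hy => by
      have h1 : Commute (t ^ b * k) y := hxK y hy
      have h2 : Commute (k⁻¹) y := Commute.inv_left (hKc k hk y hy)
      simpa using h1.mul_left h2
    have hm : b.natAbs ≠ 0 := Int.natAbs_ne_zero.2 hb
    have hcm : ∀ y ∈ K, Commute (t ^ b.natAbs) y := fun y hy => by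
      rcases Int.natAbs_eq b with h | h
      · rw [← zpow_natCast, ← h]; exact hcb y hy
      · have := hcb y hy
        rw [h, zpow_neg, zpow_natCast, Commute.inv_left_iff] at this
        exact this
    have hKL := hK.eq_of_pow_comm hm hcm
    refine ⟨Subgroup.zpowers c ⊔ Subgroup.zpowers (t ^ b.natAbs), ⟨?_⟩,
      (Subgroup.fg_zpowers c).sup (Subgroup.fg_zpowers _), ?_⟩
    · have h3 := relIndex_sup_zpowers_pow_ne_zero hK.mem_iff hm
      rw [hKL] at h3
      have hle : Subgroup.zpowers c ⊔ Subgroup.zpowers (t ^ b.natAbs) ≤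
          Subgroup.zpowers c ⊔ Subgroup.zpowers t :=
        sup_le_sup_left (Subgroup.zpowers_le.2 (Subgroup.pow_mem _ (Subgroup.mem_zpowers t) _)) _
      rw [← Subgroup.relIndex_mul_index hle]
      exact mul_ne_zero h3 hi.index_ne_zero
    · refine mul_comm_of_mem_sup (mul_comm_of_mem_zpowers c) (mul_comm_of_mem_zpowers _) ?_
      rintro x hx _ ⟨j, rfl⟩
      exact (Commute.zpow_left (hcm x (hK.le hx)) j).eq.symm

end

/-! ### Virtually abelian groups of Hirsch length two: torus and Klein bottle -/

theorem exists_mulAut_hom_GL {A : Type*} [Group A] {r : ℕ} (e : A ≃* Multiplicative (Fin r → ℤ)) :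
    ∃ ρ : MulAut A →* GL (Fin r) ℤ, ∀ f a,
      (ρ f : Matrix (Fin r) (Fin r) ℤ).mulVec (e a).toAdd = (e (f a)).toAdd := by
  let F : MulAut A → ((Fin r → ℤ) →ₗ[ℤ] (Fin r → ℤ)) := fun f => AddMonoidHom.toIntLinearMap
    { toFun := fun x => (e (f (e.symm (Multiplicative.ofAdd x)))).toAdd
      map_zero' := by simp
      map_add' := fun x y => by simp }
  have hF : ∀ f x, F f x = (e (f (e.symm (Multiplicative.ofAdd x)))).toAdd := fun _ _ => rfl
  let ρ : MulAut A →* Matrix (Fin r) (Fin r) ℤ :=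
    { toFun := fun f => LinearMap.toMatrix' (F f)
      map_one' := by
        rw [← LinearMap.toMatrix'_one]
        congr 1
        exact LinearMap.ext fun x => by simp [hF]
      map_mul' := fun f g => by
        rw [← LinearMap.toMatrix'_mul]
        congr 1
        exact LinearMap.ext fun x => by simp [hF] }
  refine ⟨ρ.toHomUnits, fun f a => ?_⟩
  change (LinearMap.toMatrix' (F f)).mulVec _ = _
  rw [← Matrix.toLin'_apply, Matrix.toLin'_toMatrix', hF]
  simp

theorem exists_conjNormal_hom_GL {G : Type*} [Group G] {C : Subgroup G} [C.Normal] {r : ℕ}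
    (e : C ≃* Multiplicative (Fin r → ℤ)) :
    ∃ ρ : G →* GL (Fin r) ℤ, (∀ g c, (ρ g : Matrix (Fin r) (Fin r) ℤ).mulVec (e c).toAdd =
      (e (MulAut.conjNormal g c)).toAdd) ∧ ∀ g, ρ g = 1 ↔ ∀ c ∈ C, g * c = c * g := by
  obtain ⟨ρ, hρ⟩ := exists_mulAut_hom_GL e
  refine ⟨ρ.comp MulAut.conjNormal, fun g c => hρ _ c, fun g => ?_⟩
  have key : ∀ c : C, MulAut.conjNormal g c = c ↔ g * c = c * g := fun c => by
    rw [← mul_inv_eq_iff_eq_mul, ← MulAut.conjNormal_apply]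
    exact Subtype.ext_iff
  constructor
  · intro h c hc
    rw [← key ⟨c, hc⟩]
    have h1 := hρ (MulAut.conjNormal g) ⟨c, hc⟩
    rw [MonoidHom.comp_apply] at h
    rw [h, Units.val_one, Matrix.one_mulVec] at h1
    exact (e.injective (Multiplicative.toAdd.injective h1)).symm
  · intro h
    refine Units.ext (Matrix.toLin'.injective (LinearMap.ext fun x => ?_))
    have h1 := hρ (MulAut.conjNormal g) (e.symm (Multiplicative.ofAdd x))
    rw [(key _).2 (h _ (e.symm (Multiplicative.ofAdd x)).2)] at h1
    simpa using h1

/-- The fixed vector is the power of `g` that lies in `C`; it is nonzero because `G` is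
torsion-free. This is how torsion-freeness constrains the holonomy. -/
theorem exists_mulVec_eq_of_finiteIndex {G : Type*} [Group G] [TorsionFree G] {C : Subgroup G}
    [C.Normal] [C.FiniteIndex] {r : ℕ} (e : C ≃* Multiplicative (Fin r → ℤ)) {ρ : G →* GL (Fin r) ℤ}
    (hρ : ∀ g c, (ρ g : Matrix (Fin r) (Fin r) ℤ).mulVec (e c).toAdd =
      (e (MulAut.conjNormal g c)).toAdd) {g : G} (hg : g ≠ 1) :
    ∃ v, v ≠ 0 ∧ (ρ g : Matrix (Fin r) (Fin r) ℤ).mulVec v = v := by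
  obtain ⟨n, hn, hgn⟩ := Subgroup.exists_pow_mem_of_finiteIndex C g
  refine ⟨(e ⟨g ^ n, hgn⟩).toAdd, fun h => ?_, ?_⟩
  · have h1 : e ⟨g ^ n, hgn⟩ = 1 := h
    rw [map_eq_one_iff e e.injective] at h1
    exact hg (TorsionFree.eq_one_of_pow hn (congrArg Subtype.val h1))
  · rw [hρ]
    congr 2
    ext
    simp [← pow_succ', pow_succ]

/-- Determinant one and an eigenvalue one make `M` unipotent, so `(M - 1)² = 0` and `Mᵏ = 1 + k(M -
1)`. -/
theorem Matrix.eq_one_of_det_eq_one {M : Matrix (Fin 2) (Fin 2) ℤ} (hdet : M.det = 1)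
    {v : Fin 2 → ℤ} (hv : v ≠ 0) (hMv : M.mulVec v = v) {n : ℕ} (hn : n ≠ 0) (hM : M ^ n = 1) :
    M = 1 := by
  have h1 : (M - 1).det = 0 := Matrix.exists_mulVec_eq_zero_iff.1
    ⟨v, hv, by rw [Matrix.sub_mulVec, hMv, Matrix.one_mulVec, sub_self]⟩
  have h2 : (M - 1) * (M - 1) = 0 := by
    rw [Matrix.det_fin_two] at h1 hdet
    simp only [Matrix.sub_apply, Matrix.one_apply_eq, Fin.isValue, Matrix.one_apply,
      zero_ne_one, one_ne_zero, if_false, sub_zero] at h1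
    have ht : M 1 1 = 2 - M 0 0 := by linarith
    rw [ht] at hdet h1
    ext i j
    fin_cases i <;> fin_cases j <;>
      simp [Matrix.mul_apply, Fin.sum_univ_two, Matrix.sub_apply, Matrix.one_apply, ht] <;> linarith
  have h3 : ∀ k : ℕ, M ^ k = 1 + k • (M - 1) := by
    intro k
    induction k with
    | zero => simp
    | succ k ih =>
      have h4 : M ^ (k + 1) = (1 + k • (M - 1)) * (1 + (M - 1)) := by
        rw [pow_succ, ih, add_sub_cancel]
      rw [h4, add_mul, mul_add, smul_mul_assoc, mul_add, h2]
      simp [add_smul]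
      abel
  have h5 : n • (M - 1) = 0 := by
    have := h3 n
    rw [hM] at this
    simpa using this.symm
  refine sub_eq_zero.1 (Matrix.ext fun i j => ?_)
  have h6 := congrFun (congrFun h5 i) j
  rw [Matrix.smul_apply, Matrix.zero_apply, smul_eq_zero] at h6
  exact h6.resolve_left hn

/-- A virtually abelian torsion-free group has a self-centralizing abelian normal subgroup of
finite index. -/
theorem exists_normal_of_finiteIndex_of_comm {G : Type*} [Group G] [TorsionFree G] {L : Subgroup G}
    [L.FiniteIndex] (hL : L.FG) (hLc : ∀ x ∈ L, ∀ y ∈ L, x * y = y * x) :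
    ∃ C : Subgroup G, C.Normal ∧ C.FiniteIndex ∧ C.FG ∧ (∀ x ∈ C, ∀ y ∈ C, x * y = y * x) ∧
      ∀ x, (∀ y ∈ C, x * y = y * x) → x ∈ C := by
  have hLn : L.normalCore ≤ Subgroup.centralizer (L.normalCore : Set G) := fun x hx =>
    Subgroup.mem_centralizer_iff.2 fun y hy => hLc y (L.normalCore_le hy) x (L.normalCore_le hx)
  have hfi : (Subgroup.centralizer (L.normalCore : Set G)).FiniteIndex :=
    Subgroup.finiteIndex_of_le hLn
  have hfg : Group.FG G := Group.fg_of_finiteIndex_of_fg hL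
  refine ⟨Subgroup.centralizer (L.normalCore : Set G), inferInstance, hfi,
    (Group.fg_iff_subgroup_fg _).1 (Subgroup.fg_of_index_ne_zero _), ?_, fun x hx =>
    Subgroup.mem_centralizer_iff.2 fun y hy => (hx y (hLn hy)).symm⟩
  set C := Subgroup.centralizer (L.normalCore : Set G)
  have h2 : L.normalCore.subgroupOf C ≤ Subgroup.center C := by
    intro x hx
    rw [Subgroup.mem_center_iff]
    intro y
    exact Subtype.ext (Subgroup.mem_centralizer_iff.1 y.2 x hx).symm
  have h4 : (Subgroup.center C).FiniteIndex := Subgroup.finiteIndex_of_le h2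
  intro x hx y hy
  exact congrArg Subtype.val (TorsionFree.mul_comm_of_finiteIndex_center (⟨x, hx⟩ : C) ⟨y, hy⟩)

theorem nonempty_mulEquiv_int_prod_int {G : Type u} [Group G] [TorsionFree G] [Group.FG G]
    (hc : ∀ x y : G, x * y = y * x) (h2 : hirschLength G = 2) :
    Nonempty (Multiplicative (ℤ × ℤ) ≃* G) := by
  obtain ⟨e⟩ := TorsionFree.nonempty_mulEquiv_pi (r := 2) hc h2
  let f : (ℤ × ℤ) ≃+ (Fin 2 → ℤ) := (LinearEquiv.finTwoArrow ℤ ℤ).symm.toAddEquiv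
  exact ⟨(AddEquiv.toMultiplicative f).trans e.symm⟩

/-- A torsion-free virtually abelian group of Hirsch length two is the fundamental group of the
torus or of the Klein bottle. -/
theorem nonempty_mulEquiv_of_hirschLength_eq_two {G : Type u} [Group G] [TorsionFree G]
    [HasHirsch G] (h2 : hirschLength G = 2) {L : Subgroup G} [L.FiniteIndex] (hL : L.FG)
    (hLc : ∀ x ∈ L, ∀ y ∈ L, x * y = y * x) :
    Nonempty (Multiplicative (ℤ × ℤ) ≃* G) ∨ Nonempty (KleinBottleGroup ≃* G) := by
  have hGfg : Group.FG G := Group.fg_of_finiteIndex_of_fg hL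
  obtain ⟨C, hCn, hCi, hCfg, hCc, hself⟩ := exists_normal_of_finiteIndex_of_comm hL hLc
  have hCl : hirschLength C = 2 := by rw [hirschLength_eq_of_finiteIndex, h2]
  have : Group.FG C := (Group.fg_iff_subgroup_fg C).2 hCfg
  obtain ⟨e⟩ := TorsionFree.nonempty_mulEquiv_pi (G := C) (r := 2)
    (fun x y => Subtype.ext (hCc x x.2 y y.2)) hCl
  obtain ⟨ρ, hρ, hρ1⟩ := exists_conjNormal_hom_GL e
  -- An element of determinant one acts through a matrix of finite order with a fixed vector, hence
  -- trivially. As the determinant is `±1`, the index of `C` is at most two.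
  have hdet : ∀ g, (ρ g : Matrix (Fin 2) (Fin 2) ℤ).det = 1 → g ∈ C := by
    intro g hg
    by_cases hg1 : g = 1
    · rw [hg1]; exact C.one_mem
    refine hself g ((hρ1 g).1 (Units.ext ?_))
    obtain ⟨v, hv, hgv⟩ := exists_mulVec_eq_of_finiteIndex e hρ hg1
    obtain ⟨n, hn, hgn⟩ := Subgroup.exists_pow_mem_of_finiteIndex C g
    refine Matrix.eq_one_of_det_eq_one hg hv hgv hn ?_
    rw [← Units.val_pow_eq_pow_val, ← map_pow, (hρ1 (g ^ n)).2 fun c hc => hCc _ hgn c hc]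
    rfl
  have hmul : ∀ g h, g ∉ C → h ∉ C → g * h ∈ C := by
    intro g h hg hh
    have key : ∀ g, g ∉ C → (ρ g : Matrix (Fin 2) (Fin 2) ℤ).det = -1 := fun g hg => by
      have h1 : IsUnit (ρ g : Matrix (Fin 2) (Fin 2) ℤ).det :=
        (Matrix.isUnit_iff_isUnit_det _).1 (ρ g).isUnit
      exact (Int.isUnit_iff.1 h1).resolve_left fun h => hg (hdet g h)
    refine hdet _ ?_
    rw [map_mul, Units.val_mul, Matrix.det_mul, key g hg, key h hh]
    rfl
  by_cases htop : ∃ h, h ∉ C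
  swap
  · left
    push Not at htop
    exact nonempty_mulEquiv_int_prod_int (fun x y => hCc x (htop x) y (htop y)) h2
  right
  obtain ⟨h, hh⟩ := htop
  have hh2 : h ^ 2 ∈ C := by rw [pow_two]; exact hmul h h hh hh
  have hact : ∀ x, x ∉ C → ∀ c ∈ C, x * c * x⁻¹ = h * c * h⁻¹ := by
    intro x hx c hc
    have h1 := hmul h⁻¹ x (fun hi => hh (C.inv_mem_iff.1 hi)) hx
    have h3 := hCc _ h1 c hc
    calc x * c * x⁻¹ = h * ((h⁻¹ * x) * c) * (h⁻¹ * x)⁻¹ * h⁻¹ := by group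
      _ = h * c * h⁻¹ := by rw [h3]; group
  -- The part of `C` that `h` inverts. It will be infinite cyclic with infinite cyclic quotient,
  -- which exhibits the Klein bottle relation.
  let A : Subgroup G :=
    { carrier := {c | c ∈ C ∧ h * c * h⁻¹ = c⁻¹}
      one_mem' := ⟨C.one_mem, by simp⟩
      mul_mem' := by
        rintro x y ⟨hx, hx'⟩ ⟨hy, hy'⟩
        refine ⟨C.mul_mem hx hy, ?_⟩
        rw [← conj_mul, hx', hy', mul_inv_rev, hCc _ (C.inv_mem hx) _ (C.inv_mem hy)]
      inv_mem' := by
        rintro x ⟨hx, hx'⟩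
        exact ⟨C.inv_mem hx, by rw [← conj_inv, hx']⟩ }
  have hA : ∀ x, x ∈ A ↔ x ∈ C ∧ h * x * h⁻¹ = x⁻¹ := fun _ => Iff.rfl
  have hAC : A ≤ C := fun x hx => hx.1
  have hconjC : ∀ x ∈ C, ∀ c ∈ C, x * c * x⁻¹ = c := fun x hx c hc => by
    rw [hCc x hx c hc, mul_inv_cancel_right]
  have hAn : A.Normal := by
    refine ⟨fun c hc x => ?_⟩
    by_cases hx : x ∈ C
    · rwa [hconjC x hx c hc.1]
    · rw [hact x hx c hc.1, hc.2]
      exact A.inv_mem hc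
  have hiso : ∀ (x : G) (n : ℕ), n ≠ 0 → x ^ n ∈ A → x ∈ A := by
    have hisoC : ∀ x ∈ C, ∀ n : ℕ, n ≠ 0 → x ^ n ∈ A → x ∈ A := by
      intro x hx n hn hxn
      refine ⟨hx, TorsionFree.eq_of_pow_eq hn
        (hCc _ (hCn.conj_mem x hx h) _ (C.inv_mem hx)) ?_⟩
      rw [conj_pow, hxn.2, inv_pow]
    intro x n hn hxn
    by_cases hx : x ∈ C
    · exact hisoC x hx n hn hxn
    -- An element `x` outside `C` would invert `x²` as well as fix it, so `x⁴ = 1`.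
    · exfalso
      have hx2 : x ^ 2 ∈ C := by rw [pow_two]; exact hmul x x hx hx
      have h3 : x ^ 2 ∈ A := hisoC _ hx2 n hn (by
        rw [← pow_mul, mul_comm, pow_mul]; exact A.pow_mem hxn 2)
      have h4 := hact x hx _ hx2
      rw [h3.2] at h4
      have h5 : x ^ 4 = 1 := by
        rw [show x * x ^ 2 * x⁻¹ = x ^ 2 by group, eq_inv_iff_mul_eq_one, ← pow_add] at h4
        exact h4
      rw [TorsionFree.eq_one_of_pow (by norm_num) h5] at hx
      exact hx C.one_mem
  have hQ : TorsionFree (G ⧸ A) := .quotient hiso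
  have hcommA : ∀ x, ∀ c ∈ C, ⁅c, x⁆ ∈ A := by
    intro x c hc
    by_cases hx : x ∈ C
    · rw [commutatorElement_eq_one_iff_mul_comm.2 (hCc c hc x hx)]
      exact A.one_mem
    · have h3 : ⁅c, x⁆ = c * (h * c⁻¹ * h⁻¹) := by
        rw [← hact x hx _ (C.inv_mem hc), commutatorElement_def]; group
      rw [h3]
      have hcc := hCn.conj_mem c hc h
      refine ⟨C.mul_mem hc (hCn.conj_mem _ (C.inv_mem hc) h), ?_⟩
      have h4 := hconjC _ hh2 _ (C.inv_mem hc)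
      calc h * (c * (h * c⁻¹ * h⁻¹)) * h⁻¹ = (h * c * h⁻¹) * (h ^ 2 * c⁻¹ * (h ^ 2)⁻¹) := by
            rw [pow_two]; group
        _ = (h * c * h⁻¹) * c⁻¹ := by rw [h4]
        _ = (c * (h * c⁻¹ * h⁻¹))⁻¹ := by group
  -- The image of `C` is central of finite index in the torsion-free quotient, which is therefore
  -- abelian by transfer.
  have hQc : ∀ x y : G ⧸ A, x * y = y * x := by
    have hle : C.map (QuotientGroup.mk' A) ≤ Subgroup.center (G ⧸ A) := by
      rintro _ ⟨c, hc, rfl⟩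
      rw [Subgroup.mem_center_iff]
      intro q
      induction q using QuotientGroup.induction_on with
      | H x =>
        symm
        rw [← commutatorElement_eq_one_iff_mul_comm]
        exact (QuotientGroup.eq_one_iff _).2 (hcommA x c hc)
    have : (C.map (QuotientGroup.mk' A)).FiniteIndex :=
      ⟨fun h0 => hCi.index_ne_zero (Nat.eq_zero_of_zero_dvd
        (h0 ▸ Subgroup.index_map_dvd _ (QuotientGroup.mk'_surjective A)))⟩
    have : (Subgroup.center (G ⧸ A)).FiniteIndex := Subgroup.finiteIndex_of_le hle
    exact TorsionFree.mul_comm_of_finiteIndex_center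
  have hA1 : 1 ≤ hirschLength A := by
    obtain ⟨c, hc, hne⟩ : ∃ c ∈ C, ⁅c, h⁆ ≠ 1 := by
      by_contra! hcon
      exact hh (hself h fun y hy => (commutatorElement_eq_one_iff_mul_comm.1 (hcon y hy)).symm)
    refine one_le_hirschLength_of_not_isOfFinOrder (g := (⟨⁅c, h⁆, hcommA h c hc⟩ : A))
      (TorsionFree.not_isOfFinOrder fun h1 => hne (congrArg Subtype.val h1))
  have hQ1 : 1 ≤ hirschLength (G ⧸ A) := by
    refine one_le_hirschLength_of_not_isOfFinOrder (g := (h : G ⧸ A))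
      (TorsionFree.not_isOfFinOrder fun h1 => hh (hAC ((QuotientGroup.eq_one_iff h).1 h1)))
  have hadd := hirschLength_eq_add A
  rw [h2] at hadd
  have hA1' : hirschLength A ≤ 1 := by
    by_contra! hlt
    have h3 : (1 : ℕ∞) + 1 ≤ hirschLength A := Order.add_one_le_of_lt hlt
    have h4 : (1 : ℕ∞) + 1 + 1 ≤ 2 := (add_le_add h3 hQ1).trans hadd.symm.le
    exact absurd h4 (by decide)
  have hQ1' : hirschLength (G ⧸ A) ≤ 1 := by
    by_contra! hlt
    have h3 : (1 : ℕ∞) + 1 ≤ hirschLength (G ⧸ A) := Order.add_one_le_of_lt hlt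
    have h4 : (1 : ℕ∞) + (1 + 1) ≤ 2 := (add_le_add hA1 h3).trans hadd.symm.le
    exact absurd h4 (by decide)
  obtain ⟨a, ha⟩ := exists_eq_zpowers_of_hirschLength_le_one (hCfg.of_le_of_comm hCc hAC)
    (fun x hx y hy => hCc x (hAC hx) y (hAC hy)) hA1'
  have ha1 : a ≠ 1 := by
    rintro rfl
    rw [ha, Subgroup.zpowers_one_eq_bot, hirschLength_eq_zero_of_finite] at hA1
    exact absurd hA1 (by decide)
  have hQfg : Group.FG (G ⧸ A) := Group.fg_of_surjective (QuotientGroup.mk'_surjective A)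
  have hcyc : IsCyclic (G ⧸ A) := TorsionFree.isCyclic_of_hirschLength_le_one hQc hQ1'
  have hinf : Infinite (G ⧸ A) := by
    by_contra hfin
    rw [not_infinite_iff_finite] at hfin
    rw [hirschLength_eq_zero_of_finite] at hQ1
    exact absurd hQ1 (by decide)
  obtain ⟨s, hs, hs'⟩ := exists_sup_zpowers_eq_top_of_isCyclic_quotient A
  have hsC : s ∉ C := fun hsC => hh <| by
    have : A ⊔ Subgroup.zpowers s ≤ C := sup_le hAC (Subgroup.zpowers_le.2 hsC)
    exact this (hs ▸ Subgroup.mem_top h)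
  have haA : a ∈ A := ha ▸ Subgroup.mem_zpowers a
  refine BaumslagSolitar.nonempty_mulEquiv (x := a) (y := s) ?_ (ha ▸ hs)
    (TorsionFree.not_isOfFinOrder ha1) (fun k hk => ha ▸ hs' hinf k hk)
  rw [hact s hsC a haA.1, haA.2, zpow_neg_one]

/-! ### Solvability through finite groups of integral matrices -/

theorem Group.isSolvable_of_subgroup_quotient {G : Type*} [Group G] (N : Subgroup G) [N.Normal]
    (h : Group.IsSolvable N) (h' : Group.IsSolvable (G ⧸ N)) : Group.IsSolvable G :=
  (Group.isSolvable_iff_subgroup_quotient N).2 ⟨h, h'⟩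

/-- A Sylow 2-subgroup has index dividing 3. Its core is a 2-group, and the quotient by the core has
squarefree order dividing `3! = 6`. -/
theorem Group.isSolvable_of_card_dvd_two_pow_mul_three {E : Type*} [Group E] [Finite E] {j : ℕ}
    (h : Nat.card E ∣ 2 ^ j * 3) : Group.IsSolvable E := by
  have : Fact (Nat.Prime 2) := ⟨Nat.prime_two⟩
  obtain ⟨P⟩ : Nonempty (Sylow 2 E) := inferInstance
  set H : Subgroup E := P.toSubgroup
  have hi : H.index ∣ 3 := by
    have h1 : ¬ 2 ∣ H.index := P.not_dvd_index
    have h2 : Nat.Coprime H.index (2 ^ j) :=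
      (Nat.Coprime.pow_left j ((Nat.Prime.coprime_iff_not_dvd Nat.prime_two).2 h1)).symm
    exact h2.dvd_of_dvd_mul_left (H.index_dvd_card.trans h)
  have h3 : H.index ≤ 3 := Nat.le_of_dvd (by norm_num) hi
  have h4 : Nat.card (E ⧸ H.normalCore) ∣ 6 := by
    rw [← Subgroup.index_eq_card]
    have h5 : H.normalCore.index ∣ H.index.factorial := by
      rw [Subgroup.normalCore_eq_ker, Subgroup.index_ker, Subgroup.index_eq_card, ← Nat.card_perm]
      exact Subgroup.card_subgroup_dvd_card _
    exact h5.trans (Nat.factorial_dvd_factorial h3)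
  have h5 : IsZGroup (E ⧸ H.normalCore) := .of_squarefree
    (Squarefree.squarefree_of_dvd h4 (by decide +kernel))
  have h6 : IsPGroup 2 H.normalCore := P.isPGroup'.to_le H.normalCore_le
  have := h6.isNilpotent
  exact Group.isSolvable_of_subgroup_quotient H.normalCore inferInstance inferInstance

/-- Divided by the gcd of its entries, the fixed vector becomes primitive and survives reduction
modulo `p`. -/
theorem Matrix.exists_mulVec_eq_intCast_ne_zero {r p : ℕ} [Fact p.Prime]
    {M : Matrix (Fin r) (Fin r) ℤ} {v : Fin r → ℤ} (hv : v ≠ 0) (hM : M.mulVec v = v) :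
    ∃ w : Fin r → ZMod p, w ≠ 0 ∧ (M.map (Int.castRingHom (ZMod p))).mulVec w = w := by
  obtain ⟨i, hi⟩ : ∃ i, v i ≠ 0 := by
    by_contra! h
    exact hv (funext h)
  obtain ⟨w, hw, hgcd⟩ := Finset.extract_gcd (s := Finset.univ) v ⟨i, Finset.mem_univ i⟩
  set d := Finset.univ.gcd v
  have hd : d ≠ 0 := fun h0 => hi (by rw [hw i (Finset.mem_univ i), h0, zero_mul])
  have hvw : v = d • w := funext fun b => by simp [hw b (Finset.mem_univ b)]
  have hMw : M.mulVec w = w := by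
    rw [hvw, Matrix.mulVec_smul] at hM
    exact smul_right_injective _ hd hM
  refine ⟨Int.castRingHom (ZMod p) ∘ w, fun h0 => ?_, ?_⟩
  · have h1 : ∀ b ∈ Finset.univ, (p : ℤ) ∣ w b := fun b _ =>
      (ZMod.intCast_zmod_eq_zero_iff_dvd (w b) p).1 (congrFun h0 b)
    have h2 := Finset.dvd_gcd h1
    rw [hgcd] at h2
    exact (Nat.prime_iff_prime_int.1 (Fact.out : p.Prime)).not_isUnit (isUnit_of_dvd_one h2)
  · exact funext fun b => by rw [← RingHom.map_mulVec, hMw]; rfl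

/-- The sum `S = 1 + M + ⋯ + Mⁿ⁻¹` annihilates `M - 1` and reduces to `n = 1` modulo 2, so its
determinant is odd, in particular nonzero. -/
theorem Matrix.eq_one_of_map_eq_one {r : ℕ} {M : Matrix (Fin r) (Fin r) ℤ} {n : ℕ} (hn : Odd n)
    (hM : M ^ n = 1) (h1 : M.map (Int.castRingHom (ZMod 2)) = 1) : M = 1 := by
  set S := ∑ i ∈ Finset.range n, M ^ i with hS
  have h2 : S * (M - 1) = 0 := by rw [hS, geom_sum_mul, hM, sub_self]
  have h1' : (Int.castRingHom (ZMod 2)).mapMatrix M = 1 := h1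
  have h3 : S.det ≠ 0 := by
    intro h0
    have h4 := RingHom.map_det (Int.castRingHom (ZMod 2)) S
    have h5 : (Int.castRingHom (ZMod 2)).mapMatrix S = 1 := by
      rw [hS, map_sum]
      simp only [map_pow, h1', one_pow, Finset.sum_const, Finset.card_range]
      obtain ⟨k, rfl⟩ := hn
      ext i j
      rw [Matrix.smul_apply, ← Nat.cast_smul_eq_nsmul (ZMod 2), Nat.cast_add, Nat.cast_mul]
      simp [CharTwo.two_eq_zero]
    rw [h0, h5, Matrix.det_one, map_zero] at h4
    exact zero_ne_one h4
  have h4 : S.det • (M - 1) = 0 := by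
    rw [← one_mul (M - 1), ← smul_mul_assoc, ← Matrix.adjugate_mul, mul_assoc, h2, mul_zero]
  refine sub_eq_zero.1 (Matrix.ext fun i j => ?_)
  have h6 := congrFun (congrFun h4 i) j
  rw [Matrix.smul_apply, Matrix.zero_apply, smul_eq_zero] at h6
  exact h6.resolve_left h3

/-- The number of fixed points on the eight vectors is congruent to 8 modulo 7, so it is 1 or 8. The
vectors `0` and `w` are two of them. -/
theorem Matrix.eq_one_of_pow_seven_eq_one {M : Matrix (Fin 3) (Fin 3) (ZMod 2)} (hM : M ^ 7 = 1)
    {w : Fin 3 → ZMod 2} (hw : w ≠ 0) (hMw : M.mulVec w = w) : M = 1 := by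
  classical
  have : Fact (Nat.Prime 7) := ⟨by norm_num⟩
  let f : Function.End (Fin 3 → ZMod 2) := fun x => M.mulVec x
  have hf : ∀ n x, (f ^ n) x = (M ^ n).mulVec x := by
    intro n
    induction n with
    | zero => intro x; rw [pow_zero, pow_zero, Matrix.one_mulVec]; rfl
    | succ n ih =>
      intro x
      rw [pow_succ', pow_succ', ← Matrix.mulVec_mulVec, ← ih]
      rfl
  have h1 := Equiv.Perm.card_fixedPoints_modEq (p := 7) (n := 1) (f := f) (funext fun x => by
    rw [hf, pow_one, hM, Matrix.one_mulVec]; rfl)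
  have h2 : Fintype.card (Fin 3 → ZMod 2) = 8 := by simp [ZMod.card]
  have hmem : ∀ x, x ∈ Function.fixedPoints f ↔ M.mulVec x = x := fun x => Iff.rfl
  have h3 : 1 < Fintype.card (Function.fixedPoints f) := by
    rw [Fintype.one_lt_card_iff]
    exact ⟨⟨w, (hmem w).2 hMw⟩, ⟨0, (hmem 0).2 (Matrix.mulVec_zero M)⟩,
      fun h => hw (congrArg Subtype.val h)⟩
  have h4 : Fintype.card (Function.fixedPoints f) ≤ 8 := h2 ▸ Fintype.card_subtype_le _
  have h5 : Fintype.card (Function.fixedPoints f) = Fintype.card (Fin 3 → ZMod 2) := by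
    rw [h2] at h1 ⊢
    generalize Fintype.card (Function.fixedPoints f) = k at *
    change 8 % 7 = k % 7 at h1
    omega
  refine Matrix.toLin'.injective (LinearMap.ext fun x => ?_)
  have h6 : Function.fixedPoints f = Set.univ := (set_fintype_card_eq_univ_iff _).1 h5
  have h7 := (hmem x).1 (h6 ▸ Set.mem_univ x)
  rw [Matrix.toLin'_apply, h7, Matrix.toLin'_one, LinearMap.id_apply]

/-- Finite groups of integral matrices of size two are solvable, and so are those of size three whose
elements have fixed vectors. -/
theorem Group.isSolvable_of_injective_GL {E : Type*} [Group E] [Finite E] {r : ℕ}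
    (hr : r = 2 ∨ r = 3) (ρ : E →* GL (Fin r) ℤ) (hρ : Injective ρ)
    (hfix : r = 3 → ∀ g, ∃ v, v ≠ 0 ∧ (ρ g : Matrix (Fin r) (Fin r) ℤ).mulVec v = v) :
    Group.IsSolvable E := by
  have : Fact (Nat.Prime 2) := ⟨Nat.prime_two⟩
  let ψ : E →* GL (Fin r) (ZMod 2) :=
    (Matrix.GeneralLinearGroup.map (Int.castRingHom (ZMod 2))).comp ρ
  have hψ : ∀ g, (ψ g : Matrix (Fin r) (Fin r) (ZMod 2)) =
      (ρ g : Matrix (Fin r) (Fin r) ℤ).map (Int.castRingHom (ZMod 2)) := fun _ => rfl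
  have hodd : ∀ (g : E) (n : ℕ), Odd n → g ^ n = 1 → ψ g = 1 → g = 1 := by
    intro g n hn hg h1
    rw [← map_eq_one_iff ρ hρ]
    refine Units.ext (Matrix.eq_one_of_map_eq_one hn ?_ ?_)
    · rw [← Units.val_pow_eq_pow_val, ← map_pow, hg, map_one, Units.val_one]
    · rw [← hψ, h1, Units.val_one]
  -- Raised to the 2-part of its order, an element of the kernel has odd order and trivial
  -- reduction, so it becomes trivial.
  have hker : IsPGroup 2 ψ.ker := by
    rintro ⟨g, hg⟩
    obtain ⟨k, m, hm, hgm⟩ := Nat.exists_eq_two_pow_mul_odd (orderOf_pos g).ne'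
    refine ⟨k, Subtype.ext (hodd (g ^ 2 ^ k) m hm ?_ ?_)⟩
    · rw [← pow_mul, ← hgm, pow_orderOf_eq_one]
    · rw [map_pow, MonoidHom.mem_ker.1 hg, one_pow]
  obtain ⟨k, hk⟩ := IsPGroup.iff_card.1 hker
  have hcard : Nat.card E = 2 ^ k * Nat.card ψ.range := by
    rw [← hk, mul_comm, ← Subgroup.card_mul_index ψ.ker, Subgroup.index_ker, mul_comm]
  have hrange : Nat.card ψ.range ∣ Nat.card (GL (Fin r) (ZMod 2)) :=
    Subgroup.card_subgroup_dvd_card _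
  rw [Matrix.card_GL_field, ZMod.card] at hrange
  rcases hr with rfl | rfl
  · refine Group.isSolvable_of_card_dvd_two_pow_mul_three (j := k + 1) ?_
    rw [hcard, pow_succ, mul_assoc]
    refine mul_dvd_mul_left _ (hrange.trans ?_)
    simp [Fin.prod_univ_two]
  -- `GL₃(𝔽₂)` has order `168 = 2³ · 3 · 7`, so the prime 7 has to be excluded; the fixed vectors do
  -- this.
  · have h7 : ¬ 7 ∣ Nat.card E := by
      have : Fact (Nat.Prime 7) := ⟨by norm_num⟩
      intro h7
      obtain ⟨g, hg⟩ := exists_prime_orderOf_dvd_card' 7 h7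
      have hg7 : g ^ 7 = 1 := by rw [← hg, pow_orderOf_eq_one]
      have hg1 : g ≠ 1 := by
        rintro rfl
        rw [orderOf_one] at hg
        exact absurd hg (by norm_num)
      obtain ⟨v, hv, hgv⟩ := hfix rfl g
      obtain ⟨w, hw, hgw⟩ := Matrix.exists_mulVec_eq_intCast_ne_zero (p := 2) hv hgv
      refine hg1 (hodd g 7 (by decide) hg7 (Units.ext ?_))
      refine Matrix.eq_one_of_pow_seven_eq_one ?_ hw hgw
      rw [← Units.val_pow_eq_pow_val, ← map_pow, hg7, map_one, Units.val_one]
    refine Group.isSolvable_of_card_dvd_two_pow_mul_three (j := k + 3) ?_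
    refine (Nat.Coprime.dvd_of_dvd_mul_left
      ((Nat.Prime.coprime_iff_not_dvd (by norm_num)).2 h7).symm (m := 7) ?_)
    rw [hcard, show 7 * (2 ^ (k + 3) * 3) = 2 ^ k * 168 by ring]
    refine mul_dvd_mul_left _ (hrange.trans ?_)
    simp [Fin.prod_univ_three]

theorem Group.isSolvable_of_finite_range_GL {G : Type*} [Group G] {r : ℕ}
    (hr : r = 2 ∨ r = 3) (ρ : G →* GL (Fin r) ℤ) [hfin : Finite ρ.range]
    (hker : Group.IsSolvable ρ.ker)
    (hfix : r = 3 → ∀ g, ∃ v, v ≠ 0 ∧ (ρ g : Matrix (Fin r) (Fin r) ℤ).mulVec v = v) :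
    Group.IsSolvable G := by
  have h1 : Group.IsSolvable ρ.range :=
    Group.isSolvable_of_injective_GL hr ρ.range.subtype ρ.range.subtype_injective
      (by rintro h ⟨_, g, rfl⟩; exact hfix h g)
  exact Group.isSolvable_of_ker_le_range ρ.ker.subtype ρ.rangeRestrict (by
    rw [MonoidHom.ker_rangeRestrict, Subgroup.range_subtype])

theorem MonoidHom.finite_range_of_le_ker {G K : Type*} [Group G] [Group K] {f : G →* K}
    {N : Subgroup G} [N.FiniteIndex] (h : N ≤ f.ker) : Finite f.range := by
  have h1 : f.ker.FiniteIndex := Subgroup.finiteIndex_of_le h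
  have h2 := h1.index_ne_zero
  rw [Subgroup.index_ker] at h2
  exact Nat.finite_of_card_ne_zero h2

section

variable {G : Type u} [Group G] [TorsionFree G] [HasHirsch G]

/-- Modulo a self-centralizing abelian normal subgroup, `G` is a finite group of integral 3×3
matrices, all with fixed vectors since `G` is torsion-free. -/
theorem Group.isSolvable_of_finiteIndex_of_comm {L : Subgroup G} [L.FiniteIndex]
    (hL : L.FG) (hLc : ∀ x ∈ L, ∀ y ∈ L, x * y = y * x) (h3 : hirschLength G = 3) :
    Group.IsSolvable G := by
  obtain ⟨C, hCn, hCi, hCfg, hCc, hself⟩ := exists_normal_of_finiteIndex_of_comm hL hLc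
  have hCl : hirschLength C = 3 := by rw [hirschLength_eq_of_finiteIndex, h3]
  have : Group.FG C := (Group.fg_iff_subgroup_fg C).2 hCfg
  obtain ⟨e⟩ := TorsionFree.nonempty_mulEquiv_pi (G := C) (r := 3)
    (fun x y => Subtype.ext (hCc x x.2 y y.2)) hCl
  obtain ⟨ρ, hρ, hρ1⟩ := exists_conjNormal_hom_GL e
  have hker : ρ.ker = C := by
    ext x
    rw [MonoidHom.mem_ker, hρ1]
    exact ⟨hself x, fun hx c hc => hCc x hx c hc⟩
  have hfin : Finite ρ.range := MonoidHom.finite_range_of_le_ker hker.ge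
  refine Group.isSolvable_of_finite_range_GL (Or.inr rfl) ρ ?_ fun _ g => ?_
  · rw [hker]
    exact Group.isSolvable_of_comm fun x y => Subtype.ext (hCc x x.2 y y.2)
  · by_cases hg : g = 1
    · refine ⟨fun _ => 1, fun h => one_ne_zero (congrFun h 0), ?_⟩
      rw [hg, map_one, Units.val_one, Matrix.one_mulVec]
    · exact exists_mulVec_eq_of_finiteIndex e hρ hg

/-- A group that is central-by-finite modulo a subgroup `Z`, as in the statement, is solvable. -/
theorem Group.isSolvable_of_finiteIndex_map_le_center {D Z M : Subgroup G} [hZn : Z.Normal]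
    (hM : M.relIndex D ≠ 0)
    (hZc : ∀ x ∈ Z, ∀ y ∈ Z, x * y = y * x) (hZ1 : hirschLength Z ≤ 1)
    (hiso : ∀ x ∈ M, ∀ n : ℕ, n ≠ 0 → x ^ n ∈ Z → x ∈ Z)
    (hMc : ∀ x ∈ M, ∀ y ∈ D, ⁅x, y⁆ ∈ Z) : Group.IsSolvable D := by
  have hZ'n : (Z.subgroupOf D).Normal := inferInstance
  set Z' := Z.subgroupOf D
  have hle : (M.subgroupOf D).map (QuotientGroup.mk' Z') ≤ Subgroup.center (D ⧸ Z') := by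
    rintro _ ⟨c, hc, rfl⟩
    rw [Subgroup.mem_center_iff]
    intro q
    induction q using QuotientGroup.induction_on with
    | H x =>
      symm
      rw [← commutatorElement_eq_one_iff_mul_comm]
      exact (QuotientGroup.eq_one_iff _).2 (hMc c hc x x.2)
  have : ((M.subgroupOf D).map (QuotientGroup.mk' Z')).FiniteIndex :=
    ⟨fun h0 => hM (Nat.eq_zero_of_zero_dvd
      (h0 ▸ Subgroup.index_map_dvd _ (QuotientGroup.mk'_surjective Z')))⟩
  have hcfi : (Subgroup.center (D ⧸ Z')).FiniteIndex := Subgroup.finiteIndex_of_le hle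
  -- The transfer into the centre of `D/Z` is a power map, so elements of its kernel have a power in
  -- `Z`. The kernel is then a finite extension of `Z`, hence abelian by rank one, and the image is
  -- abelian too.
  let f : D →* Subgroup.center (D ⧸ Z') :=
    (MonoidHom.transferCenterPow (D ⧸ Z')).comp (QuotientGroup.mk' Z')
  have hf : ∀ x ∈ f.ker, ∃ n : ℕ, n ≠ 0 ∧ (x : G) ^ n ∈ Z := by
    intro x hx
    refine ⟨_, hcfi.index_ne_zero, ?_⟩
    have h1 := congrArg Subtype.val (MonoidHom.mem_ker.1 hx)
    rw [MonoidHom.comp_apply, MonoidHom.transferCenterPow_apply] at h1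
    exact (QuotientGroup.eq_one_iff (x ^ _)).1 h1
  have hZf : Z' ≤ f.ker := fun x hx => by
    rw [MonoidHom.mem_ker, MonoidHom.comp_apply, QuotientGroup.mk'_apply,
      (QuotientGroup.eq_one_iff x).2 hx, map_one]
  have hker : Group.IsSolvable f.ker := by
    have hi : (Z'.subgroupOf f.ker).FiniteIndex := by
      constructor
      have h1 : ((M.subgroupOf D).subgroupOf f.ker).FiniteIndex := by
        have : (M.subgroupOf D).FiniteIndex := ⟨hM⟩
        infer_instance
      have h2 : (M.subgroupOf D).subgroupOf f.ker ≤ Z'.subgroupOf f.ker := by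
        intro x hx
        obtain ⟨n, hn, hxn⟩ := hf x x.2
        exact hiso _ hx n hn hxn
      exact (Subgroup.finiteIndex_of_le h2).index_ne_zero
    refine Group.isSolvable_of_comm (mul_comm_of_finiteIndex_of_hirschLength_le_one
      (C := Z'.subgroupOf f.ker) ?_ ?_)
    · exact fun x hx y hy => Subtype.ext (Subtype.ext (hZc _ hx _ hy))
    · refine (hirschLength_le_of_injective (G := Z)
        ((D.subtype.comp (f.ker.subtype.comp (Z'.subgroupOf f.ker).subtype)).codRestrict Z
          fun x => x.2) ?_).trans hZ1
      intro x y hxy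
      exact Subtype.ext (Subtype.ext (Subtype.ext (congrArg (Subtype.val : Z → G) hxy)))
  have hrange : Group.IsSolvable (Subgroup.center (D ⧸ Z')) :=
    Group.isSolvable_of_comm fun x y => Subtype.ext (Subgroup.mem_center_iff.1 y.2 x)
  exact Group.isSolvable_of_ker_le_range f.ker.subtype f (by rw [Subgroup.range_subtype])

/-- If `M` is not abelian, its centre `Z` has rank one and `M/Z` is torsion-free abelian of rank
two. `G` acts on `M/Z` through a finite subgroup of `GL₂(ℤ)`, and the kernel of this action is
treated by `Group.isSolvable_of_finiteIndex_map_le_center`. -/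
theorem Group.isSolvable_of_finiteIndex_of_class_two {M : Subgroup G} [hMn : M.Normal]
    [M.FiniteIndex] (hM : M.FG) (hcl : ∀ x ∈ M, ∀ y ∈ M, ∀ z ∈ M, ⁅x, y⁆ * z = z * ⁅x, y⁆)
    (h3 : hirschLength G = 3) : Group.IsSolvable G := by
  by_cases hMc : ∀ x ∈ M, ∀ y ∈ M, x * y = y * x
  · exact Group.isSolvable_of_finiteIndex_of_comm hM hMc h3
  set Z := M ⊓ Subgroup.centralizer (M : Set G) with hZ
  have hZn : Z.Normal := inferInstance
  have hZM : Z ≤ M := inf_le_left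
  have hmemZ : ∀ x ∈ M, (∀ y ∈ M, x * y = y * x) → x ∈ Z := fun x hx hxy =>
    ⟨hx, Subgroup.mem_centralizer_iff.2 fun y hy => (hxy y hy).symm⟩
  have hZc : ∀ x ∈ Z, ∀ y ∈ M, x * y = y * x := fun x hx y hy =>
    (Subgroup.mem_centralizer_iff.1 hx.2 y hy).symm
  have hcomm : ∀ x ∈ M, ∀ y ∈ M, ⁅x, y⁆ ∈ Z := fun x hx y hy =>
    hmemZ _ (M.commutator_le_self (Subgroup.commutator_mem_commutator hx hy)) (hcl x hx y hy)
  have hiso : ∀ x ∈ M, ∀ n : ℕ, n ≠ 0 → x ^ n ∈ Z → x ∈ Z := by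
    intro x hx n hn hxn
    refine hmemZ x hx fun y hy => ?_
    have h1 : y * x * y⁻¹ = ⁅y, x⁆ * x := by rw [commutatorElement_def]; group
    have h2 : Commute (y * x * y⁻¹) x := by
      rw [h1]
      exact Commute.mul_left (hcl y hy x hx x hx) (Commute.refl x)
    have h4 : y * x * y⁻¹ = x := TorsionFree.eq_of_pow_eq hn h2 (by
      rw [conj_pow, ← hZc _ hxn y hy, mul_inv_cancel_right])
    exact (mul_inv_eq_iff_eq_mul.1 h4).symm
  set A := M.map (QuotientGroup.mk' Z) with hA
  have hAn : A.Normal := hMn.map _ (QuotientGroup.mk'_surjective Z)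
  let f : M →* A := (QuotientGroup.mk' Z).subgroupMap M
  have hf : Surjective f := (QuotientGroup.mk' Z).subgroupMap_surjective M
  have hfk : ∀ x, f x = 1 ↔ (x : G) ∈ Z := fun x => by
    rw [← QuotientGroup.eq_one_iff (N := Z)]
    exact Subtype.ext_iff
  have hAc : ∀ x y : A, x * y = y * x := by
    intro x y
    obtain ⟨x, rfl⟩ := hf x
    obtain ⟨y, rfl⟩ := hf y
    rw [← commutatorElement_eq_one_iff_mul_comm, ← map_commutatorElement, hfk]
    exact hcomm x x.2 y y.2
  have hAtf : TorsionFree A := by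
    refine ⟨fun q hq => ?_⟩
    obtain ⟨n, hn, hqn⟩ := isOfFinOrder_iff_pow_eq_one.1 hq
    obtain ⟨x, rfl⟩ := hf q
    rw [← map_pow, hfk] at hqn
    rw [hfk]
    exact hiso x x.2 n hn.ne' hqn
  have hMfg : Group.FG M := (Group.fg_iff_subgroup_fg M).2 hM
  have hAfg : Group.FG A := Group.fg_of_surjective hf
  have hker : hirschLength f.ker = hirschLength Z := by
    refine le_antisymm (hirschLength_le_of_injective
      ((M.subtype.comp f.ker.subtype).codRestrict Z fun x => (hfk x).1 x.2) fun x y hxy =>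
        Subtype.ext (Subtype.ext (congrArg (Subtype.val : Z → G) hxy)))
      (hirschLength_le_of_injective ((Subgroup.inclusion hZM).codRestrict f.ker fun x =>
        (hfk _).2 x.2) fun x y hxy => Subtype.ext (congrArg (fun z : f.ker => ((z : M) : G)) hxy))
  have hadd := hirschLength_eq_ker_add f hf
  rw [hker, hirschLength_eq_of_finiteIndex, h3] at hadd
  have hZ1 : 1 ≤ hirschLength Z := by
    push Not at hMc
    obtain ⟨x, hx, y, hy, hxy⟩ := hMc
    exact one_le_hirschLength_of_not_isOfFinOrder (g := (⟨⁅x, y⁆, hcomm x hx y hy⟩ : Z))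
      (TorsionFree.not_isOfFinOrder fun h1 => hxy
        (commutatorElement_eq_one_iff_mul_comm.1 (congrArg Subtype.val h1)))
  -- A cyclic quotient by the centre would make `M` abelian.
  have hA2 : 1 + 1 ≤ hirschLength A := by
    refine Order.add_one_le_of_lt (not_le.1 fun hA1 => hMc fun x hx y hy => ?_)
    have hcyc : IsCyclic A := TorsionFree.isCyclic_of_hirschLength_le_one hAc hA1
    have h5 := MonoidHom.isMulCommutative_of_isCyclic_of_ker_le_center f (fun z hz => by
      rw [Subgroup.mem_center_iff]
      exact fun w => Subtype.ext (hZc z ((hfk z).1 hz) w w.2).symm)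
    exact congrArg Subtype.val (h5.is_comm.comm ⟨x, hx⟩ ⟨y, hy⟩)
  have hZ1' : hirschLength Z ≤ 1 := by
    by_contra! hlt
    have h5 : (1 : ℕ∞) + 1 + (1 + 1) ≤ 3 :=
      (add_le_add (Order.add_one_le_of_lt hlt) hA2).trans hadd.symm.le
    exact absurd h5 (by decide)
  have hA2' : hirschLength A = 2 := by
    refine le_antisymm (not_lt.1 fun hlt => ?_) hA2
    have h5 : (1 : ℕ∞) + (2 + 1) ≤ 3 :=
      (add_le_add hZ1 (Order.add_one_le_of_lt hlt)).trans hadd.symm.le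
    exact absurd h5 (by decide)
  obtain ⟨e⟩ := TorsionFree.nonempty_mulEquiv_pi (G := A) (r := 2) hAc hA2'
  obtain ⟨ρ, -, hρ1⟩ := exists_conjNormal_hom_GL e
  let ρ' := ρ.comp (QuotientGroup.mk' Z)
  have hρ' : ∀ g, g ∈ ρ'.ker ↔ ∀ m ∈ M, ⁅m, g⁆ ∈ Z := by
    intro g
    rw [MonoidHom.mem_ker, MonoidHom.comp_apply, hρ1]
    constructor
    · intro h m hm
      rw [← QuotientGroup.eq_one_iff]
      exact commutatorElement_eq_one_iff_mul_comm.2 (h _ ⟨m, hm, rfl⟩).symm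
    · rintro h _ ⟨m, hm, rfl⟩
      exact (commutatorElement_eq_one_iff_mul_comm.1
        ((QuotientGroup.eq_one_iff ⁅m, g⁆).2 (h m hm))).symm
  have hMD : M ≤ ρ'.ker := fun x hx => (hρ' x).2 fun m hm => hcomm m hm x hx
  have hfin : Finite ρ'.range := MonoidHom.finite_range_of_le_ker hMD
  refine Group.isSolvable_of_finite_range_GL (Or.inl rfl) ρ' ?_ (fun h => by omega)
  refine Group.isSolvable_of_finiteIndex_map_le_center ?_
    (fun x hx y hy => hZc x hx y (hZM hy)) hZ1' hiso fun x hx y hy => (hρ' y).1 hy x hx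
  have h1 : (M.subgroupOf ρ'.ker).FiniteIndex := inferInstance
  exact h1.index_ne_zero

end

/-! ### Ascending HNN extensions with abelian base of rank two -/

section

variable {G : Type*} [Group G]

theorem conj_mem_iff_of_normal (K : Subgroup G) [hK : K.Normal] (w x : G) :
    w * x * w⁻¹ ∈ K ↔ x ∈ K := by
  refine ⟨fun hx => ?_, fun hx => hK.conj_mem x hx w⟩
  have := hK.conj_mem _ hx w⁻¹
  simpa [mul_assoc] using this

theorem exists_mul_zpow_eq {K : Subgroup G} {t : G} (h : ∀ x, t * x * t⁻¹ ∈ K ↔ x ∈ K) {k : G}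
    (hk : k ∈ K) (q : ℤ) : ∃ k' ∈ K, (t * k) ^ q = t ^ q * k' := by
  induction q using Int.induction_on with
  | zero => exact ⟨1, K.one_mem, by simp⟩
  | succ i ih =>
    obtain ⟨k', hk', h1⟩ := ih
    refine ⟨t⁻¹ * k' * t * k, K.mul_mem ((conj_inv_mem_iff h k').2 hk') hk, ?_⟩
    rw [zpow_add_one, h1, zpow_add_one]; group
  | pred i ih =>
    obtain ⟨k', hk', h1⟩ := ih
    refine ⟨t * (k' * k⁻¹) * t⁻¹, (h _).2 (K.mul_mem hk' (K.inv_mem hk)), ?_⟩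
    rw [zpow_sub_one, h1, zpow_sub_one]; group

theorem conj_eq_or_eq_inv_of_normal_zpowers {z : G} (hz : ¬ IsOfFinOrder z)
    [hn : (Subgroup.zpowers z).Normal] (w : G) : w * z * w⁻¹ = z ∨ w * z * w⁻¹ = z⁻¹ := by
  obtain ⟨r, hr⟩ := hn.conj_mem z (Subgroup.mem_zpowers z) w
  obtain ⟨k, hk⟩ := hn.conj_mem z (Subgroup.mem_zpowers z) w⁻¹
  have hr : z ^ r = w * z * w⁻¹ := hr
  have hk : z ^ k = w⁻¹ * z * w⁻¹⁻¹ := hk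
  have h1 : z ^ (r * k) = z ^ (1 : ℤ) := by
    rw [zpow_mul, hr, conj_zpow, hk]; group
  have h2 : r * k = 1 := injective_zpow_iff_not_isOfFinOrder.2 hz h1
  rw [← hr]
  rcases Int.eq_one_or_neg_one_of_mul_eq_one h2 with rfl | rfl
  · exact Or.inl (zpow_one z)
  · exact Or.inr (zpow_neg_one z)

/-- The automorphism group of `ℤ` is abelian, so commutators act trivially. -/
theorem commutatorElement_mul_comm_of_normal_zpowers {z : G} (hz : ¬ IsOfFinOrder z)
    [hn : (Subgroup.zpowers z).Normal] (x y : G) : ⁅x, y⁆ * z = z * ⁅x, y⁆ := by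
  have key := conj_eq_or_eq_inv_of_normal_zpowers hz
  have h1 : x * (y * z * y⁻¹) * x⁻¹ = y * (x * z * x⁻¹) * y⁻¹ := by
    rcases key x with hx | hx <;> rcases key y with hy | hy <;> simp only [hx, hy, ← conj_inv, inv_inv]
  set w := y * (x * z * x⁻¹) * y⁻¹ with hw
  have h2 : Commute ⁅x, y⁆ w := by
    have h3 : ⁅x, y⁆ * w * ⁅x, y⁆⁻¹ = w := by
      rw [← h1, commutatorElement_def]
      nth_rw 1 [h1]
      rw [hw]; group
    exact mul_inv_eq_iff_eq_mul.1 h3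
  rcases key (y * x) with h | h
  · rwa [show w = z by rw [← h, hw]; group] at h2
  · rw [show w = z⁻¹ by rw [← h, hw]; group, Commute.inv_right_iff] at h2
    exact h2

namespace IsContracted

variable {K L : Subgroup G} {g : G}

theorem refl (h : ∀ x, g * x * g⁻¹ ∈ K ↔ x ∈ K) : IsContracted K K g :=
  ⟨le_rfl, h, fun x hx => (h x).2 hx, fun x hx => ⟨0, by simpa using hx⟩⟩

theorem conj [hK : K.Normal] (h : IsContracted K L g) (w : G) :
    IsContracted K (L.map (MulAut.conj w).toMonoidHom) (w * g * w⁻¹) where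
  le := by
    rintro _ ⟨x, hx, rfl⟩
    exact hK.conj_mem x (h.le hx) w
  mem_iff := conj_mem_iff_of_normal K _
  conj_mem := by
    rintro _ ⟨x, hx, rfl⟩
    exact ⟨_, h.conj_mem x hx, by simp [mul_assoc]⟩
  absorb x hx := by
    obtain ⟨n, hn⟩ := h.absorb _ (hK.conj_mem x hx w⁻¹)
    refine ⟨n, _, hn, ?_⟩
    simp only [MulEquiv.toMonoidHom_eq_coe, MonoidHom.coe_coe, MulAut.conj_apply, conj_pow]
    group

theorem exists_absorb {F : Subgroup G} (h : IsContracted K L g) (hF : F.FG) (hFK : F ≤ K) :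
    ∃ n : ℕ, ∀ x ∈ F, g ^ n * x * (g ^ n)⁻¹ ∈ L := by
  obtain ⟨S, rfl⟩ := hF
  have h1 : ∀ s ∈ S, ∃ n : ℕ, g ^ n * s * (g ^ n)⁻¹ ∈ L := fun s hs =>
    h.absorb s (hFK (Subgroup.subset_closure hs))
  choose! ν hν using h1
  refine ⟨S.sup ν, fun x hx => ?_⟩
  have : Subgroup.closure (S : Set G) ≤ L.comap (MulAut.conj (g ^ S.sup ν)).toMonoidHom :=
    (Subgroup.closure_le _).2 fun s hs =>
      conj_pow_mem_of_le h.conj_mem (Finset.le_sup (f := ν) hs) (hν s hs)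
  exact this hx

/-- A power of `g` moves `x` into the finitely generated `L`, and a power of `g⁻¹` moves all of `L`
into `L'`. Taken with the same exponent, the two conjugations cancel, so `x` itself lies in `L'`. -/
theorem eq_of_inv {L' : Subgroup G} (h : IsContracted K L g) (hL : L.FG)
    (h' : IsContracted K L' g⁻¹) : K = L' := by
  refine le_antisymm (fun x hx => ?_) h'.le
  obtain ⟨n, hn⟩ := h'.exists_absorb hL h.le
  obtain ⟨m, hm⟩ := h.absorb x hx
  have h1 := hn _ (conj_pow_mem_of_le h.conj_mem (le_max_left m n) hm)
  have h2 := conj_pow_mem_of_le h'.conj_mem (le_max_right m n) h1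
  rwa [inv_pow, inv_inv, mul_assoc (g ^ _), inv_mul_cancel_left, inv_mul_cancel_right] at h2

end IsContracted

/-- The normal core of a finite-index ascending HNN extension of a commutative group is of the same
form. -/
theorem exists_normalCore_eq_sup_zpowers {K L : Subgroup G} {t : G} (hK : IsContracted K L t)
    (hKc : ∀ x ∈ K, ∀ y ∈ K, x * y = y * x) (ht : ∀ k : ℕ, k ≠ 0 → t ^ k ∉ K)
    {N₀ : Subgroup G} [N₀.Normal] [N₀.FiniteIndex] (hN₀ : N₀ ≤ K ⊔ Subgroup.zpowers t) :
    ∃ t₀, IsContracted (K ⊓ N₀) (L ⊓ N₀) t₀ ∧ (∀ k : ℕ, k ≠ 0 → t₀ ^ k ∉ K) ∧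
      N₀ = (K ⊓ N₀) ⊔ Subgroup.zpowers t₀ := by
  -- The exponents of `t` that occur in `N₀` modulo `K`. Its generator `d` yields the new stable
  -- letter `t ^ d * k`.
  let S : AddSubgroup ℤ :=
    { carrier := {b | ∃ k ∈ K, t ^ b * k ∈ N₀}
      zero_mem' := ⟨1, K.one_mem, by simp⟩
      add_mem' := by
        rintro a b ⟨k, hk, hk'⟩ ⟨l, hl, hl'⟩
        have hz : t ^ (-b) * k * (t ^ (-b))⁻¹ ∈ K :=
          (conj_mem_of_mem_sup (H := ⊥) (fun h hh x hx => by
            rw [Subgroup.mem_bot.1 hh]; simpa using hx) hK.mem_iff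
            (Subgroup.mem_sup_right (Subgroup.zpow_mem_zpowers t _)) k).2 hk
        refine ⟨_, K.mul_mem hz hl, ?_⟩
        have := N₀.mul_mem hk' hl'
        rwa [show t ^ (a + b) * (t ^ (-b) * k * (t ^ (-b))⁻¹ * l) = t ^ a * k * (t ^ b * l) by
          group]
      neg_mem' := by
        rintro a ⟨k, hk, hk'⟩
        have hz : t ^ a * k⁻¹ * (t ^ a)⁻¹ ∈ K :=
          (conj_mem_of_mem_sup (H := ⊥) (fun h hh x hx => by
            rw [Subgroup.mem_bot.1 hh]; simpa using hx) hK.mem_iff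
            (Subgroup.mem_sup_right (Subgroup.zpow_mem_zpowers t _)) k⁻¹).2 (K.inv_mem hk)
        refine ⟨_, hz, ?_⟩
        have := N₀.inv_mem hk'
        rwa [show t ^ (-a) * (t ^ a * k⁻¹ * (t ^ a)⁻¹) = (t ^ a * k)⁻¹ by group] }
  obtain ⟨d, hd⟩ : ∃ d : ℕ, S = AddSubgroup.zmultiples (d : ℤ) := by
    obtain ⟨a, ha⟩ := Int.subgroup_cyclic S
    exact ⟨a.natAbs, by rw [Int.zmultiples_natAbs, AddSubgroup.zmultiples_eq_closure, ha]⟩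
  obtain ⟨m, hm, htm⟩ := Subgroup.exists_pow_mem_of_finiteIndex N₀ t
  have hmS : (m : ℤ) ∈ S := ⟨1, K.one_mem, by simpa using htm⟩
  have hd0 : d ≠ 0 := by
    rintro rfl
    rw [hd, Int.mem_zmultiples_iff] at hmS
    simp at hmS
    exact hm hmS
  obtain ⟨k, hk, hkN⟩ : (d : ℤ) ∈ S := hd ▸ AddSubgroup.mem_zmultiples _
  rw [zpow_natCast] at hkN
  have hKd := hK.pow hd0
  refine ⟨t ^ d * k, (hKd.congr fun x hx => ?_).inf_normal N₀, fun j hj hmem => ?_,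
    le_antisymm (fun x hx => ?_) (sup_le inf_le_right (Subgroup.zpowers_le.2 hkN))⟩
  · have h1 := hKc k hk x hx
    calc t ^ d * k * x * (t ^ d * k)⁻¹ = t ^ d * (k * x) * k⁻¹ * (t ^ d)⁻¹ := by group
      _ = t ^ d * x * (t ^ d)⁻¹ := by rw [h1]; group
  · obtain ⟨k', hk', h1⟩ := exists_mul_zpow_eq hKd.mem_iff hk j
    rw [zpow_natCast, zpow_natCast, ← pow_mul] at h1
    rw [h1] at hmem
    exact ht _ (mul_ne_zero hd0 hj) ((K.mul_mem_cancel_right hk').1 hmem)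
  · obtain ⟨b, l, hl, rfl⟩ := exists_zpow_mul_of_mem_sup hK.mem_iff (hN₀ hx)
    have hb : b ∈ S := ⟨l, hl, hx⟩
    rw [hd, Int.mem_zmultiples_iff] at hb
    obtain ⟨q, rfl⟩ := hb
    obtain ⟨k', hk', h1⟩ := exists_mul_zpow_eq hKd.mem_iff hk q
    rw [← zpow_natCast t d, ← zpow_mul, zpow_natCast] at h1
    have h2 : t ^ ((d : ℤ) * q) * l = (t ^ d * k) ^ q * (k'⁻¹ * l) := by rw [h1]; group
    rw [h2] at hx ⊢
    have h3 := N₀.zpow_mem hkN q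
    exact Subgroup.mul_mem _ (Subgroup.mem_sup_right ⟨q, rfl⟩) (Subgroup.mem_sup_left
      ⟨K.mul_mem (K.inv_mem hk') hl, (N₀.mul_mem_cancel_left h3).1 hx⟩)

/-- Splitting off an infinite cyclic quotient, when the contracting element is central modulo the
contracted subgroup. -/
theorem exists_isContracted_of_central {C L : Subgroup G} [hCn : C.Normal] {t : G}
    (hCc : ∀ x ∈ C, ∀ y ∈ C, x * y = y * x) (hL : L.FG) (hC : IsContracted C L t)
    (ht : ∀ k : ℕ, k ≠ 0 → t ^ k ∉ C) (hfi : (C ⊔ Subgroup.zpowers t).FiniteIndex)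
    (hcen : ∀ q : G ⧸ C, q * (t : G ⧸ C) = (t : G ⧸ C) * q) :
    ∃ (G₁ H₁ : Subgroup G) (u : G), G₁.Normal ∧ C ≤ G₁ ∧ C.relIndex G₁ ≠ 0 ∧
      G₁ ⊔ Subgroup.zpowers u = ⊤ ∧ (∀ k : ℕ, k ≠ 0 → u ^ k ∉ G₁) ∧ H₁.FG ∧
      IsContracted G₁ H₁ u := by
  set z : G ⧸ C := (t : G ⧸ C) with hz
  have hzfin : ∀ k : ℕ, k ≠ 0 → z ^ k ≠ 1 := fun k hk h1 =>
    ht k hk ((QuotientGroup.eq_one_iff (t ^ k)).1 h1)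
  have hZfi : (Subgroup.zpowers z).FiniteIndex := by
    constructor
    have h1 : (C ⊔ Subgroup.zpowers t).map (QuotientGroup.mk' C) = Subgroup.zpowers z := by
      rw [Subgroup.map_sup, QuotientGroup.map_mk'_self, bot_sup_eq, MonoidHom.map_zpowers]
      rfl
    rw [← h1]
    exact fun h0 => hfi.index_ne_zero (Nat.eq_zero_of_zero_dvd
      (h0 ▸ Subgroup.index_map_dvd _ (QuotientGroup.mk'_surjective C)))
  set n := (Subgroup.zpowers z).index with hn
  have hn0 : n ≠ 0 := hZfi.index_ne_zero
  let _ : CommGroup (Subgroup.zpowers z) := IsCyclic.commGroup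
  -- Transfer into a central subgroup of index `n` is the `n`-th power map. The pulled-back kernel
  -- `{x | xⁿ ∈ C}` is the normal subgroup sought: `C` has finite index in it, and the quotient is
  -- infinite cyclic.
  let f : G ⧸ C →* Subgroup.zpowers z := MonoidHom.transfer (MonoidHom.id (Subgroup.zpowers z))
  have hf : ∀ q, (f q : G ⧸ C) = q ^ n := fun q => by
    have := MonoidHom.transfer_eq_pow (MonoidHom.id (Subgroup.zpowers z)) q (fun k g₀ h => by
      obtain ⟨j, hj⟩ := h
      have hj : z ^ j = g₀⁻¹ * q ^ k * g₀ := hj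
      have h1 : Commute g₀ (z ^ j) := Commute.zpow_right (hcen g₀) j
      have h2 : q ^ k = g₀ * z ^ j * g₀⁻¹ := by rw [hj]; group
      rw [← hj, h2, h1.eq, mul_inv_cancel_right])
    exact congrArg Subtype.val this
  let F : G →* Subgroup.zpowers z := f.comp (QuotientGroup.mk' C)
  have hF : ∀ x, x ∈ F.ker ↔ x ^ n ∈ C := fun x => by
    rw [MonoidHom.mem_ker, ← QuotientGroup.eq_one_iff (N := C), QuotientGroup.mk_pow, ← hf]
    exact Subtype.ext_iff
  have hcyc : IsCyclic (G ⧸ F.ker) := isCyclic_of_injective _ (QuotientGroup.kerLift_injective F)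
  have htF : ∀ k : ℕ, k ≠ 0 → t ^ k ∉ F.ker := fun k hk => by
    rw [hF, ← pow_mul]
    exact ht _ (mul_ne_zero hk hn0)
  have hinf : Infinite (G ⧸ F.ker) := by
    by_contra h
    rw [not_infinite_iff_finite] at h
    have : F.ker.FiniteIndex := Subgroup.finiteIndex_of_finite_quotient
    obtain ⟨k, hk, hk'⟩ := Subgroup.exists_pow_mem_of_finiteIndex F.ker t
    exact htF k hk hk'
  have hCF : C ≤ F.ker := fun x hx => (hF x).2 (C.pow_mem hx n)
  have hrel : C.relIndex F.ker ≠ 0 := by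
    have h1 : ((C ⊔ Subgroup.zpowers t).subgroupOf F.ker).FiniteIndex := inferInstance
    have h2 : (C ⊔ Subgroup.zpowers t).subgroupOf F.ker ≤ C.subgroupOf F.ker := by
      rintro ⟨x, hx⟩ hx'
      obtain ⟨b, c, hc, rfl⟩ := exists_zpow_mul_of_mem_sup hC.mem_iff (Subgroup.mem_subgroupOf.1 hx')
      have h3 : t ^ b ∈ F.ker := (F.ker.mul_mem_cancel_right (hCF hc)).1 hx
      have h4 : b = 0 := by
        by_contra hb
        exact zpow_notMem_of_pow_notMem htF hb h3
      subst h4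
      rw [Subgroup.mem_subgroupOf]
      simpa using hc
    exact (Subgroup.finiteIndex_of_le h2).index_ne_zero
  -- The generator `u` is inverted if necessary, so that `uⁿ` agrees modulo `C` with a positive
  -- power of `t`; only positive powers of `t` are known to contract.
  obtain ⟨u, d, hd, hsup, huF, hud⟩ : ∃ (u : G) (d : ℕ), d ≠ 0 ∧ F.ker ⊔ Subgroup.zpowers u = ⊤ ∧
      (∀ k : ℕ, k ≠ 0 → u ^ k ∉ F.ker) ∧ (t ^ d)⁻¹ * u ^ n ∈ C := by
    obtain ⟨u, hsup, huF⟩ := exists_sup_zpowers_eq_top_of_isCyclic_quotient F.ker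
    replace huF := huF hinf
    obtain ⟨d, hd⟩ := (F u).2
    have hd : z ^ d = (u : G ⧸ C) ^ n := hd.trans (hf u)
    have hd0 : d ≠ 0 := by
      rintro rfl
      rw [zpow_zero] at hd
      refine huF 1 one_ne_zero ?_
      rw [pow_one, hF, ← QuotientGroup.eq_one_iff (N := C), QuotientGroup.mk_pow, ← hd]
    have hda : d.natAbs ≠ 0 := Int.natAbs_ne_zero.2 hd0
    rcases Int.natAbs_eq d with h | h
    · refine ⟨u, d.natAbs, hda, hsup, huF, QuotientGroup.eq.1 ?_⟩
      rw [QuotientGroup.mk_pow, QuotientGroup.mk_pow, ← hd, ← zpow_natCast, ← h]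
    · refine ⟨u⁻¹, d.natAbs, hda, by rwa [Subgroup.zpowers_inv], fun k hk hmem => huF k hk ?_,
        QuotientGroup.eq.1 ?_⟩
      · rwa [inv_pow, inv_mem_iff] at hmem
      · rw [QuotientGroup.mk_pow, QuotientGroup.mk_pow, QuotientGroup.mk_inv, inv_pow, ← hd,
          ← zpow_neg, ← zpow_natCast]
        congr 1
        omega
  have h1 : IsContracted C L (u ^ n) := (hC.pow hd).congr fun x hx => by
    have h3 := hCc _ hud x hx
    calc u ^ n * x * (u ^ n)⁻¹ = t ^ d * (((t ^ d)⁻¹ * u ^ n) * x) * ((t ^ d)⁻¹ * u ^ n)⁻¹ * (t ^ d)⁻¹ := by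
          group
      _ = t ^ d * x * (t ^ d)⁻¹ := by rw [h3]; group
  obtain ⟨L', hL', -, h2⟩ := h1.of_pow hn0 (conj_mem_iff_of_normal _ u) hL
  obtain ⟨H₁, hH₁, h3⟩ := h2.of_relIndex hCF hrel (conj_mem_iff_of_normal _ u) hL'
  exact ⟨F.ker, H₁, u, inferInstance, hCF, hrel, hsup, huF, hH₁, h3⟩

end

section

variable {G : Type u} [Group G]

/-- If the endomorphism is onto, `H` is normal with cyclic quotient, so the extension that fails to
be proper is polycyclic. -/
theorem IsProperlyAscendingHNN.or_isPolycyclic {B : Type} [Group B] (hB : IsPolycyclic B)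
    {H : Subgroup G} {u : G} (e : B ≃* H) (hA : IsAscending H u)
    (hsup : H ⊔ Subgroup.zpowers u = ⊤) : IsProperlyAscendingHNN B G ∨ IsPolycyclic G := by
  let ψ : H →* H := ((MulAut.conj u).toMonoidHom.comp H.subtype).codRestrict H
    fun x => hA.conj_mem x x.2
  have hψ : ∀ x, (ψ x : G) = u * x * u⁻¹ := fun _ => rfl
  have hψi : Injective ψ := fun x y hxy =>
    Subtype.ext (mul_left_cancel (mul_right_cancel (congrArg Subtype.val hxy)))
  let φ : B →* B := e.symm.toMonoidHom.comp (ψ.comp e.toMonoidHom)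
  have hφ : Injective φ := e.symm.injective.comp (hψi.comp e.injective)
  have hcomp : ∀ x, (e (φ x) : G) = u * e x * u⁻¹ := fun x => by
    change (e (e.symm (ψ (e x))) : G) = _
    rw [e.apply_symm_apply, hψ]
  by_cases hs : Surjective φ
  · right
    have hHn : H.Normal := by
      rw [← Subgroup.normalizer_eq_top_iff, eq_top_iff, ← hsup]
      refine sup_le Subgroup.le_normalizer ?_
      rw [Subgroup.zpowers_le, Subgroup.mem_normalizer_iff]
      refine fun x => ⟨fun hx => hA.conj_mem x hx, fun hx => ?_⟩
      obtain ⟨b, hb⟩ := hs (e.symm ⟨_, hx⟩)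
      have h1 := hcomp b
      rw [hb, e.apply_symm_apply] at h1
      have h2 : x = e b := mul_left_cancel (mul_right_cancel h1)
      rw [h2]
      exact (e b).2
    exact .of_sup_zpowers hsup (hB.of_surjective e.toMonoidHom e.surjective)
  · left
    exact ⟨φ, hφ, hs, nonempty_mulEquiv_ascendingHNN hA hsup e φ hφ hcomp⟩

variable [TorsionFree G] [HasHirsch G]

/-- The kernel of the map onto `ℤ` is contracted to a finitely generated, virtually abelian group of
length two, and torsion-freeness leaves only `ℤ²` and the Klein bottle group for it. -/
theorem isProperlyAscendingHNN_or_isPolycyclic_of_central {C L : Subgroup G} [hCn : C.Normal] {t : G}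
    (hCc : ∀ x ∈ C, ∀ y ∈ C, x * y = y * x) (hC2 : hirschLength C = 2) (hL : L.FG)
    (hC : IsContracted C L t)
    (ht : ∀ k : ℕ, k ≠ 0 → t ^ k ∉ C) (hfi : (C ⊔ Subgroup.zpowers t).FiniteIndex)
    (hcen : ∀ q : G ⧸ C, q * (t : G ⧸ C) = (t : G ⧸ C) * q) :
    (IsProperlyAscendingHNN (Multiplicative (ℤ × ℤ)) G ∨
      IsProperlyAscendingHNN KleinBottleGroup G) ∨ IsPolycyclic G := by
  obtain ⟨G₁, H₁, u, hG₁, hCG, hrel, hsup, hu, hH₁, hc⟩ :=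
    exists_isContracted_of_central hCc hL hC ht hfi hcen
  have hA : IsAscending H₁ u := ⟨hc.conj_mem, fun k hk h => hu k hk (hc.le h)⟩
  have hsup' : H₁ ⊔ Subgroup.zpowers u = ⊤ := hc.sup_zpowers_eq.trans hsup
  have hH2 : hirschLength H₁ = 2 := by
    rw [← hc.hirschLength_eq, ← hirschLength_eq_of_le_of_relIndex hCG hrel, hC2]
  have hfg : Group.FG H₁ := (Group.fg_iff_subgroup_fg H₁).2 hH₁
  have hfi₁ : (C.subgroupOf H₁).FiniteIndex := ⟨fun h0 =>
    hrel (Subgroup.relIndex_eq_zero_of_le_right hc.le h0)⟩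
  have hCfg : (C.subgroupOf H₁).FG :=
    (Group.fg_iff_subgroup_fg _).1 (Subgroup.fg_of_index_ne_zero _)
  rcases nonempty_mulEquiv_of_hirschLength_eq_two hH2 hCfg
    (fun x hx y hy => Subtype.ext (hCc x hx y hy)) with ⟨⟨e⟩⟩ | ⟨⟨e⟩⟩
  · exact (IsProperlyAscendingHNN.or_isPolycyclic .int_prod_int e hA hsup').imp_left Or.inl
  · exact (IsProperlyAscendingHNN.or_isPolycyclic .kleinBottleGroup e hA hsup').imp_left Or.inr

/-- The centralizer `P` of the image of `t` modulo `C` contains all commutators. Within `P` that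
image is central, so `P` is an extension of `ℤ²` or the Klein bottle group by a cyclic group. -/
theorem isPolycyclic_of_normal_zpowers [Group.FG G] {C : Subgroup G} [hCn : C.Normal] {t : G}
    (hCc : ∀ x ∈ C, ∀ y ∈ C, x * y = y * x) (hC2 : hirschLength C = 2) (hCfg : C.FG)
    (ht : ∀ k : ℕ, k ≠ 0 → t ^ k ∉ C) (hfi : (C ⊔ Subgroup.zpowers t).FiniteIndex)
    (hn : (Subgroup.zpowers (t : G ⧸ C)).Normal) : IsPolycyclic G := by
  set P := (Subgroup.centralizer (Subgroup.zpowers (t : G ⧸ C) : Set (G ⧸ C))).comap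
    (QuotientGroup.mk' C) with hP
  have hmem : ∀ x, x ∈ P ↔ (x : G ⧸ C) * t = t * x := by
    intro x
    rw [hP, Subgroup.mem_comap, Subgroup.mem_centralizer_iff]
    constructor
    · exact fun h => (h _ (Subgroup.mem_zpowers _)).symm
    · rintro h _ ⟨j, rfl⟩
      exact (Commute.zpow_right h j).eq.symm
  have htord : ¬ IsOfFinOrder (t : G ⧸ C) := by
    rw [isOfFinOrder_iff_pow_eq_one]
    rintro ⟨k, hk, hk'⟩
    exact ht k hk.ne' ((QuotientGroup.eq_one_iff (t ^ k)).1 hk')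
  have hcomm : commutator G ≤ P := by
    rw [commutator_def, Subgroup.commutator_le]
    intro x _ y _
    rw [hmem]
    exact commutatorElement_mul_comm_of_normal_zpowers htord x y
  have hCP : C ≤ P := fun x hx => by
    rw [hmem, (QuotientGroup.eq_one_iff x).2 hx, one_mul, mul_one]
  have htP : t ∈ P := (hmem t).2 rfl
  have hsupP : (C ⊔ Subgroup.zpowers t) ≤ P := sup_le hCP (Subgroup.zpowers_le.2 htP)
  have hmapC : (C.subgroupOf P).map P.subtype = C := by
    rw [Subgroup.subgroupOf_map_subtype, inf_eq_left.2 hCP]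
  have e := Subgroup.subgroupOfEquivOfLe hCP
  obtain ⟨G₁, -, u, hG₁, hCG, hrel, hsup, -⟩ :=
    exists_isContracted_of_central (C := C.subgroupOf P) (L := C.subgroupOf P) (t := ⟨t, htP⟩)
      (fun x hx y hy => Subtype.ext (hCc x hx y hy))
      ((Group.fg_iff_subgroup_fg _).1 (by
        have : Group.FG C := (Group.fg_iff_subgroup_fg C).2 hCfg
        exact Group.fg_of_surjective (f := e.symm.toMonoidHom) e.symm.surjective))
      (.refl (conj_mem_iff_of_normal _ _)) (fun k hk h => ht k hk h) (by
        have h1 : C.subgroupOf P ⊔ Subgroup.zpowers (⟨t, htP⟩ : P) =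
            (C ⊔ Subgroup.zpowers t).subgroupOf P := by
          apply Subgroup.map_injective P.subtype_injective
          rw [Subgroup.map_sup, hmapC, MonoidHom.map_zpowers, Subgroup.subgroupOf_map_subtype,
            inf_eq_left.2 hsupP]
          rfl
        rw [h1]
        infer_instance)
      (fun q => by
        induction q using QuotientGroup.induction_on with
        | H w =>
          have h1 := (hmem w).1 w.2
          rw [← QuotientGroup.mk_mul, ← QuotientGroup.mk_mul, QuotientGroup.eq] at h1 ⊢
          exact h1)
  refine .of_commutator_le hcomm (.of_sup_zpowers hsup ?_)
  have hfi₁ : ((C.subgroupOf P).subgroupOf G₁).FiniteIndex := ⟨hrel⟩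
  have e' := (Subgroup.subgroupOfEquivOfLe hCG).trans e
  have hfg' : ((C.subgroupOf P).subgroupOf G₁).FG := by
    have : Group.FG C := (Group.fg_iff_subgroup_fg C).2 hCfg
    exact (Group.fg_iff_subgroup_fg _).1 (Group.fg_of_surjective (f := e'.symm.toMonoidHom) e'.symm.surjective)
  have hG2 : hirschLength G₁ = 2 := by
    rw [← hirschLength_eq_of_finiteIndex ((C.subgroupOf P).subgroupOf G₁), hirschLength_congr e', hC2]
  rcases nonempty_mulEquiv_of_hirschLength_eq_two hG2 hfg'
    (fun x hx y hy => Subtype.ext (Subtype.ext (hCc _ hx _ hy))) with ⟨⟨f⟩⟩ | ⟨⟨f⟩⟩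
  · exact IsPolycyclic.int_prod_int.of_surjective f.toMonoidHom f.surjective
  · exact IsPolycyclic.kleinBottleGroup.of_surjective f.toMonoidHom f.surjective

/-- A power of `t` both contracts and fixes `⁅N₀, N₀⁆`, so this subgroup lies in `L` and is finitely
generated; `G` then inherits the maximal condition. Solvability follows from a finite-index subgroup
of nilpotency class at most two. -/
theorem isPolycyclic_of_pow_comm [Group.FG G] {N₀ K L : Subgroup G} [hN₀ : N₀.Normal] [N₀.FiniteIndex]
    {t : G} (h3 : hirschLength G = 3) (hKc : ∀ x ∈ K, ∀ y ∈ K, x * y = y * x) (hL : L.FG)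
    (hK : IsContracted K L t) (hN : N₀ = K ⊔ Subgroup.zpowers t) {k : ℕ} (hk : k ≠ 0)
    (hcom : ∀ x ∈ ⁅N₀, N₀⁆, t ^ k * x = x * t ^ k) : IsPolycyclic G := by
  have hNK : ⁅N₀, N₀⁆ ≤ K := by rw [hN]; exact commutator_sup_zpowers_le hK.mem_iff
  have hNL : ⁅N₀, N₀⁆ ≤ L := fun x hx => by
    obtain ⟨n, hn⟩ := (hK.pow hk).absorb x (hNK hx)
    have h1 : (t ^ k) ^ n * x = x * (t ^ k) ^ n := Commute.pow_left (hcom x hx) n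
    rwa [h1, mul_inv_cancel_right] at hn
  have hNfg : ⁅N₀, N₀⁆.FG :=
    hL.of_le_of_comm (fun x hx y hy => hKc x (hK.le hx) y (hK.le hy)) hNL
  have hmax : SubgroupsFG G := by
    have hmap : (commutator N₀).map N₀.subtype = ⁅N₀, N₀⁆ := by
      rw [commutator_def, Subgroup.map_commutator, ← MonoidHom.range_eq_map, Subgroup.range_subtype]
    have h1 : SubgroupsFG (commutator N₀) := by
      let e := ((commutator N₀).equivMapOfInjective N₀.subtype N₀.subtype_injective)
      have h2 : Group.FG ((commutator N₀).map N₀.subtype) :=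
        (Group.fg_iff_subgroup_fg _).2 (hmap ▸ hNfg)
      have h4 : Group.FG (commutator N₀) :=
        Group.fg_of_surjective (f := e.symm.toMonoidHom) e.symm.surjective
      refine .of_comm fun x y => Subtype.ext (Subtype.ext (hKc _ (hNK ?_) _ (hNK ?_))) <;>
      · rw [← hmap]
        exact Subgroup.mem_map_of_mem _ (Subtype.prop _)
    have h2 : SubgroupsFG (N₀ ⧸ commutator N₀) := by
      have : Group.FG (N₀ ⧸ commutator N₀) :=
        Group.fg_of_surjective (QuotientGroup.mk'_surjective (commutator N₀))
      exact .of_comm (QuotientGroup.mul_comm_of_commutator_le le_rfl)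
    have : SubgroupsFG N₀ := .of_extension (commutator N₀)
    exact .of_finiteIndex N₀
  set D := N₀ ⊓ Subgroup.centralizer (⁅N₀, N₀⁆ : Subgroup G) with hD
  have hKD : K ⊔ Subgroup.zpowers (t ^ k) ≤ D := by
    refine sup_le (fun x hx => ⟨hN ▸ Subgroup.mem_sup_left hx, ?_⟩)
      (Subgroup.zpowers_le.2 ⟨?_, ?_⟩)
    · exact Subgroup.mem_centralizer_iff.2 fun y hy => hKc y (hNK hy) x hx
    · exact N₀.pow_mem (hN ▸ Subgroup.mem_sup_right (Subgroup.mem_zpowers t)) k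
    · exact Subgroup.mem_centralizer_iff.2 fun y hy => (hcom y hy).symm
  have hDi : D.FiniteIndex := by
    have h1 := relIndex_sup_zpowers_pow_ne_zero hK.mem_iff hk
    rw [← hN] at h1
    constructor
    rw [← Subgroup.relIndex_mul_index (H := D) (K := N₀) inf_le_left]
    exact mul_ne_zero (fun h0 => h1 (Subgroup.relIndex_eq_zero_of_le_left hKD h0))
      Subgroup.FiniteIndex.index_ne_zero
  -- `D` centralizes `⁅N₀, N₀⁆`, which contains the commutators of `D`.
  have hsol : Group.IsSolvable G := by
    refine Group.isSolvable_of_finiteIndex_of_class_two (M := D) (SubgroupsFG.fg D) ?_ h3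
    intro x hx y hy z hz
    exact Subgroup.mem_centralizer_iff.1 hz.2 _ (Subgroup.commutator_mem_commutator hx.1 hy.1)
  exact .of_isSolvable

/-- The case of a group with a finite-index ascending HNN extension of an abelian group. -/
theorem isProperlyAscendingHNN_or_isPolycyclic {L : Subgroup G} {t : G}
    (h3 : hirschLength G = 3) (hL : L.FG) (hLc : ∀ x ∈ L, ∀ y ∈ L, x * y = y * x)
    (hA : IsAscending L t) (hfi : (L ⊔ Subgroup.zpowers t).FiniteIndex) :
    (IsProperlyAscendingHNN (Multiplicative (ℤ × ℤ)) G ∨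
      IsProperlyAscendingHNN KleinBottleGroup G) ∨ IsPolycyclic G := by
  have hfg : Group.FG G := Group.fg_of_finiteIndex_of_fg (hL.sup (Subgroup.fg_zpowers t))
  have hK' := isContracted_ascUnion hA.conj_mem
  have hK'c := hK'.mul_comm hLc
  rw [hK'.sup_zpowers_eq] at hfi
  set K' := ascUnion L t
  obtain ⟨N₀, hN₀n, hN₀i, hN₀⟩ : ∃ N₀ : Subgroup G, N₀.Normal ∧ N₀.FiniteIndex ∧
      N₀ ≤ K' ⊔ Subgroup.zpowers t :=
    ⟨_, inferInstance, inferInstance, Subgroup.normalCore_le (K' ⊔ Subgroup.zpowers t)⟩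
  obtain ⟨t₀, hK, ht₀, hN⟩ := exists_normalCore_eq_sup_zpowers hK' hK'c
    (hK'.pow_notMem hA.pow_notMem) hN₀
  have hL₀ : (L ⊓ N₀).FG := hL.of_le_of_comm hLc inf_le_left
  set K := K' ⊓ N₀ with hKdef
  have hKc : ∀ x ∈ K, ∀ y ∈ K, x * y = y * x := fun x hx y hy => hK'c x hx.1 y hy.1
  have ht₀K : ∀ k : ℕ, k ≠ 0 → t₀ ^ k ∉ K := fun k hk h => ht₀ k hk h.1
  have ht₀N : t₀ ∈ N₀ := hN ▸ Subgroup.mem_sup_right (Subgroup.mem_zpowers t₀)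
  -- If no power of `t₀` centralizes `⁅N₀, N₀⁆`, then `K` is exactly the centralizer of that
  -- subgroup in `N₀`, hence normal in `G`.
  by_cases hα : ∃ k : ℕ, k ≠ 0 ∧ ∀ x ∈ ⁅N₀, N₀⁆, t₀ ^ k * x = x * t₀ ^ k
  · obtain ⟨k, hk, hcom⟩ := hα
    exact Or.inr (isPolycyclic_of_pow_comm h3 hKc hL₀ hK hN hk hcom)
  have hNK : ⁅N₀, N₀⁆ ≤ K := by rw [hN]; exact commutator_sup_zpowers_le hK.mem_iff
  have hC₀ : ∀ x ∈ N₀, (∀ y ∈ ⁅N₀, N₀⁆, x * y = y * x) → x ∈ K := by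
    intro x hx hxy
    rw [hN] at hx
    obtain ⟨b, k, hk, rfl⟩ := exists_zpow_mul_of_mem_sup hK.mem_iff hx
    by_cases hb : b = 0
    · subst hb; simpa using hk
    · exfalso
      refine hα ⟨b.natAbs, Int.natAbs_ne_zero.2 hb, fun y hy => ?_⟩
      have h1 : Commute (t₀ ^ b * k) y := hxy y hy
      have h2 : Commute k⁻¹ y := Commute.inv_left (hKc k hk y (hNK hy))
      have h4 : Commute (t₀ ^ b) y := by simpa using h1.mul_left h2
      rcases Int.natAbs_eq b with h | h
      · rw [← zpow_natCast, ← h]; exact h4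
      · rw [h, zpow_neg, zpow_natCast, Commute.inv_left_iff] at h4
        exact h4
  obtain ⟨hinf, hCc⟩ := centralizer_comm_of_finiteIndex (K := K) (N := N₀) inf_le_right hKc hC₀ hNK
  have hKn : K.Normal := by
    have : K = N₀ ⊓ Subgroup.centralizer (⁅N₀, N₀⁆ : Subgroup G) := by
      refine le_antisymm (fun x hx => ⟨hx.2, Subgroup.mem_centralizer_iff.2 fun y hy =>
        hKc y (hNK hy) x hx⟩) (fun x hx => hC₀ x hx.1 fun y hy =>
        (Subgroup.mem_centralizer_iff.1 hx.2 y hy).symm)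
    rw [this]
    infer_instance
  set C := Subgroup.centralizer (K : Set G) with hC
  have hCn : C.Normal := inferInstance
  have hKC : K ≤ C := hinf ▸ inf_le_right
  have hrel : K.relIndex C ≠ 0 := by
    have h5 : (N₀.subgroupOf C).FiniteIndex := inferInstance
    rw [← hinf, Subgroup.inf_relIndex_right]
    exact h5.index_ne_zero
  have hC2 : hirschLength C = 2 := by
    rw [← hirschLength_eq_of_le_of_relIndex hKC hrel]
    have h5 := hirschLength_sup_zpowers hK.mem_iff ht₀K
    rw [← hN, hirschLength_eq_of_finiteIndex, h3] at h5
    exact ENat.add_left_injective_of_ne_top (n := 1) (by decide) h5.symm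
  have ht₀C : ∀ k : ℕ, k ≠ 0 → t₀ ^ k ∉ C := fun k hk hmem =>
    ht₀K k hk (hinf ▸ ⟨N₀.pow_mem ht₀N k, hmem⟩)
  have hle : N₀ ≤ C ⊔ Subgroup.zpowers t₀ := by
    nth_rw 1 [hN]
    exact sup_le_sup_right hKC _
  have hCfi : (C ⊔ Subgroup.zpowers t₀).FiniteIndex := Subgroup.finiteIndex_of_le hle
  obtain ⟨L₁, hL₁, hCL⟩ := hK.of_relIndex hKC hrel (conj_mem_iff_of_normal C t₀) hL₀
  have hzn : (Subgroup.zpowers (t₀ : G ⧸ C)).Normal := by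
    have h1 : N₀.map (QuotientGroup.mk' C) = Subgroup.zpowers (t₀ : G ⧸ C) := by
      rw [hN, Subgroup.map_sup, MonoidHom.map_zpowers]
      have : K.map (QuotientGroup.mk' C) = ⊥ := by
        rw [Subgroup.map_eq_bot_iff, QuotientGroup.ker_mk']
        exact hKC
      rw [this, bot_sup_eq]
      rfl
    rw [← h1]
    exact Subgroup.Normal.map inferInstance _ (QuotientGroup.mk'_surjective C)
  have hord : ¬ IsOfFinOrder (t₀ : G ⧸ C) := by
    rw [isOfFinOrder_iff_pow_eq_one]
    rintro ⟨k, hk, hk'⟩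
    exact ht₀C k hk.ne' ((QuotientGroup.eq_one_iff (t₀ ^ k)).1 hk')
  by_cases hcen : ∀ q : G ⧸ C, q * (t₀ : G ⧸ C) = (t₀ : G ⧸ C) * q
  · exact isProperlyAscendingHNN_or_isPolycyclic_of_central hCc hC2 hL₁ hCL ht₀C hCfi hcen
  right
  refine isPolycyclic_of_normal_zpowers hCc hC2 ?_ ht₀C hCfi hzn
  -- Some `w` inverts `t₀` modulo `C`. Conjugating the contraction by `w` shows that `t₀⁻¹`
  -- contracts `C` as well, so `C` equals a conjugate of the finitely generated `L₁`.
  push Not at hcen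
  obtain ⟨q, hq⟩ := hcen
  obtain ⟨w, rfl⟩ := QuotientGroup.mk_surjective q
  have hinv := (conj_eq_or_eq_inv_of_normal_zpowers hord (w : G ⧸ C)).resolve_left
    fun h => hq (mul_inv_eq_iff_eq_mul.1 h)
  have hwt : (w * t₀ * w⁻¹)⁻¹ * t₀⁻¹ ∈ C := QuotientGroup.eq.1 hinv
  have h6 : IsContracted C (L₁.map (MulAut.conj w).toMonoidHom) t₀⁻¹ :=
    (hCL.conj w).congr fun x hx => by
      have h7 := hCc _ hwt x hx
      calc t₀⁻¹ * x * t₀⁻¹⁻¹ = (w * t₀ * w⁻¹) * (((w * t₀ * w⁻¹)⁻¹ * t₀⁻¹) * x) *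
            ((w * t₀ * w⁻¹)⁻¹ * t₀⁻¹)⁻¹ * (w * t₀ * w⁻¹)⁻¹ := by group
        _ = w * t₀ * w⁻¹ * x * (w * t₀ * w⁻¹)⁻¹ := by rw [h7]; group
  rw [hCL.eq_of_inv hL₁ h6]
  exact hL₁.map_hom _

end

/-! ### Bases that are virtually abelian or Baumslag-Solitar groups -/

section

variable {G : Type u} [Group G]

/-- Any finite set of cosets in the union is pushed by one power of `t` into `H`, where it injects
into the cosets of `L`; so the index does not grow. -/
theorem relIndex_ascUnion_ne_zero {L H : Subgroup G} {t : G} (hL : ∀ x ∈ L, t * x * t⁻¹ ∈ L)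
    (hH : ∀ x ∈ H, t * x * t⁻¹ ∈ H) (hi : L.relIndex H ≠ 0) :
    (ascUnion L t).relIndex (ascUnion H t) ≠ 0 := by
  intro h0
  set Q := ascUnion H t ⧸ (ascUnion L t).subgroupOf (ascUnion H t)
  have hQ : Infinite Q := by
    by_contra h
    rw [not_infinite_iff_finite] at h
    exact (Subgroup.finiteIndex_of_finite_quotient
      (H := (ascUnion L t).subgroupOf (ascUnion H t))).index_ne_zero h0
  have hfin : Finite (H ⧸ L.subgroupOf H) := by
    have : (L.subgroupOf H).FiniteIndex := ⟨hi⟩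
    infer_instance
  obtain ⟨S, hS⟩ := Infinite.exists_subset_card_eq Q (Nat.card (H ⧸ L.subgroupOf H) + 1)
  have h1 : ∀ q : Q, ∃ n : ℕ, t ^ n * (q.out : ascUnion H t) * (t ^ n)⁻¹ ∈ H := fun q =>
    (mem_ascUnion hH).1 q.out.2
  choose ν hν using h1
  have hm : ∀ q ∈ S, t ^ S.sup ν * (q.out : ascUnion H t) * (t ^ S.sup ν)⁻¹ ∈ H := fun q hq =>
    conj_pow_mem_of_le hH (Finset.le_sup (f := ν) hq) (hν q)
  let f : S → H ⧸ L.subgroupOf H := fun q => ((⟨_, hm q q.2⟩ : H) : H ⧸ L.subgroupOf H)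
  have hf : Injective f := by
    intro p q hpq
    have h2 : (t ^ S.sup ν * ((p : Q).out : ascUnion H t) * (t ^ S.sup ν)⁻¹)⁻¹ *
        (t ^ S.sup ν * ((q : Q).out : ascUnion H t) * (t ^ S.sup ν)⁻¹) ∈ L :=
      (QuotientGroup.eq (s := L.subgroupOf H)).1 hpq
    have h3 : (((p : Q).out : ascUnion H t) : G)⁻¹ * ((q : Q).out : ascUnion H t) ∈ ascUnion L t :=
      (mem_ascUnion hL).2 ⟨S.sup ν, by simpa [mul_assoc] using h2⟩
    refine Subtype.ext ?_
    rw [← Quotient.out_eq' (p : Q), ← Quotient.out_eq' (q : Q)]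
    exact QuotientGroup.eq.2 h3
  have h4 := Nat.card_le_card_of_injective f hf
  rw [Nat.card_eq_fintype_card, Fintype.card_coe, hS] at h4
  omega

theorem relIndex_sup_zpowers_ne_zero {L H : Subgroup G} {t : G} (hL : ∀ x ∈ L, t * x * t⁻¹ ∈ L)
    (hH : ∀ x ∈ H, t * x * t⁻¹ ∈ H) (hi : L.relIndex H ≠ 0) :
    (L ⊔ Subgroup.zpowers t).relIndex (H ⊔ Subgroup.zpowers t) ≠ 0 := by
  rw [(isContracted_ascUnion hL).sup_zpowers_eq, (isContracted_ascUnion hH).sup_zpowers_eq]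
  obtain ⟨D, hD, -, hcov⟩ :=
    Subgroup.exists_finite_cover_of_relIndex_ne_zero (relIndex_ascUnion_ne_zero hL hH hi)
  refine Subgroup.relIndex_ne_zero_of_finite_cover hD fun x hx => ?_
  -- The inverse is decomposed so that in `x = k⁻¹ t⁻ᵇ` the part from the union stands on the left,
  -- next to the coset representative.
  obtain ⟨b, k, hk, hxk⟩ := exists_zpow_mul_of_mem_sup (isContracted_ascUnion hH).mem_iff
    (Subgroup.inv_mem _ hx)
  obtain ⟨d, hd, hdk⟩ := hcov _ (Subgroup.inv_mem _ hk)
  refine ⟨d, hd, ?_⟩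
  have h1 : d⁻¹ * x = d⁻¹ * k⁻¹ * t ^ (-b) := by
    rw [← inv_inv x, hxk]; group
  rw [h1]
  exact Subgroup.mul_mem _ (Subgroup.mem_sup_left hdk) (Subgroup.mem_sup_right ⟨_, rfl⟩)

/-- The base of an ascending HNN extension can be replaced by an abelian group if it is virtually
abelian. -/
theorem exists_isAscending_of_virtually_comm {H E : Subgroup G} {t : G} (hA : IsAscending H t)
    (hEH : E ≤ H) (hE : E.FG) (hEc : ∀ x ∈ E, ∀ y ∈ E, x * y = y * x) (hi : E.relIndex H ≠ 0) :
    ∃ L : Subgroup G, L.FG ∧ (∀ x ∈ L, ∀ y ∈ L, x * y = y * x) ∧ IsAscending L t ∧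
      (L ⊔ Subgroup.zpowers t).relIndex (H ⊔ Subgroup.zpowers t) ≠ 0 := by
  have hEfi : (E.subgroupOf H).FiniteIndex := ⟨hi⟩
  set m := (E.subgroupOf H).normalCore.index with hm
  have hm0 : m ≠ 0 := Subgroup.FiniteIndex.index_ne_zero
  have hpow : ∀ x ∈ H, x ^ m ∈ E := fun x hx =>
    (E.subgroupOf H).normalCore_le (Subgroup.pow_index_mem (E.subgroupOf H).normalCore ⟨x, hx⟩)
  -- The `m`-th powers generate a subgroup that every endomorphism of `H` preserves, which `E` need
  -- not be. The quotient of `E` by it is finitely generated abelian of finite exponent.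
  set L := Subgroup.closure ((fun x => x ^ m) '' (H : Set G)) with hL
  have hLE : L ≤ E := by
    rw [hL, Subgroup.closure_le]
    rintro _ ⟨x, hx, rfl⟩
    exact hpow x hx
  have hLA : IsAscending L t := by
    refine ⟨fun x hx => ?_, fun k hk h => hA.pow_notMem k hk (hEH (hLE h))⟩
    have h1 : L ≤ L.comap (MulAut.conj t).toMonoidHom := by
      rw [hL, Subgroup.closure_le]
      rintro _ ⟨x, hx, rfl⟩
      exact Subgroup.subset_closure ⟨t * x * t⁻¹, hA.conj_mem x hx, conj_pow⟩
    exact h1 hx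
  refine ⟨L, hE.of_le_of_comm hEc hLE, fun x hx y hy => hEc x (hLE hx) y (hLE hy), hLA, ?_⟩
  refine relIndex_sup_zpowers_ne_zero hLA.conj_mem hA.conj_mem
    (Subgroup.relIndex_ne_zero_trans (K := E) ?_ hi)
  have hEc' : ∀ x y : E, x * y = y * x := fun x y => Subtype.ext (hEc x x.2 y y.2)
  have hn : (L.subgroupOf E).Normal := ⟨fun z hz w => by
    rw [hEc' w z, mul_inv_cancel_right]; exact hz⟩
  have hEfg : Group.FG E := (Group.fg_iff_subgroup_fg E).2 hE
  have hQfg : Group.FG (E ⧸ L.subgroupOf E) :=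
    Group.fg_of_surjective (QuotientGroup.mk'_surjective _)
  have hfin : Finite (E ⧸ L.subgroupOf E) := by
    refine finite_of_comm_of_fg (fun x y => ?_) (fun x => ?_)
    · induction x using QuotientGroup.induction_on with
      | H x =>
        induction y using QuotientGroup.induction_on with
        | H y => rw [← QuotientGroup.mk_mul, hEc', QuotientGroup.mk_mul]
    · induction x using QuotientGroup.induction_on with
      | H x =>
        refine isOfFinOrder_iff_pow_eq_one.2 ⟨m, Nat.pos_of_ne_zero hm0, ?_⟩
        rw [← QuotientGroup.mk_pow, QuotientGroup.eq_one_iff]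
        exact Subgroup.subset_closure ⟨x, hEH x.2, rfl⟩
  exact (Subgroup.finiteIndex_of_finite_quotient (H := L.subgroupOf E)).index_ne_zero

theorem conj_eq_conj_of_mk_eq {A : Subgroup G} [A.Normal] (hA : ∀ x ∈ A, ∀ y ∈ A, x * y = y * x)
    {p q : G} (hpq : (p : G ⧸ A) = q) {x : G} (hx : x ∈ A) : p * x * p⁻¹ = q * x * q⁻¹ := by
  have h1 := hA _ (QuotientGroup.eq.1 hpq) x hx
  calc p * x * p⁻¹ = p * (x * (p⁻¹ * q)) * (p⁻¹ * q)⁻¹ * p⁻¹ := by group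
    _ = q * x * q⁻¹ := by rw [← h1]; group

variable [TorsionFree G] [HasHirsch G]

/-- Conjugation by the stable letter on a base that is a Baumslag-Solitar group. -/
theorem conj_mem_iff_and_inv_mul_conj_mem {H C : Subgroup G} {c u t : G} (hA : IsAscending H t)
    (hCc : ∀ x ∈ C, ∀ y ∈ C, x * y = y * x) (hC1 : hirschLength C = 1) (hHC : ⁅H, H⁆ ≤ C)
    (hself : ∀ x ∈ H, (∀ y ∈ C, x * y = y * x) → x ∈ C) (hc1 : c ≠ 1)
    (hu : IsContracted C (Subgroup.zpowers c) u) (huC : ∀ m : ℕ, m ≠ 0 → u ^ m ∉ C)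
    (hsup : C ⊔ Subgroup.zpowers u = H) :
    (∀ x ∈ H, t * x * t⁻¹ ∈ C ↔ x ∈ C) ∧ u⁻¹ * (t * u * t⁻¹) ∈ C := by
  have hCH : C ≤ H := hsup ▸ le_sup_left
  have huH : u ∈ H := hsup ▸ Subgroup.mem_sup_right (Subgroup.mem_zpowers u)
  have hcC : c ∈ C := hu.le (Subgroup.mem_zpowers c)
  have hcent : ∀ x ∈ H, ∀ y ∈ C, y ≠ 1 → x * y = y * x → x ∈ C := fun x hx y hy hy1 hxy =>
    hself x hx (commute_of_hirschLength_le_one hCc hC1.le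
      (fun w hw => conj_mem_of_commutator_le hHC hCH hx hw) hy hy1 hxy)
  have huC' : u ∉ C := by simpa using huC 1 one_ne_zero
  have hz1 : ⁅u, c⁆ ≠ 1 := fun h =>
    huC' (hcent u huH c hcC hc1 (commutatorElement_eq_one_iff_mul_comm.1 h))
  have hz : ⁅u, c⁆ ∈ C := hHC (Subgroup.commutator_mem_commutator huH (hCH hcC))
  have hφ : ∀ {x : G}, x ≠ 1 → t * x * t⁻¹ ≠ 1 := fun hx h => hx (by
    rwa [conj_eq_one_iff] at h)
  -- Conjugation by `t` keeps this nontrivial commutator in `C`. Since `C` is the centralizer in `H`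
  -- of each of its nontrivial elements, testing against it decides membership in `C` before and
  -- after conjugation.
  have htz : t * ⁅u, c⁆ * t⁻¹ ∈ C := by
    have h1 : t * ⁅u, c⁆ * t⁻¹ = ⁅t * u * t⁻¹, t * c * t⁻¹⁆ := by
      simp only [commutatorElement_def]; group
    rw [h1]
    exact hHC (Subgroup.commutator_mem_commutator (hA.conj_mem u huH) (hA.conj_mem c (hCH hcC)))
  have hiff : ∀ x ∈ H, t * x * t⁻¹ ∈ C ↔ x ∈ C := by
    intro x hx
    constructor
    · intro h
      have h1 : Commute (t * x * t⁻¹) (t * ⁅u, c⁆ * t⁻¹) := hCc _ h _ htz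
      rw [Commute.conj_iff] at h1
      exact hcent x hx _ hz hz1 h1
    · intro h
      have h1 : Commute x ⁅u, c⁆ := hCc _ h _ hz
      exact hcent _ (hA.conj_mem x hx) _ htz (hφ hz1) ((Commute.conj_iff t).2 h1)
  refine ⟨hiff, ?_⟩
  obtain ⟨r, hr⟩ := hu.conj_mem c (Subgroup.mem_zpowers c)
  have hr : c ^ r = u * c * u⁻¹ := hr
  have hy : t * c * t⁻¹ ∈ C := (hiff c (hCH hcC)).2 hcC
  obtain ⟨n, hn, j, hj⟩ := exists_pow_mem_zpowers_of_hirschLength_le_one hCc hC1.le hy hcC hc1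
  have hj : c ^ j = (t * c * t⁻¹) ^ n := hj
  -- In rank one, `u` acts by the same exponent `r` at every element of `C`. So `u` and `t u t⁻¹`
  -- act alike on `t c t⁻¹` and differ by an element of `C`.
  have h1 : u * (t * c * t⁻¹) * u⁻¹ = (t * c * t⁻¹) ^ r := by
    refine TorsionFree.eq_of_pow_eq hn (hCc _ ((hu.mem_iff _).2 hy) _ (C.zpow_mem hy r)) ?_
    rw [conj_pow, ← hj, ← conj_zpow, ← hr, ← zpow_mul, mul_comm, zpow_mul, hj, ← zpow_natCast,
      ← zpow_mul, mul_comm, zpow_mul, zpow_natCast]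
  have h2 : (t * u * t⁻¹) * (t * c * t⁻¹) * (t * u * t⁻¹)⁻¹ = (t * c * t⁻¹) ^ r := by
    rw [conj_zpow, hr]; group
  refine hcent _ (H.mul_mem (H.inv_mem huH) (hA.conj_mem u huH)) _ hy (hφ hc1) ?_
  rw [← mul_inv_eq_iff_eq_mul]
  calc u⁻¹ * (t * u * t⁻¹) * (t * c * t⁻¹) * (u⁻¹ * (t * u * t⁻¹))⁻¹
      = u⁻¹ * ((t * u * t⁻¹) * (t * c * t⁻¹) * (t * u * t⁻¹)⁻¹) * u := by group
    _ = t * c * t⁻¹ := by rw [h2, ← h1]; group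

end

section

variable {G : Type u} [Group G] [TorsionFree G] [HasHirsch G]

/-- The data of an ascending HNN extension of a Baumslag-Solitar group `⟨c, u⟩`, and the properties
of the union `A` of the conjugates of its rank-one normal subgroup `C`. -/
theorem exists_isContracted_of_isAscending {H C : Subgroup G} {c u t : G} (hA : IsAscending H t)
    (htop : H ⊔ Subgroup.zpowers t = ⊤)
    (hCc : ∀ x ∈ C, ∀ y ∈ C, x * y = y * x) (hC1 : hirschLength C = 1) (hHC : ⁅H, H⁆ ≤ C)
    (hself : ∀ x ∈ H, (∀ y ∈ C, x * y = y * x) → x ∈ C) (hc1 : c ≠ 1)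
    (hu : IsContracted C (Subgroup.zpowers c) u) (huC : ∀ m : ℕ, m ≠ 0 → u ^ m ∉ C)
    (hsup : C ⊔ Subgroup.zpowers u = H) :
    ∃ (A : Subgroup G) (g : G), A.Normal ∧ C ≤ A ∧ (∀ x ∈ A, ∀ y ∈ A, x * y = y * x) ∧
      hirschLength A = 1 ∧ commutator G ≤ A ∧ IsContracted A (Subgroup.zpowers c) g ∧
      (∀ m : ℕ, m ≠ 0 → g ^ m ∉ A) ∧ ∀ (x : G) (n : ℕ), n ≠ 0 → x ^ n ∈ A → x ∈ A := by
  have hCH : C ≤ H := hsup ▸ le_sup_left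
  have huH : u ∈ H := hsup ▸ Subgroup.mem_sup_right (Subgroup.mem_zpowers u)
  have hcC : c ∈ C := hu.le (Subgroup.mem_zpowers c)
  obtain ⟨hiff, hut⟩ := conj_mem_iff_and_inv_mul_conj_mem hA hCc hC1 hHC hself hc1 hu huC hsup
  have htC : ∀ x ∈ C, t * x * t⁻¹ ∈ C := fun x hx => (hiff x (hCH hx)).2 hx
  have hAt := isContracted_ascUnion htC
  set A := ascUnion C t with hAdef
  have hAc := hAt.mul_comm hCc
  have hA1 : hirschLength A = 1 := by rw [hAt.hirschLength_eq, hC1]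
  have hAn : A.Normal := by
    refine ⟨fun x hx y => ?_⟩
    refine (conj_mem_of_mem_sup (H := H) (g := t) (fun h hh x hx => ?_) hAt.mem_iff
      (htop ▸ Subgroup.mem_top y) x).2 hx
    rw [hAdef, mem_ascUnion htC] at hx ⊢
    obtain ⟨n, hn⟩ := hx
    refine ⟨n, ?_⟩
    have h1 := conj_mem_of_commutator_le hHC hCH (conj_pow_mem hA.conj_mem n hh) hn
    rwa [show t ^ n * h * (t ^ n)⁻¹ * (t ^ n * x * (t ^ n)⁻¹) * (t ^ n * h * (t ^ n)⁻¹)⁻¹ =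
      t ^ n * (h * x * h⁻¹) * (t ^ n)⁻¹ by group] at h1
  have hutA : (u : G ⧸ A) * (t : G ⧸ A) = t * u := by
    rw [← QuotientGroup.mk_mul, ← QuotientGroup.mk_mul, QuotientGroup.eq]
    have h1 := hAn.conj_mem _ (hAt.le hut) t⁻¹
    rwa [show t⁻¹ * (u⁻¹ * (t * u * t⁻¹)) * t⁻¹⁻¹ = (u * t)⁻¹ * (t * u) by group] at h1
  have hQtop : Subgroup.zpowers (u : G ⧸ A) ⊔ Subgroup.zpowers (t : G ⧸ A) = ⊤ := by
    have h1 := congrArg (Subgroup.map (QuotientGroup.mk' A)) htop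
    rw [← hsup, Subgroup.map_sup, Subgroup.map_sup, MonoidHom.map_zpowers, MonoidHom.map_zpowers,
      Subgroup.map_top_of_surjective _ (QuotientGroup.mk'_surjective A)] at h1
    have h2 : C.map (QuotientGroup.mk' A) = ⊥ := by
      rw [Subgroup.map_eq_bot_iff, QuotientGroup.ker_mk']
      exact hAt.le
    rwa [h2, bot_sup_eq] at h1
  have hQc : ∀ p q : G ⧸ A, p * q = q * p := fun p q =>
    mul_comm_of_mem_sup (mul_comm_of_mem_zpowers _) (mul_comm_of_mem_zpowers _) (by
      rintro _ ⟨i, rfl⟩ _ ⟨j, rfl⟩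
      exact Commute.zpow_zpow hutA i j) p (hQtop ▸ Subgroup.mem_top p) q
      (hQtop ▸ Subgroup.mem_top q)
  have hcommA : commutator G ≤ A := by
    rw [commutator_def, Subgroup.commutator_le]
    intro x _ y _
    rw [← QuotientGroup.eq_one_iff (N := A)]
    exact commutatorElement_eq_one_iff_mul_comm.2 (hQc x y)
  have hmem : ∀ {x y : G}, (x : G ⧸ A) = y → (x ∈ A ↔ y ∈ A) := fun {x y} h => by
    rw [← QuotientGroup.eq_one_iff (N := A), h, QuotientGroup.eq_one_iff]
  -- `G/A` is free abelian on the images of `u` and `t`; this will make `A` isolated and keep powers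
  -- of the contracting element out of `A`.
  have hind : ∀ a b : ℤ, u ^ a * t ^ b ∈ A → a = 0 ∧ b = 0 := by
    intro a b hab
    rw [hAdef, mem_ascUnion htC] at hab
    obtain ⟨n, hn⟩ := hab
    have h1 : t ^ n * u ^ a * (t ^ n)⁻¹ ∈ H := conj_pow_mem hA.conj_mem n (H.zpow_mem huH a)
    have h2 : t ^ b ∈ H := by
      have h3 := H.mul_mem (H.inv_mem h1) (hCH hn)
      rwa [show (t ^ n * u ^ a * (t ^ n)⁻¹)⁻¹ * (t ^ n * (u ^ a * t ^ b) * (t ^ n)⁻¹) =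
        t ^ (n : ℤ) * t ^ b * (t ^ (n : ℤ))⁻¹ by group, ← zpow_add, add_comm, zpow_add,
        mul_inv_cancel_right] at h3
    have hb : b = 0 := by
      by_contra hb
      exact zpow_notMem_of_pow_notMem hA.pow_notMem hb h2
    subst hb
    rw [zpow_zero, mul_one] at hn
    have h3 : ∀ (k : ℕ) (x : G), x ∈ H → t ^ k * x * (t ^ k)⁻¹ ∈ C → x ∈ C := by
      intro k
      induction k with
      | zero => intro x _ hx; simpa using hx
      | succ k ih =>
        intro x hx hxk
        refine ih x hx ((hiff _ (conj_pow_mem hA.conj_mem k hx)).1 ?_)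
        rwa [show t * (t ^ k * x * (t ^ k)⁻¹) * t⁻¹ = t ^ (k + 1) * x * (t ^ (k + 1))⁻¹ by
          rw [pow_succ']; group]
    refine ⟨?_, rfl⟩
    by_contra ha
    exact zpow_notMem_of_pow_notMem huC ha (h3 n _ (H.zpow_mem huH a) hn)
  -- `t` need not preserve the group of powers of `c`, but `v = uⁱ t` does. The contracting element
  -- is `u * v`: modulo `A` its powers separate, so `t` first brings an element into `C`, then `u`
  -- brings it into the powers of `c`, where `v` keeps it.
  obtain ⟨i, hi⟩ := hu.absorb _ (htC c hcC)
  set v := u ^ i * t with hv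
  have hvc : ∀ x ∈ Subgroup.zpowers c, v * x * v⁻¹ ∈ Subgroup.zpowers c := by
    rintro _ ⟨k, rfl⟩
    have h1 : v * c ^ k * v⁻¹ = (u ^ i * (t * c * t⁻¹) * (u ^ i)⁻¹) ^ k := by
      rw [← conj_zpow, hv]
      congr 1
      group
    change v * c ^ k * v⁻¹ ∈ _
    rw [h1]
    exact Subgroup.zpow_mem _ hi k
  have hact : ∀ {p q x : G}, (p : G ⧸ A) = q → x ∈ A → p * x * p⁻¹ = q * x * q⁻¹ :=
    fun hpq hx => conj_eq_conj_of_mk_eq hAc hpq hx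
  have hpow : ∀ (p q : G) (n : ℕ), (((p * q) ^ n : G) : G ⧸ A) = ((p ^ n * q ^ n : G) : G ⧸ A) :=
    fun p q n => by
      simp only [QuotientGroup.mk_pow, QuotientGroup.mk_mul]
      exact Commute.mul_pow (hQc p q) n
  have huC' : ∀ n x, x ∈ C → u ^ n * x * (u ^ n)⁻¹ ∈ C := fun n x hx =>
    (conj_pow_mem_iff hu.mem_iff n x).2 hx
  refine ⟨A, u * v, hAn, hAt.le, hAc, hA1, hcommA, ⟨hu.le.trans hAt.le, conj_mem_iff_of_normal A _,
    fun x hx => ?_, fun x hx => ?_⟩, fun m hm hmA => ?_, fun x n hn hxn => ?_⟩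
  · have h1 := hu.conj_mem _ (hvc x hx)
    rwa [show u * (v * x * v⁻¹) * u⁻¹ = u * v * x * (u * v)⁻¹ by group] at h1
  · obtain ⟨n, hn⟩ := hAt.absorb x hx
    have h1 : (u * v) ^ n * x * ((u * v) ^ n)⁻¹ ∈ C := by
      rw [hact (q := u ^ n * ((u ^ i) ^ n * t ^ n)) ?_ hx]
      · have h2 := huC' n _ (huC' (i * n) _ hn)
        rw [pow_mul] at h2
        rwa [show u ^ n * ((u ^ i) ^ n * (t ^ n * x * (t ^ n)⁻¹) * ((u ^ i) ^ n)⁻¹) * (u ^ n)⁻¹ =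
          u ^ n * ((u ^ i) ^ n * t ^ n) * x * (u ^ n * ((u ^ i) ^ n * t ^ n))⁻¹ by group] at h2
      · rw [hpow, QuotientGroup.mk_mul, hv, hpow, ← QuotientGroup.mk_mul]
    obtain ⟨m, hm⟩ := hu.absorb _ h1
    refine ⟨m + n, ?_⟩
    have h2 := conj_pow_mem hvc m hm
    rw [show v ^ m * (u ^ m * ((u * v) ^ n * x * ((u * v) ^ n)⁻¹) * (u ^ m)⁻¹) * (v ^ m)⁻¹ =
      (v ^ m * u ^ m) * ((u * v) ^ n * x * ((u * v) ^ n)⁻¹) * (v ^ m * u ^ m)⁻¹ by group] at h2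
    rw [hact (q := (u * v) ^ m) ?_ (hAt.le h1)] at h2
    · rw [pow_add]
      rwa [show (u * v) ^ m * ((u * v) ^ n * x * ((u * v) ^ n)⁻¹) * ((u * v) ^ m)⁻¹ =
        (u * v) ^ m * (u * v) ^ n * x * ((u * v) ^ m * (u * v) ^ n)⁻¹ by group] at h2
    · rw [hpow, QuotientGroup.mk_mul, QuotientGroup.mk_mul, hQc]
  · have h1 : (((u * v) ^ m : G) : G ⧸ A) = ((u ^ ((m + i * m : ℕ) : ℤ) * t ^ (m : ℤ) : G) : G ⧸ A) := by
      rw [hpow, QuotientGroup.mk_mul, hv, hpow, ← QuotientGroup.mk_mul, zpow_natCast, zpow_natCast,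
        pow_add, pow_mul, mul_assoc]
    have h2 := hind _ _ ((hmem h1).1 hmA)
    exact hm (by exact_mod_cast h2.2)
  · obtain ⟨b, q, ⟨a, rfl⟩, hxq⟩ := exists_zpow_mul_of_mem_sup
      (K := Subgroup.zpowers (u : G ⧸ A)) (t := (t : G ⧸ A)) (fun y => by
        rw [hQc (t : G ⧸ A) y, mul_inv_cancel_right]) (hQtop ▸ Subgroup.mem_top (x : G ⧸ A))
    have hx : (x : G ⧸ A) = ((u ^ a * t ^ b : G) : G ⧸ A) := by
      rw [hxq, hQc]; rfl
    have hxn' : ((x ^ n : G) : G ⧸ A) = ((u ^ (a * n) * t ^ (b * n) : G) : G ⧸ A) := by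
      rw [QuotientGroup.mk_pow, hx, ← QuotientGroup.mk_pow, hpow, zpow_mul, zpow_mul, zpow_natCast,
        zpow_natCast]
    have h2 := hind _ _ ((hmem hxn').1 hxn)
    have hn' : (n : ℤ) ≠ 0 := by exact_mod_cast hn
    have ha := (mul_eq_zero.1 h2.1).resolve_right hn'
    have hb := (mul_eq_zero.1 h2.2).resolve_right hn'
    rw [hmem hx, ha, hb, zpow_zero, zpow_zero, mul_one]
    exact A.one_mem

/-- When the union is not self-centralizing, the group virtually is an ascending HNN extension of an
abelian group. -/
theorem exists_isAscending_of_centralizing [Group.FG G] {A : Subgroup G} {c g y : G} [hAn : A.Normal]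
    (h3 : hirschLength G = 3) (hAc : ∀ x ∈ A, ∀ y ∈ A, x * y = y * x) (hA1 : hirschLength A = 1)
    (hcomm : commutator G ≤ A) (hg : IsContracted A (Subgroup.zpowers c) g)
    (hiso : ∀ (x : G) (n : ℕ), n ≠ 0 → x ^ n ∈ A → x ∈ A)
    (hgA : ∀ m : ℕ, m ≠ 0 → ∃ x ∈ A, g ^ m * x ≠ x * g ^ m)
    (hy : ∀ x ∈ A, y * x = x * y) (hyA : y ∉ A) :
    ∃ (L : Subgroup G) (s : G), L.FG ∧ (∀ x ∈ L, ∀ y ∈ L, x * y = y * x) ∧ IsAscending L s ∧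
      (L ⊔ Subgroup.zpowers s).FiniteIndex := by
  have hcA : c ∈ A := hg.le (Subgroup.mem_zpowers c)
  have haA : y⁻¹ * (g * y * g⁻¹) ∈ A := by
    have h1 : y⁻¹ * (g * y * g⁻¹) = ⁅y⁻¹, g⁆ := by rw [commutatorElement_def]; group
    rw [h1]
    refine hcomm ?_
    rw [commutator_def]
    exact Subgroup.commutator_mem_commutator (Subgroup.mem_top _) (Subgroup.mem_top _)
  obtain ⟨n, hn⟩ := hg.absorb _ haA
  -- `g y g⁻¹ = y a` with `a ∈ A`. The conjugate `d` of `c` is taken far enough back that `a` is a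
  -- power of `d`, and then `g` carries the abelian group generated by `d` and `y` into itself.
  set d := (g ^ n)⁻¹ * c * g ^ n with hd
  have hdmem : ∀ x, x ∈ Subgroup.zpowers d ↔ g ^ n * x * (g ^ n)⁻¹ ∈ Subgroup.zpowers c := by
    intro x
    have h1 : ∀ k : ℤ, d ^ k = (g ^ n)⁻¹ * c ^ k * g ^ n := fun k => by
      have := conj_zpow (a := (g ^ n)⁻¹) (b := c) (i := k)
      rw [inv_inv] at this
      rw [hd, this]
    constructor
    · rintro ⟨k, rfl⟩
      refine ⟨k, ?_⟩
      change c ^ k = g ^ n * d ^ k * (g ^ n)⁻¹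
      rw [h1]; group
    · rintro ⟨k, hk⟩
      refine ⟨k, ?_⟩
      have hk : c ^ k = g ^ n * x * (g ^ n)⁻¹ := hk
      change d ^ k = x
      rw [h1, hk]; group
  have hdA : Subgroup.zpowers d ≤ A := by
    rw [Subgroup.zpowers_le, hd]
    simpa using hAn.conj_mem c hcA (g ^ n)⁻¹
  have hgd : ∀ x ∈ Subgroup.zpowers d, g * x * g⁻¹ ∈ Subgroup.zpowers d := by
    intro x hx
    rw [hdmem] at hx ⊢
    have h1 := hg.conj_mem _ hx
    rwa [show g * (g ^ n * x * (g ^ n)⁻¹) * g⁻¹ = (g * g ^ n) * x * (g * g ^ n)⁻¹ by group,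
      ← pow_succ', pow_succ, show g ^ n * g * x * (g ^ n * g)⁻¹ = g ^ n * (g * x * g⁻¹) * (g ^ n)⁻¹ by
      group] at h1
  have hyd : ∀ x, y * x * y⁻¹ ∈ Subgroup.zpowers d ↔ x ∈ Subgroup.zpowers d := by
    intro x
    constructor
    · intro hx
      have h1 := hy _ (hdA hx)
      have h3 : y * x * y⁻¹ = x := mul_left_cancel (a := y) (by rw [h1]; group)
      rwa [h3] at hx
    · intro hx
      rwa [hy x (hdA hx), mul_inv_cancel_right]
  set L := Subgroup.zpowers d ⊔ Subgroup.zpowers y with hL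
  have hLc : ∀ x ∈ L, ∀ y ∈ L, x * y = y * x :=
    mul_comm_of_mem_sup (mul_comm_of_mem_zpowers d) (mul_comm_of_mem_zpowers y) (by
      rintro x hx _ ⟨j, rfl⟩
      exact (Commute.zpow_left (hy x (hdA hx)) j).eq.symm)
  have hLfg : L.FG := (Subgroup.fg_zpowers d).sup (Subgroup.fg_zpowers y)
  have hyk : ∀ k : ℕ, k ≠ 0 → y ^ k ∉ A := fun k hk h => hyA (hiso y k hk h)
  have hLA : IsAscending L g := by
    constructor
    · have h1 : L ≤ L.comap (MulAut.conj g).toMonoidHom := by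
        refine sup_le (fun x hx => Subgroup.mem_sup_left (hgd x hx)) ?_
        rw [Subgroup.zpowers_le]
        have h2 := L.mul_mem (Subgroup.mem_sup_right (Subgroup.mem_zpowers y))
          (Subgroup.mem_sup_left ((hdmem _).2 hn))
        rwa [mul_inv_cancel_left] at h2
      exact fun x hx => h1 hx
    · intro k hk hmem
      obtain ⟨b, e, he, hke⟩ := exists_zpow_mul_of_mem_sup hyd hmem
      obtain ⟨x, hx, hne⟩ := hgA k hk
      refine hne ?_
      rw [hke]
      exact Commute.mul_left (Commute.zpow_left (hy x hx) b) (hAc e (hdA he) x hx)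
  refine ⟨L, g, hLfg, hLc, hLA, ?_⟩
  have hd1 : d ≠ 1 := by
    rintro h1
    have hc1 : c = 1 := by
      have h2 : c = g ^ n * d * (g ^ n)⁻¹ := by rw [hd]; group
      rw [h2, h1]; group
    have h2 := hg.hirschLength_eq
    rw [hA1, hc1, Subgroup.zpowers_one_eq_bot, hirschLength_eq_zero_of_finite] at h2
    exact one_ne_zero h2
  have hL2 : hirschLength L = 1 + 1 := by
    rw [hL, hirschLength_sup_zpowers hyd (fun k hk h => hyk k hk (hdA h)),
      hirschLength_zpowers (TorsionFree.not_isOfFinOrder hd1)]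
  have hN3 := hLA.hirschLength_eq
  rw [hL2] at hN3
  set N := L ⊔ Subgroup.zpowers g with hN
  -- Containing `A`, the subgroup `N` contains all commutators and is normal. Its length is already
  -- three, so the quotient is a finitely generated torsion abelian group.
  have hAN : A ≤ N := by
    intro x hx
    obtain ⟨m, hm⟩ := hg.absorb x hx
    have hgN : g ∈ N := Subgroup.mem_sup_right (Subgroup.mem_zpowers g)
    have h1 : (g ^ n)⁻¹ * (g ^ m * x * (g ^ m)⁻¹) * g ^ n ∈ N := by
      refine Subgroup.mem_sup_left (Subgroup.mem_sup_left ((hdmem _).2 ?_))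
      rwa [show g ^ n * ((g ^ n)⁻¹ * (g ^ m * x * (g ^ m)⁻¹) * g ^ n) * (g ^ n)⁻¹ =
        g ^ m * x * (g ^ m)⁻¹ by group]
    have h2 := N.mul_mem (N.mul_mem (N.inv_mem (N.pow_mem hgN m)) (N.mul_mem (N.mul_mem
      (N.pow_mem hgN n) h1) (N.inv_mem (N.pow_mem hgN n)))) (N.pow_mem hgN m)
    rwa [show (g ^ m)⁻¹ * (g ^ n * ((g ^ n)⁻¹ * (g ^ m * x * (g ^ m)⁻¹) * g ^ n) * (g ^ n)⁻¹) * g ^ m =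
      x by group] at h2
  have hNn : N.Normal := .of_commutator_le _ (hcomm.trans hAN)
  have h0 := hirschLength_eq_add N
  rw [h3, hN3] at h0
  have h1 : hirschLength (G ⧸ N) = 0 :=
    (ENat.add_right_injective_of_ne_top (n := 1 + 1 + 1) (by decide)
      (show (1 + 1 + 1 : ℕ∞) + 0 = 1 + 1 + 1 + hirschLength (G ⧸ N) from h0)).symm
  have hQfg : Group.FG (G ⧸ N) := Group.fg_of_surjective (QuotientGroup.mk'_surjective N)
  have : Finite (G ⧸ N) := finite_of_comm_of_fg
    (QuotientGroup.mul_comm_of_commutator_le (hcomm.trans hAN))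
    (isOfFinOrder_of_hirschLength_eq_zero h1)
  exact Subgroup.finiteIndex_of_finite_quotient

end

/-! ### The classification in Hirsch length three -/

theorem IsContracted.map {G : Type u} {K : Type v} [Group G] [Group K] {A L : Subgroup G} {g : G}
    (h : IsContracted A L g) (f : G →* K) :
    IsContracted (A.map f) (L.map f) (f g) where
  le := Subgroup.map_mono h.le
  mem_iff x := by
    constructor
    · rintro ⟨y, hy, hyx⟩
      refine ⟨g⁻¹ * y * g, ?_, ?_⟩
      · rw [SetLike.mem_coe, ← h.mem_iff]
        simpa [mul_assoc] using hy
      · rw [map_mul, map_mul, map_inv, hyx]; group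
    · rintro ⟨y, hy, rfl⟩
      exact ⟨_, (h.mem_iff y).2 hy, by simp⟩
  conj_mem := by
    rintro _ ⟨x, hx, rfl⟩
    exact ⟨_, h.conj_mem x hx, by simp⟩
  absorb := by
    rintro _ ⟨x, hx, rfl⟩
    obtain ⟨n, hn⟩ := h.absorb x hx
    exact ⟨n, _, hn, by simp⟩

theorem mul_comm_of_mem_map {G : Type u} {K : Type v} [Group G] [Group K] {A : Subgroup G}
    (h : ∀ x ∈ A, ∀ y ∈ A, x * y = y * x) (f : G →* K) :
    ∀ x ∈ A.map f, ∀ y ∈ A.map f, x * y = y * x := by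
  rintro _ ⟨x, hx, rfl⟩ _ ⟨y, hy, rfl⟩
  rw [← map_mul, h x hx y hy, map_mul]

theorem hirschLength_map {G : Type u} {K : Type u} [Group G] [HasHirsch G] [Group K] (A : Subgroup G)
    (f : G →* K) (hf : Injective f) : hirschLength (A.map f) = hirschLength A :=
  (hirschLength_congr (A.equivMapOfInjective f hf)).symm

section

variable {G : Type u} [Group G] [TorsionFree G] [HasHirsch G]

/-- An ascending HNN extension of a constructible group of Hirsch length two is virtually an
ascending HNN extension of an abelian group, or has a self-centralizing rank-one normal subgroup
with abelian quotient. -/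
theorem IsAscending.exists_base_comm_or_exists_normal {H : Subgroup G} {t : G}
    (hA : IsAscending H t) (htop : H ⊔ Subgroup.zpowers t = ⊤) (hc : IsConstructible H)
    (h2 : hirschLength H = 2) :
    (∃ (L : Subgroup G) (s : G), L.FG ∧ (∀ x ∈ L, ∀ y ∈ L, x * y = y * x) ∧ IsAscending L s ∧
      (L ⊔ Subgroup.zpowers s).FiniteIndex) ∨
    Group.FG G ∧ ∃ (A L : Subgroup G) (g : G), (∀ x ∈ A, ∀ y ∈ A, x * y = y * x) ∧
      hirschLength A = 1 ∧ commutator G ≤ A ∧ (∀ x, (∀ y ∈ A, x * y = y * x) → x ∈ A) ∧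
      L.FG ∧ IsContracted A L g ∧ ∀ m : ℕ, m ≠ 0 → g ^ m ∉ A := by
  have h3 : hirschLength G = 3 := by
    have h := hA.hirschLength_eq
    rw [htop, h2, hirschLength_congr Subgroup.topEquiv] at h
    rw [h]; rfl
  rcases hc.of_hirschLength_eq_two h2 with ⟨L, hLi, hL, hLc⟩ |
    ⟨C₀, c₀, u₀, -, hCc, hC1, hcomm, hself, hc1, hu, huC, hsup⟩
  · left
    have hle : L.map H.subtype ≤ H := Subgroup.map_subtype_le L
    obtain ⟨E, hE, hEc, hEA, hi⟩ := exists_isAscending_of_virtually_comm hA hle (Subgroup.FG.map_hom hL _)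
      (mul_comm_of_mem_map hLc _) (by
        rw [Subgroup.relIndex, Subgroup.subgroupOf,
          Subgroup.comap_map_eq_self_of_injective H.subtype_injective]
        exact hLi.index_ne_zero)
    rw [htop, Subgroup.relIndex_top_right] at hi
    exact ⟨E, t, hE, hEc, hEA, ⟨hi⟩⟩
  set C := C₀.map H.subtype with hCdef
  set c : G := H.subtype c₀ with hcdef
  set u : G := H.subtype u₀ with hudef
  replace hCc : ∀ x ∈ C, ∀ y ∈ C, x * y = y * x := mul_comm_of_mem_map hCc _
  replace hC1 : hirschLength C = 1 := (hirschLength_map _ _ H.subtype_injective).trans hC1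
  have hHC : ⁅H, H⁆ ≤ C := H.map_subtype_commutator ▸ Subgroup.map_mono hcomm
  replace hself : ∀ x ∈ H, (∀ y ∈ C, x * y = y * x) → x ∈ C := fun x hx h =>
    ⟨⟨x, hx⟩, hself ⟨x, hx⟩ fun y hy => Subtype.ext (h y ⟨y, hy, rfl⟩), rfl⟩
  replace hc1 : c ≠ 1 := fun h => hc1 (H.subtype_injective (by rw [← hcdef, h, map_one]))
  replace hu : IsContracted C (Subgroup.zpowers c) u := by
    have := hu.map H.subtype
    rwa [MonoidHom.map_zpowers] at this
  have huH : u ∈ H := u₀.2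
  replace huC : ∀ m : ℕ, m ≠ 0 → u ^ m ∉ C := by
    rintro m hm ⟨x, hx, hxu⟩
    refine huC m hm ?_
    rwa [← H.subtype_injective (hxu.trans (map_pow _ _ _).symm)]
  replace hsup : C ⊔ Subgroup.zpowers u = H := by
    rw [sup_zpowers_map, hsup, ← MonoidHom.range_eq_map, Subgroup.range_subtype]
  obtain ⟨A, g, hAn, hCA, hAc, hA1, hAcomm, hg, hgA, hiso⟩ :=
    exists_isContracted_of_isAscending hA htop hCc hC1 hHC hself hc1 hu huC hsup
  have hfg : Group.FG G := by
    rw [Group.fg_def, ← htop, ← hsup, ← hu.sup_zpowers_eq]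
    exact ((Subgroup.fg_zpowers c).sup (Subgroup.fg_zpowers u)).sup (Subgroup.fg_zpowers t)
  by_cases hs : ∀ x, (∀ y ∈ A, x * y = y * x) → x ∈ A
  · exact .inr ⟨hfg, A, _, g, hAc, hA1, hAcomm, hs, Subgroup.fg_zpowers c, hg, hgA⟩
  · left
    push Not at hs
    obtain ⟨y, hy, hyA⟩ := hs
    refine exists_isAscending_of_centralizing h3 hAc hA1 hAcomm hg hiso (fun m hm => ?_) hy hyA
    -- A power of `g` centralizing `A` would force `A`, hence also `C`, to consist of the powers of
    -- `c`. Then `u²` centralizes `C`, although no proper power of `u` lies in `C`.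
    by_contra! hcon
    have hAL := hg.eq_of_pow_comm hm hcon
    have hCc' : C = Subgroup.zpowers c := le_antisymm (hCA.trans hAL.le) hu.le
    have h4 := sq_mul_comm_of_conj_mem_zpowers (c := c) (u := u) (hCc' ▸ hu.mem_iff)
    refine huC 2 two_ne_zero (hself _ (H.pow_mem huH 2) fun x hx => ?_)
    rw [hCc'] at hx
    obtain ⟨k, rfl⟩ := hx
    exact Commute.zpow_right h4 k

/-- A torsion-free constructible group of Hirsch length three is one of the standard examples. -/
theorem IsConstructible.classification_of_hirschLength_eq_three (h : IsConstructible G)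
    (h3 : hirschLength G = 3) :
    (∃ n : ℤ, n ≠ 0 ∧ n ≠ 1 ∧ n ≠ -1 ∧
      ∃ θ : MulAut (BaumslagSolitar 1 n),
        Nonempty (G ≃* BaumslagSolitar 1 n ⋊[zpowersHom (MulAut (BaumslagSolitar 1 n)) θ]
          Multiplicative ℤ)) ∨
    (IsProperlyAscendingHNN (Multiplicative (ℤ × ℤ)) G ∨
      IsProperlyAscendingHNN KleinBottleGroup G) ∨
    IsPolycyclic G := by
  obtain ⟨H, t, hA, hi, hc, hH⟩ := h.exists_isAscending_of_hirschLength_eq_add_one (a := 2)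
    (by rw [h3]; rfl)
  set N := H ⊔ Subgroup.zpowers t with hN
  have hHN : H ≤ N := le_sup_left
  have htN : t ∈ N := Subgroup.mem_sup_right (Subgroup.mem_zpowers t)
  have e := (Subgroup.subgroupOfEquivOfLe hHN).symm
  have hA' : IsAscending (H.subgroupOf N) (⟨t, htN⟩ : N) :=
    ⟨fun x hx => hA.conj_mem x hx, fun k hk hm => hA.pow_notMem k hk hm⟩
  rcases hA'.exists_base_comm_or_exists_normal (subgroupOf_sup_zpowers_eq_top htN)
    (hc.of_mulEquiv e) ((hirschLength_congr e).symm.trans hH) with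
    ⟨L, s, hL, hLc, hLA, hLi⟩ | ⟨hfg, A, L, g, hAc, hA1, hcomm, hself, hL, hg, hgA⟩
  · refine .inr (isProperlyAscendingHNN_or_isPolycyclic h3 (Subgroup.FG.map_hom hL N.subtype)
      (mul_comm_of_mem_map hLc _) (hLA.map N.subtype N.subtype_injective) ⟨?_⟩)
    rw [sup_zpowers_map, Subgroup.index_map_subtype]
    exact mul_ne_zero hLi.index_ne_zero hi.index_ne_zero
  · have hfgG : Group.FG G := Group.fg_of_finiteIndex_of_fg ((Group.fg_iff_subgroup_fg N).1 hfg)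
    -- The rank-one subgroup found in the finite-index subgroup `N` is traded for one that is normal
    -- and self-centralizing in `G` itself.
    obtain ⟨C, hCn, hCc, hC1, hCcomm, hCself, g', L', hL', hg', hgC'⟩ :=
      exists_normal_of_hirschLength_eq_one (N := N) (K := A.map N.subtype)
        (Subgroup.map_subtype_le A) (mul_comm_of_mem_map hAc _)
        ((hirschLength_map _ _ N.subtype_injective).trans hA1)
        (N.map_subtype_commutator ▸ Subgroup.map_mono hcomm)
        (fun x hx hxy => ⟨⟨x, hx⟩, hself ⟨x, hx⟩ fun y hy =>
          Subtype.ext (hxy y ⟨y, hy, rfl⟩), rfl⟩)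
        (Subgroup.FG.map_hom hL N.subtype) (hg.map N.subtype) (by
          rintro m hm ⟨x, hx, hxg⟩
          refine hgA m hm ?_
          rwa [← N.subtype_injective (hxg.trans (map_pow _ _ _).symm)])
    obtain ⟨c, u, r, hc1, hr, hu, huC, hiso⟩ :=
      exists_isContracted_zpowers hCc hC1 hCcomm hCself hL' hg' hgC'
    rcases semidirectProduct_or_isPolycyclic hCc hC1 hCcomm hc1 hr hu huC hiso h3 with h | h
    · exact .inl h
    · exact .inr (.inr h)

end

theorem mainTheorem4 (G : Type u) [Group G]
    (htf : ∀ g : G, IsOfFinOrder g → g = 1)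
    (hea : IsElementaryAmenable G)
    (hh : HasHirschLength G 3) :
    IsConstructible G ↔
      (∃ n : ℤ, n ≠ 0 ∧ n ≠ 1 ∧ n ≠ -1 ∧
        ∃ θ : MulAut (BaumslagSolitar 1 n),
          Nonempty (G ≃* BaumslagSolitar 1 n ⋊[zpowersHom (MulAut (BaumslagSolitar 1 n)) θ]
            Multiplicative ℤ)) ∨
      (IsProperlyAscendingHNN (Multiplicative (ℤ × ℤ)) G ∨
        IsProperlyAscendingHNN KleinBottleGroup G) ∨
      IsPolycyclic G := by
  constructor
  · intro h
    have : TorsionFree G := ⟨htf⟩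
    have : HasHirsch G := ⟨3, hh⟩
    exact h.classification_of_hirschLength_eq_three hh.eq_hirschLength.symm
  · rintro (⟨n, -, -, -, θ, ⟨e⟩⟩ | (h | h) | h)
    · exact .of_mulEquiv_semidirectProduct e
    · exact h.isConstructible .int_prod_int
    · exact h.isConstructible .kleinBottleGroup
    · exact h.isConstructible
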